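/- Let $v(x)=|x|^{-1}$ or $v(x)=-|x|^{-1}$ on $\mathbb{R}^3$, and put $v^{(N)}=N^{-2/3}v$. For every $A,D>0$ there are constants $K,C>0$, depending only on $A$ and $D$, such that the following holds for every $N\ge 1$, every real external field $w\in L^2_{\mathrm{loc}}(\mathbb{R}^3)$ (which may depend on $N$) and every $0<T\le\infty$. Let $\varphi_1^t,\dots,\varphi_N^t\in L^2(\mathbb{R}^3)$, $t\in[0,T)$, be $L^2$-continuous (distributional) solutions of the fermionic Hartree equations $$ i\partial_t\varphi_j^t=\big(-\Delta+w+v^{(N)}\star\rho_N^t\big)\varphi_j^t,\qquad \rho_N^t=\sum_{i=1}^N|\varphi_i^t|^2,\qquad j=1,\dots,N, $$ with orthonormal initial data $\varphi_1^0,\dots,\varphi_N^0$, and assume that for all $t\in[0,T)$ $$ \sum_{i=1}^N\|\nabla\varphi_i^t\|^2\le AN,\qquad \|\rho_N^t\|_\infty\le D. $$ Then: (1) for all $t\in[0,T)$, $$\sup_{y\in\mathbb{R}^3}\Big(\big(v^{(N)}\big)^2\star\rho_N^t\Big)(y)\le K N^{-1};$$ (2) suppose moreover that the Hamiltonian $$H^N=\sum_{j=1}^N\big(-\Delta_{x_j}+w(x_j)\big)+\sum_{1\le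 i<j\le N}v^{(N)}(x_i-x_j),$$ defined as the closure in $L^2(\mathbb{R}^{3N})$ of this expression on $C_c^\infty(\mathbb{R}^{3N})$, is self-adjoint, and let $\psi^t\in L^2(\mathbb{R}^{3N})$, $t\in[0,T)$, be a solution of $i\partial_t\psi^t=H^N\psi^t$ (i.e. $\psi^t=e^{-iH^Nt}\psi^0$) with normalized antisymmetric initial datum $\psi^0\in L^2(\mathbb{R}^{3N})$. Then for all $t\in[0,T)$ $$ \alpha_n(t)\le e^{Ct}\,\alpha_n(0)+\big(e^{Ct}-1\big)N^{-1}. $$ Here $$\alpha_n(t)=\sum_{k=0}^N\frac{k}{N}\,\big\langle\psi^t,P_{N,k}\psi^t\big\rangle,\qquad P_{N,k}=\sum_{\substack{a\in\{0,1\}^N\\ a_1+\dots+a_N=k}}\ \prod_{m=1}^N (p_m)^{1-a_m}(q_m)^{a_m},$$ where $q_m=1-p_m$ and $p_m=\sum_{j=1}^N|\varphi_j^t\rangle\langle\varphi_j^t|_m$ acts on the $m$-th variable: $$(p_m\psi)(x_1,\dots,x_N)=\sum_{j=1}^N\varphi_j^t(x_m)\int_{\mathbb{R}^3}\overline{\varphi_j^t(y)}\,\psi(x_1,\dots,x_{m-1},y,x_{m+1},\dots,x_N)\,dy.$$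 -/

import Mathlib

open MeasureTheory ComplexConjugate
open scoped ENNReal

noncomputable section

/-- Physical space `ℝ³`. -/
abbrev Pos : Type := EuclideanSpace ℝ (Fin 3)

/-- Configurations `(x_1, …, x_N) ∈ ℝ^{3N}` of `N` particles, with (product) Lebesgue measure. -/
abbrev Config (N : ℕ) : Type := Fin N → Pos

/-- The one-particle Hilbert space `L²(ℝ³, ℂ)`. -/
abbrev OneBody : Type := Lp ℂ 2 (volume : Measure Pos)

/-- The `N`-particle Hilbert space `L²(ℝ^{3N}, ℂ)`. -/
abbrev ManyBody (N : ℕ) : Type := Lp ℂ 2 (volume : Measure (Config N))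

/-- The time interval `[0, T)`, where `T = ∞` is allowed. -/
def timeInterval (T : EReal) : Set ℝ := {t : ℝ | 0 ≤ t ∧ (t : EReal) < T}

/-- Smooth compactly supported complex-valued functions. -/
def IsTestFunction {E : Type*} [NormedAddCommGroup E] [NormedSpace ℝ E] (η : E → ℂ) : Prop :=
  ContDiff ℝ ((⊤ : ℕ∞) : WithTop ℕ∞) η ∧ HasCompactSupport η

/-- Real-valued (measurable) functions that are square integrable on every compact set. -/
def IsLocallySquareIntegrable (w : Pos → ℝ) : Prop :=
  ∀ K : Set Pos, IsCompact K → MemLp w 2 (volume.restrict K)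

/-! ### Kinetic energy -/

/-- `G = (G_1, G_2, G_3)` is the weak gradient of `φ`. -/
def IsWeakGradient (φ : OneBody) (G : Fin 3 → OneBody) : Prop :=
  ∀ η : Pos → ℂ, IsTestFunction η → ∀ k : Fin 3,
    ∫ x, fderiv ℝ η x (EuclideanSpace.single k 1) * φ x = -∫ x, η x * G k x

/-- `‖∇φ‖²`, with value `∞` if `φ` is not in the Sobolev space `H¹(ℝ³)`. (The weak gradient is
unique if it exists, so that the infimum is over at most one `G`.) -/
def gradNormSq (φ : OneBody) : ℝ≥0∞ :=
  ⨅ (G : Fin 3 → OneBody) (_ : IsWeakGradient φ G), ENNReal.ofReal (∑ k, ‖G k‖ ^ 2)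

/-- The total kinetic energy `∑ᵢ ‖∇φᵢ‖²` of the orbitals. -/
def kineticEnergy {N : ℕ} (φ : Fin N → OneBody) : ℝ≥0∞ := ∑ i, gradNormSq (φ i)

/-! ### Interaction, density and the fermionic Hartree equations -/

/-- The scaled interaction `N^{-β} v`. -/
def scaledInteraction (β : ℝ) (N : ℕ) (v : Pos → ℝ) (x : Pos) : ℝ := (N : ℝ) ^ (-β) * v x

/-- The density `ρ(x) = ∑ᵢ |φᵢ(x)|²`. -/
def density {N : ℕ} (φ : Fin N → OneBody) (x : Pos) : ℝ := ∑ i, ‖φ i x‖ ^ 2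

/-- The mean field `(v ⋆ ρ)(x)`. -/
def meanField {N : ℕ} (v : Pos → ℝ) (φ : Fin N → OneBody) (x : Pos) : ℝ :=
  ∫ y, v (x - y) * density φ y

/-- `sup_y (v² ⋆ ρ)(y)`, as an element of `[0, ∞]`. -/
def supSqConvDensity {N : ℕ} (v : Pos → ℝ) (φ : Fin N → OneBody) : ℝ≥0∞ :=
  ⨆ y : Pos, ∫⁻ x, ENNReal.ofReal (v (y - x) ^ 2 * density φ x)

/-- `φ = (φ_1, …, φ_N)` is an `L²`-continuous solution on `[0, T)` of the fermionic Hartree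
equations `i ∂ₜ φ_j = (-Δ + w + v ⋆ ρ) φ_j`, which hold in the sense of distributions: for all
test functions `η` one has `d/dt ⟨η, φ_j⟩ = -i ⟨(-Δ + w + v ⋆ ρ) η, φ_j⟩`. -/
def IsHartreeSolution {N : ℕ} (w v : Pos → ℝ) (T : EReal) (φ : ℝ → Fin N → OneBody) : Prop :=
  ∀ j : Fin N, ContinuousOn (fun t => φ t j) (timeInterval T) ∧
    ∀ η : Pos → ℂ, IsTestFunction η → ∀ t ∈ timeInterval T,
      HasDerivWithinAt (fun s => ∫ x, conj (η x) * φ s j x)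
        (-Complex.I * ∫ x, conj (-(Laplacian.laplacian η x)
          + ((w x + meanField v (φ t) x : ℝ) : ℂ) * η x) * φ t j x)
        (timeInterval T) t

/-! ### The Hamiltonian and the Schrödinger equation -/

/-- The Laplacian `Δ_{x_j}` in the `j`-th particle variable. -/
def particleLaplacian {N : ℕ} (j : Fin N) (η : Config N → ℂ) (x : Config N) : ℂ :=
  Laplacian.laplacian (fun y : Pos => η (Function.update x j y)) (x j)

/-- The differential expression
`(∑_j (-Δ_{x_j} + w(x_j)) + ∑_{i<j} v(x_i - x_j)) η`. -/
def hamiltonianExpr {N : ℕ} (w v : Pos → ℝ) (η : Config N → ℂ) (x : Config N) : ℂ :=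
  ∑ j, (-(particleLaplacian j η x) + (w (x j) : ℂ) * η x)
    + (∑ i, ∑ j ∈ Finset.Ioi i, (v (x i - x j) : ℂ)) * η x

lemma particleLaplacian_add {N : ℕ} (j : Fin N) {η₁ η₂ : Config N → ℂ}
    (h₁ : IsTestFunction η₁) (h₂ : IsTestFunction η₂) (x : Config N) :
    particleLaplacian j (η₁ + η₂) x = particleLaplacian j η₁ x + particleLaplacian j η₂ x := by
  have hu : ContDiff ℝ 2 (fun y : Pos => Function.update x j y) := contDiff_update 2 x j
  have e₁ : ContDiff ℝ 2 (fun y : Pos => η₁ (Function.update x j y)) :=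
    (h₁.1.of_le ENat.LEInfty.out).comp hu
  have e₂ : ContDiff ℝ 2 (fun y : Pos => η₂ (Function.update x j y)) :=
    (h₂.1.of_le ENat.LEInfty.out).comp hu
  exact ContDiffAt.laplacian_add e₁.contDiffAt e₂.contDiffAt

lemma particleLaplacian_smul {N : ℕ} (j : Fin N) (c : ℂ) {η : Config N → ℂ}
    (h : IsTestFunction η) (x : Config N) :
    particleLaplacian j (c • η) x = c * particleLaplacian j η x := by
  have hu : ContDiff ℝ 2 (fun y : Pos => Function.update x j y) := contDiff_update 2 x j
  have e : ContDiff ℝ 2 (fun y : Pos => η (Function.update x j y)) :=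
    (h.1.of_le ENat.LEInfty.out).comp hu
  exact InnerProductSpace.laplacian_smul c e.contDiffAt

lemma hamiltonianExpr_add {N : ℕ} (w v : Pos → ℝ) {η₁ η₂ : Config N → ℂ}
    (h₁ : IsTestFunction η₁) (h₂ : IsTestFunction η₂) :
    hamiltonianExpr w v (η₁ + η₂) = hamiltonianExpr w v η₁ + hamiltonianExpr w v η₂ := by
  funext x
  simp only [hamiltonianExpr, Pi.add_apply, particleLaplacian_add _ h₁ h₂,
    Finset.sum_add_distrib, Finset.sum_neg_distrib, mul_add]
  ring

lemma hamiltonianExpr_smul {N : ℕ} (w v : Pos → ℝ) (c : ℂ) {η : Config N → ℂ}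
    (h : IsTestFunction η) :
    hamiltonianExpr w v (c • η) = c • hamiltonianExpr w v η := by
  funext x
  simp only [hamiltonianExpr, Pi.smul_apply, smul_eq_mul, particleLaplacian_smul _ c h,
    mul_add, Finset.mul_sum]
  congr 1
  · exact Finset.sum_congr rfl fun j _ => by ring
  · rw [Finset.sum_mul, Finset.sum_mul, Finset.mul_sum]
    exact Finset.sum_congr rfl fun j _ => by ring

lemma isTestFunction_zero {N : ℕ} : IsTestFunction (0 : Config N → ℂ) :=
  ⟨contDiff_const, HasCompactSupport.zero⟩

/-- The graph of the differential expression on test functions (those which it maps to `L²`). -/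
def hamiltonianGraph {N : ℕ} (w v : Pos → ℝ) : Submodule ℂ (ManyBody N × ManyBody N) where
  carrier := {p | ∃ η : Config N → ℂ, IsTestFunction η ∧
    p.1 =ᵐ[volume] η ∧ p.2 =ᵐ[volume] hamiltonianExpr w v η}
  add_mem' := by
    rintro p q ⟨η₁, h₁, a₁, b₁⟩ ⟨η₂, h₂, a₂, b₂⟩
    refine ⟨η₁ + η₂, ⟨h₁.1.add h₂.1, h₁.2.add h₂.2⟩, ?_, ?_⟩
    · exact (Lp.coeFn_add _ _).trans (a₁.add a₂)
    · rw [hamiltonianExpr_add w v h₁ h₂]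
      exact (Lp.coeFn_add _ _).trans (b₁.add b₂)
  zero_mem' := by
    refine ⟨0, isTestFunction_zero, Lp.coeFn_zero _ _ _, ?_⟩
    have : hamiltonianExpr w v (0 : Config N → ℂ) = 0 := by
      simpa using hamiltonianExpr_smul w v (0 : ℂ) (isTestFunction_zero (N := N))
    rw [this]
    exact Lp.coeFn_zero _ _ _
  smul_mem' := by
    rintro c p ⟨η, h, a, b⟩
    refine ⟨c • η, ⟨h.1.const_smul c, h.2.smul_left (f := fun _ => c)⟩, ?_, ?_⟩
    · exact (Lp.coeFn_smul _ _).trans (a.const_smul c)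
    · rw [hamiltonianExpr_smul w v c h]
      exact (Lp.coeFn_smul _ _).trans (b.const_smul c)

/-- `hamiltonianGraph` is the graph of an operator, because test functions are continuous. -/
lemma hamiltonianGraph_functional {N : ℕ} (w v : Pos → ℝ) (p : ManyBody N × ManyBody N)
    (hp : p ∈ hamiltonianGraph w v) (h0 : p.1 = 0) : p.2 = 0 := by
  obtain ⟨η, h, a, b⟩ := hp
  rw [h0] at a
  have h1 : η =ᵐ[volume] (0 : Config N → ℂ) := a.symm.trans (Lp.coeFn_zero _ _ _)
  have h2 : η = 0 := (Continuous.ae_eq_iff_eq volume h.1.continuous continuous_zero).1 h1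
  have h3 : hamiltonianExpr w v (0 : Config N → ℂ) = 0 := by
    simpa using hamiltonianExpr_smul w v (0 : ℂ) (isTestFunction_zero (N := N))
  rw [h2, h3] at b
  exact Lp.ext (b.trans (Lp.coeFn_zero _ _ _).symm)

/-- The `N`-particle Hamiltonian `∑_j (-Δ_{x_j} + w(x_j)) + ∑_{i<j} v(x_i - x_j)`, an unbounded
operator in `L²(ℝ^{3N})`: the closure of the differential expression on test functions. -/
def hamiltonian (N : ℕ) (w v : Pos → ℝ) : ManyBody N →ₗ.[ℂ] ManyBody N :=
  (hamiltonianGraph w v).toLinearPMap.closure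

/-- `ψ` is an `L²`-continuous solution of `i ∂ₜ ψ = H ψ` on `[0, T)`: for all `η` in the domain
of `H` one has `d/dt ⟨η, ψ⟩ = -i ⟨H η, ψ⟩`. For self-adjoint `H` these are exactly the functions
`ψ(t) = e^{-iHt} ψ(0)` with arbitrary `ψ(0) ∈ L²`. -/
def IsSchrodingerSolution {N : ℕ} (H : ManyBody N →ₗ.[ℂ] ManyBody N) (T : EReal)
    (ψ : ℝ → ManyBody N) : Prop :=
  ContinuousOn ψ (timeInterval T) ∧
    ∀ η : H.domain, ∀ t ∈ timeInterval T,
      HasDerivWithinAt (fun s => inner ℂ (η : ManyBody N) (ψ s))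
        (-Complex.I * inner ℂ (H η) (ψ t)) (timeInterval T) t

/-- Antisymmetry of an `N`-particle wave function under permutations of the particles. -/
def IsAntisymmetric {N : ℕ} (ψ : ManyBody N) : Prop :=
  ∀ σ : Equiv.Perm (Fin N), ∀ᵐ x : Config N,
    ψ (fun i => x (σ i)) = ((Equiv.Perm.sign σ : ℤ) : ℂ) * ψ x

/-! ### The counting functional -/

/-- The operator `p_m = ∑_j |φ_j⟩⟨φ_j|_m`, i.e.
`(p_m ψ)(x_1, …, x_N) = ∑_j φ_j(x_m) ∫ conj (φ_j(y)) ψ(…, y, …) dy` with `y` in the `m`-th place. -/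
def projP {N : ℕ} (φ : Fin N → OneBody) (m : Fin N) (ψ : Config N → ℂ) (x : Config N) : ℂ :=
  ∑ j, φ j (x m) * ∫ y : Pos, conj (φ j y) * ψ (Function.update x m y)

/-- The operator `q_m = 1 - p_m`. -/
def projQ {N : ℕ} (φ : Fin N → OneBody) (m : Fin N) (ψ : Config N → ℂ) (x : Config N) : ℂ :=
  ψ x - projP φ m ψ x

/-- The operator `P_{N,k}`: the sum over all `k`-element sets `S` of particle labels of the
product over `m = 1, …, N` of the factors `q_m` (if `m ∈ S`) and `p_m` (if `m ∉ S`). -/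
def projPNk {N : ℕ} (φ : Fin N → OneBody) (k : ℕ) (ψ : Config N → ℂ) (x : Config N) : ℂ :=
  ∑ S ∈ Finset.powersetCard k (Finset.univ : Finset (Fin N)),
    (List.finRange N).foldr
      (fun m χ => if m ∈ S then projQ φ m χ else projP φ m χ) ψ x

/-- The counting functional `α_f = ∑_{k=0}^N f(k) ⟨ψ, P_{N,k} ψ⟩` for a weight `f`. (The scalar
products are real; we take the real part only to get a real number.) -/
def alphaFunctional {N : ℕ} (f : ℕ → ℝ) (ψ : ManyBody N) (φ : Fin N → OneBody) : ℝ :=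
  ∑ k ∈ Finset.range (N + 1), f k * (∫ x, conj (ψ x) * projPNk φ k ψ x).re

/-- The functional `α_n`, with weight `n(k) = k / N`. -/
def alphaN {N : ℕ} (ψ : ManyBody N) (φ : Fin N → OneBody) : ℝ :=
  alphaFunctional (fun k => (k : ℝ) / (N : ℝ)) ψ φ

end

/-! Part (1). Let `ρ` be the density and split `|x|⁻² ⋆ ρ` at a radius `R`. The inner part is at
most `4π D R` because `ρ ≤ D`, the outer part at most `N / R²` because `∫ ρ = N`. With the prefactor
`N^(-4/3)` and `R = N^(1/3)` both are of order `N⁻¹` (`interactionBound_coulomb`). The total mass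
`N` comes from orthonormality of the orbitals at time `t`. For distributional solutions with `w`
merely locally square integrable this needs an argument (`HartreeBound.inner_eq`): the scalar
products are localized and mollified. The commutator with the Laplacian is then of the order of the
inverse cutoff radius, by finiteness of the kinetic energy. The commutator with the potential is
controlled by its mean oscillation at the mollifier scale, by `‖φ_i‖_∞ ≤ √D`.

Part (2). Write `p`, `q` for `p_0`, `q_0`, and let `κ = K / N` be the bound of part (1). By
antisymmetry `α_n = ‖qψ‖²` (`alphaN_eq_norm_sq`). Since `p` evolves with `-Δ + w + v ⋆ ρ`, all
one-particle terms cancel in the time derivative, and `α' = 2 Im ⟨ψ, W p ψ⟩` with `W = ∑_{j ≠ 0}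
v(x_0 - x_j) - (v ⋆ ρ)(x_0)`. As `⟨pψ, W pψ⟩` is real, only `⟨qψ, W pψ⟩` matters. Estimating the
terms of `W` one by one loses a power of `N`; the gain comes from antisymmetry.

Insert `1 = p_j + q_j` to the left of each `v(x_0 - x_j)`. The mean field minus the `p_j` part is
`∑_k ⟨F_k, 𝒜 (φ_k ⊗ pψ)⟩`, where `𝒜 = 1 - ∑_j τ_j`, `τ_j` exchanges the extra variable with `x_j`,
and `F_k(z, x) = v(x_0 - z) φ_k(z) (qψ)(x)`. On functions antisymmetric in the `x_j` the form of `𝒜`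
is nonnegative, so Cauchy–Schwarz applies to it. The form at `φ_k ⊗ pψ`, summed over `k`, is `N
‖pψ‖² - ∑_j ⟨pψ, p_j pψ⟩ ≤ N α + 1`: the other particles already occupy almost all orbitals
(`norm_inner_meanField_sub_le`). For the `q_j` part, the square of `∑_j q_j v(x_0 - x_j) pψ` is
expanded: diagonal terms gain `1 / (N - 1)` by antisymmetry, and in off-diagonal terms both `q`'s
can be moved onto `ψ` (`norm_sum_orbCoproj_interProj_sq_le`). Each part is at most `√(N κ) (α + 1 /
N)`, so Grönwall gives the rate `C = 4 √(N κ) = 4 √K`.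

The derivative has to be justified for arbitrary `ψ` in `L²`. On test functions the commutator of
`p` with the Hamiltonian is computed by hand. Since `W p` is bounded, the formula extends to the
closure of the graph (`hasDerivAt_inner_apply_of_mem_closure`). Forward time averages of `ψ` lie in
the domain, and they are used to run Grönwall before the averaging is removed
(`WeakSolution.gronwall`). -/

noncomputable section

/-! ### Tensor products with one-particle functions -/

/-- The complex Hilbert space `L²(X)`. -/
abbrev SqInt (X : Type*) [MeasureSpace X] : Type _ := Lp ℂ 2 (volume : Measure X)

instance sigmaFinite_volume_prod {X Y : Type*} [MeasureSpace X] [MeasureSpace Y]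
    [SigmaFinite (volume : Measure X)] [SigmaFinite (volume : Measure Y)] :
    SigmaFinite (volume : Measure (X × Y)) :=
  inferInstanceAs (SigmaFinite ((volume : Measure X).prod (volume : Measure Y)))

section Tensor

variable {X : Type*} [MeasureSpace X]

lemma inner_eq_integral {Y : Type*} [MeasureSpace Y] (f g : SqInt Y) :
    inner ℂ f g = ∫ x, conj (f x) * g x := by
  rw [L2.inner_def]
  simp only [RCLike.inner_apply']

lemma inner_eq_integral_of_ae {Y : Type*} [MeasureSpace Y] {f g : SqInt Y} {f' g' : Y → ℂ}
    (hf : f =ᵐ[volume] f') (hg : g =ᵐ[volume] g') :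
    inner ℂ f g = ∫ x, conj (f' x) * g' x := by
  rw [inner_eq_integral]
  refine integral_congr_ae ?_
  filter_upwards [hf, hg] with x h1 h2
  rw [h1, h2]

lemma norm_sq_eq_integral {Y : Type*} [MeasureSpace Y] {F : SqInt Y} {F' : Y → ℂ}
    (h : F =ᵐ[volume] F') : ‖F‖ ^ 2 = ∫ z, ‖F' z‖ ^ 2 := by
  have h2 := inner_eq_integral_of_ae h h
  rw [inner_self_eq_norm_sq_to_K] at h2
  have h3 : (∫ x, conj (F' x) * F' x) = ((∫ z, ‖F' z‖ ^ 2 : ℝ) : ℂ) := by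
    rw [← integral_complex_ofReal]
    refine integral_congr_ae (Filter.Eventually.of_forall fun x => ?_)
    simp only [Complex.conj_mul', Complex.ofReal_pow]
  rw [h3] at h2
  exact Complex.ofReal_injective (by rw [← h2]; simp)

lemma norm_toLp_sq {Y : Type*} [MeasureSpace Y] {g : Y → ℂ} (hg : MemLp g 2) :
    ‖hg.toLp g‖ ^ 2 = ∫ z, ‖g z‖ ^ 2 :=
  norm_sq_eq_integral hg.coeFn_toLp

lemma memLp_tensor {Y : Type*} [MeasureSpace Y] [SigmaFinite (volume : Measure X)]
    {u : Y → ℂ} {f : X → ℂ} (hu : MemLp u 2) (hf : MemLp f 2) :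
    MemLp (fun p : Y × X => u p.1 * f p.2) 2 := by
  have hm : AEStronglyMeasurable (fun p : Y × X => u p.1 * f p.2) volume :=
    hu.1.comp_fst.mul hf.1.comp_snd
  rw [memLp_two_iff_integrable_sq_norm hm]
  have h := ((memLp_two_iff_integrable_sq_norm hu.1).1 hu).mul_prod
    ((memLp_two_iff_integrable_sq_norm hf.1).1 hf)
  refine h.congr (Filter.Eventually.of_forall fun p => ?_)
  simp only [norm_mul, mul_pow]

lemma ae_fst {Y : Type*} [MeasureSpace Y] [SigmaFinite (volume : Measure X)] {P : Y → Prop}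
    (h : ∀ᵐ y : Y, P y) : ∀ᵐ p : Y × X, P p.1 :=
  Measure.quasiMeasurePreserving_fst.ae h

lemma ae_snd {Y : Type*} [MeasureSpace Y] [SigmaFinite (volume : Measure Y)] {P : X → Prop}
    (h : ∀ᵐ y : X, P y) : ∀ᵐ p : Y × X, P p.2 :=
  Measure.quasiMeasurePreserving_snd.ae h

variable [SigmaFinite (volume : Measure X)]

/-- The function `(z, x) ↦ u(z) f(x)`. -/
def tensorFun (u : OneBody) (f : SqInt X) : SqInt (Pos × X) :=
  (memLp_tensor (Lp.memLp u) (Lp.memLp f)).toLp _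

lemma coeFn_tensorFun (u : OneBody) (f : SqInt X) :
    tensorFun u f =ᵐ[volume] fun p : Pos × X => u p.1 * f p.2 :=
  MemLp.coeFn_toLp _

lemma inner_tensorFun (u w : OneBody) (f g : SqInt X) :
    inner ℂ (tensorFun u f) (tensorFun w g) = inner ℂ u w * inner ℂ f g := by
  rw [inner_eq_integral_of_ae (coeFn_tensorFun u f) (coeFn_tensorFun w g), inner_eq_integral,
    inner_eq_integral, ← integral_prod_mul]
  refine integral_congr_ae (Filter.Eventually.of_forall fun p => ?_)
  simp only [map_mul]
  ring

lemma norm_tensorFun (u : OneBody) (f : SqInt X) : ‖tensorFun u f‖ = ‖u‖ * ‖f‖ := by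
  have h := inner_tensorFun u u f f
  simp only [inner_self_eq_norm_sq_to_K] at h
  have h2 : ‖tensorFun u f‖ ^ 2 = (‖u‖ * ‖f‖) ^ 2 := by
    rw [mul_pow]
    exact_mod_cast h
  exact (pow_left_inj₀ (norm_nonneg _) (by positivity) two_ne_zero).1 h2

/-- The bilinear map `(u, f) ↦ u ⊗ f`. -/
def tensor : OneBody →L[ℂ] SqInt X →L[ℂ] SqInt (Pos × X) :=
  LinearMap.mkContinuous₂
    (LinearMap.mk₂ ℂ tensorFun
      (fun u u' f => by
        refine Lp.ext ?_
        filter_upwards [coeFn_tensorFun (u + u') f, coeFn_tensorFun u f, coeFn_tensorFun u' f,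
          Lp.coeFn_add (tensorFun u f) (tensorFun u' f),
          ae_fst (X := X) (Lp.coeFn_add u u')] with p h1 h2 h3 h4 h5
        rw [h1, h4, Pi.add_apply, h2, h3, h5, Pi.add_apply, add_mul])
      (fun c u f => by
        refine Lp.ext ?_
        filter_upwards [coeFn_tensorFun (c • u) f, coeFn_tensorFun u f,
          Lp.coeFn_smul c (tensorFun u f), ae_fst (X := X) (Lp.coeFn_smul c u)] with p h1 h2 h3 h4
        rw [h1, h3, Pi.smul_apply, h2, h4, Pi.smul_apply, smul_eq_mul, smul_eq_mul, mul_assoc])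
      (fun u f f' => by
        refine Lp.ext ?_
        filter_upwards [coeFn_tensorFun u (f + f'), coeFn_tensorFun u f, coeFn_tensorFun u f',
          Lp.coeFn_add (tensorFun u f) (tensorFun u f'),
          ae_snd (Y := Pos) (Lp.coeFn_add f f')] with p h1 h2 h3 h4 h5
        rw [h1, h4, Pi.add_apply, h2, h3, h5, Pi.add_apply, mul_add])
      (fun c u f => by
        refine Lp.ext ?_
        filter_upwards [coeFn_tensorFun u (c • f), coeFn_tensorFun u f,
          Lp.coeFn_smul c (tensorFun u f), ae_snd (Y := Pos) (Lp.coeFn_smul c f)] with p h1 h2 h3 h4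
        rw [h1, h3, Pi.smul_apply, h2, h4, Pi.smul_apply, smul_eq_mul, smul_eq_mul]
        ring))
    1 (fun u f => by simp [norm_tensorFun])

lemma coeFn_tensor (u : OneBody) (f : SqInt X) :
    tensor u f =ᵐ[volume] fun p : Pos × X => u p.1 * f p.2 :=
  coeFn_tensorFun u f

lemma norm_tensor (u : OneBody) (f : SqInt X) : ‖tensor u f‖ = ‖u‖ * ‖f‖ :=
  norm_tensorFun u f

lemma inner_tensor (u w : OneBody) (f g : SqInt X) :
    inner ℂ (tensor u f) (tensor w g) = inner ℂ u w * inner ℂ f g :=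
  inner_tensorFun u w f g

lemma ae_ae_of_ae_snd {P : Pos × X → Prop} (h : ∀ᵐ p : Pos × X, P p) :
    ∀ᵐ x : X, ∀ᵐ z : Pos, P (z, x) := by
  have h1 : ∀ᵐ p : X × Pos, P p.swap :=
    (Measure.measurePreserving_swap (μ := (volume : Measure X))
      (ν := (volume : Measure Pos))).quasiMeasurePreserving.ae h
  exact Measure.ae_ae_of_ae_prod h1

lemma memLp_two_ae_section (F : SqInt (Pos × X)) :
    ∀ᵐ x : X, MemLp (fun z => F (z, x)) 2 volume := by
  have h := (memLp_two_iff_integrable_sq_norm (Lp.aestronglyMeasurable F)).1 (Lp.memLp F)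
  have h2 := Integrable.prod_left_ae h
  filter_upwards [h2] with x hx
  have hm : AEStronglyMeasurable (fun z => F (z, x)) volume :=
    ((Lp.stronglyMeasurable F).comp_measurable
      (measurable_id.prodMk measurable_const)).aestronglyMeasurable
  exact (memLp_two_iff_integrable_sq_norm hm).2 hx

/-- Cauchy–Schwarz for functions rather than classes, so that it can be applied to a section `z ↦ F
(z, x)` at a single `x`. -/
lemma norm_integral_mul_sq_le {w f : Pos → ℂ} (hw : MemLp w 2) (hf : MemLp f 2) :
    ‖∫ z, conj (w z) * f z‖ ^ 2 ≤ (∫ z, ‖w z‖ ^ 2) * ∫ z, ‖f z‖ ^ 2 := by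
  have h1 : inner ℂ (hw.toLp w) (hf.toLp f) = ∫ z, conj (w z) * f z :=
    inner_eq_integral_of_ae hw.coeFn_toLp hf.coeFn_toLp
  rw [← h1, ← norm_toLp_sq hw, ← norm_toLp_sq hf, ← mul_pow]
  exact pow_le_pow_left₀ (norm_nonneg _) (norm_inner_le_norm _ _) 2

/-- The partial scalar product `x ↦ ∫ conj (w z) F(z, x) dz`. -/
def partialInner (w : Pos → ℂ) (F : Pos × X → ℂ) (x : X) : ℂ := ∫ z, conj (w z) * F (z, x)

/-- Cauchy–Schwarz in `z` bounds the square by `‖w‖²` times the squared norm of the section, which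
is integrable in `x` by Fubini. -/
lemma memLp_partialInner (w : OneBody) (F : SqInt (Pos × X)) :
    MemLp (partialInner (X := X) w F) 2 := by
  have hF2 := (memLp_two_iff_integrable_sq_norm (Lp.aestronglyMeasurable F)).1 (Lp.memLp F)
  have hm : AEStronglyMeasurable (partialInner (X := X) w F) volume := by
    have : StronglyMeasurable fun q : X × Pos => conj (w q.2) * F (q.2, q.1) := by
      refine StronglyMeasurable.mul ?_ ?_
      · exact Complex.continuous_conj.comp_stronglyMeasurable
          ((Lp.stronglyMeasurable w).comp_measurable measurable_snd)
      · exact (Lp.stronglyMeasurable F).comp_measurable measurable_swap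
    exact this.integral_prod_right.aestronglyMeasurable
  rw [memLp_two_iff_integrable_sq_norm hm]
  refine Integrable.mono' ((Integrable.integral_prod_right hF2).const_mul (∫ z, ‖w z‖ ^ 2))
    (hm.norm.pow 2) ?_
  filter_upwards [memLp_two_ae_section F] with x hx
  rw [Real.norm_of_nonneg (by positivity)]
  exact norm_integral_mul_sq_le (Lp.memLp w) hx

/-- Fubini, applied to `⟨w ⊗ g, F⟩`. One-particle operators are assembled from `tensor`, its adjoint
and an exchange of coordinates, which keeps all identities at the level of `L²`. -/
lemma adjoint_tensor_coeFn (w : OneBody) (F : SqInt (Pos × X)) :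
    (ContinuousLinearMap.adjoint (tensor (X := X) w)) F =ᵐ[volume] partialInner (X := X) w F := by
  have h := memLp_partialInner w F
  have : (ContinuousLinearMap.adjoint (tensor (X := X) w)) F = h.toLp _ := by
    refine ext_inner_left ℂ fun g => ?_
    rw [ContinuousLinearMap.adjoint_inner_right,
      inner_eq_integral_of_ae (coeFn_tensor w g) Filter.EventuallyEq.rfl,
      inner_eq_integral_of_ae Filter.EventuallyEq.rfl h.coeFn_toLp]
    have hint : Integrable (fun p : Pos × X => conj (w p.1 * g p.2) * F p) volume := by
      have h3 := L2.integrable_inner (𝕜 := ℂ) (tensor w g) F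
      refine h3.congr ?_
      filter_upwards [coeFn_tensor w g] with p hp
      rw [RCLike.inner_apply', hp]
    have hp := integral_prod_symm (μ := (volume : Measure Pos)) (ν := (volume : Measure X)) _ hint
    refine Eq.trans hp ?_
    refine integral_congr_ae (Filter.Eventually.of_forall fun x => ?_)
    simp only [partialInner]
    rw [← integral_const_mul]
    refine integral_congr_ae (Filter.Eventually.of_forall fun z => ?_)
    simp only [map_mul]
    ring
  rw [this]
  exact h.coeFn_toLp

end Tensor

/-! ### Composition with measure preserving involutions -/

section Comp

variable {Y : Type*} [MeasureSpace Y]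

/-- Composition with a measure preserving map. -/
def compMP {Z : Type*} [MeasureSpace Z] (τ : Y → Z)
    (hτ : MeasurePreserving τ volume volume) : SqInt Z →L[ℂ] SqInt Y :=
  (Lp.compMeasurePreservingₗᵢ ℂ τ hτ).toContinuousLinearMap

lemma coeFn_compMP {Z : Type*} [MeasureSpace Z] {τ : Y → Z}
    (hτ : MeasurePreserving τ volume volume) (F : SqInt Z) :
    compMP τ hτ F =ᵐ[volume] F ∘ τ :=
  Lp.coeFn_compMeasurePreserving F hτ

lemma coeFn_compMP_of_ae {Z : Type*} [MeasureSpace Z] {τ : Y → Z}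
    (hτ : MeasurePreserving τ volume volume) {F : SqInt Z} {F' : Z → ℂ} (h : F =ᵐ[volume] F') :
    compMP τ hτ F =ᵐ[volume] F' ∘ τ :=
  (coeFn_compMP hτ F).trans (hτ.quasiMeasurePreserving.ae_eq_comp h)

lemma norm_compMP {Z : Type*} [MeasureSpace Z] {τ : Y → Z}
    (hτ : MeasurePreserving τ volume volume) (F : SqInt Z) : ‖compMP τ hτ F‖ = ‖F‖ :=
  (Lp.compMeasurePreservingₗᵢ ℂ τ hτ).norm_map F

lemma inner_compMP_compMP {Z : Type*} [MeasureSpace Z] {τ : Y → Z}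
    (hτ : MeasurePreserving τ volume volume) (F G : SqInt Z) :
    inner ℂ (compMP τ hτ F) (compMP τ hτ G) = inner ℂ F G :=
  (Lp.compMeasurePreservingₗᵢ ℂ τ hτ).inner_map_map F G

lemma compMP_compMP_inverse {Z : Type*} [MeasureSpace Z] {τ : Y → Z} {ρ : Z → Y}
    (hτ : MeasurePreserving τ volume volume) (hρ : MeasurePreserving ρ volume volume)
    (hi : ∀ y, τ (ρ y) = y) (F : SqInt Z) : compMP ρ hρ (compMP τ hτ F) = F := by
  refine Lp.ext ((coeFn_compMP_of_ae hρ (coeFn_compMP hτ F)).trans ?_)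
  refine Filter.Eventually.of_forall fun y => ?_
  simp [hi]

lemma inner_compMP_left {Z : Type*} [MeasureSpace Z] {τ : Y → Z} {ρ : Z → Y}
    (hτ : MeasurePreserving τ volume volume) (hρ : MeasurePreserving ρ volume volume)
    (hi : ∀ y, τ (ρ y) = y) (F : SqInt Z) (G : SqInt Y) :
    inner ℂ (compMP τ hτ F) G = inner ℂ F (compMP ρ hρ G) := by
  rw [← inner_compMP_compMP hρ (compMP τ hτ F) G, compMP_compMP_inverse hτ hρ hi]

end Comp

end

noncomputable section

/-! ### Replacing one particle coordinate -/

/-- Exchange of the first two factors of `Y × (Z × X)`. -/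
def swapFst {X Y Z : Type*} (p : Y × (Z × X)) : Z × (Y × X) := (p.2.1, (p.1, p.2.2))

lemma measurePreserving_swapFst {X Y Z : Type*} [MeasureSpace X] [MeasureSpace Y] [MeasureSpace Z]
    [SigmaFinite (volume : Measure X)] [SigmaFinite (volume : Measure Y)]
    [SigmaFinite (volume : Measure Z)] :
    MeasurePreserving (swapFst : Y × (Z × X) → Z × (Y × X)) volume volume := by
  have h1 := (measurePreserving_prodAssoc (volume : Measure Y) (volume : Measure Z)
    (volume : Measure X)).symm
  have h2 := (Measure.measurePreserving_swap (μ := (volume : Measure Y))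
    (ν := (volume : Measure Z))).prod (MeasurePreserving.id (volume : Measure X))
  have h3 := measurePreserving_prodAssoc (volume : Measure Z) (volume : Measure Y)
    (volume : Measure X)
  exact h3.comp (h2.comp h1)

/-- The map `(z, x) ↦ (x_m, (x_1, …, z, …, x_N))` which exchanges `z` and the coordinate `x_m`. -/
def slotSwap {N : ℕ} (m : Fin N) (p : Pos × Config N) : Pos × Config N :=
  (p.2 m, Function.update p.2 m p.1)

lemma slotSwap_slotSwap {N : ℕ} (m : Fin N) (p : Pos × Config N) :
    slotSwap m (slotSwap m p) = p := by
  simp [slotSwap]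

lemma measurePreserving_insertNth {n : ℕ} (m : Fin (n + 1)) :
    MeasurePreserving (fun p : Pos × Config n => (m.insertNth p.1 p.2 : Config (n + 1)))
      volume volume :=
  (volume_preserving_piFinSuccAbove (fun _ => Pos) m).symm

lemma measurePreserving_removeNth {n : ℕ} (m : Fin (n + 1)) :
    MeasurePreserving (fun x : Config (n + 1) => ((x m, m.removeNth x) : Pos × Config n))
      volume volume :=
  volume_preserving_piFinSuccAbove (fun _ => Pos) m

/-- In the coordinates `z`, `x_m` and the remaining particles, the map exchanges the first two
factors of a product. -/
lemma measurePreserving_slotSwap {N : ℕ} (m : Fin N) :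
    MeasurePreserving (slotSwap m) volume volume := by
  obtain _ | n := N
  · exact m.elim0
  have h1 := (MeasurePreserving.id (volume : Measure Pos)).prod (measurePreserving_removeNth m)
  have h2 := measurePreserving_swapFst (X := Config n) (Y := Pos) (Z := Pos)
  have h3 := (MeasurePreserving.id (volume : Measure Pos)).prod (measurePreserving_insertNth m)
  have h := h3.comp (h2.comp h1)
  have he : slotSwap m = Prod.map id (fun p : Pos × Config n => (m.insertNth p.1 p.2 : Config (n + 1))) ∘
      swapFst ∘ Prod.map id (fun x : Config (n + 1) => ((x m, m.removeNth x) : Pos × Config n)) := by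
    funext p
    simp only [slotSwap, swapFst, Function.comp, Prod.map, id]
    rw [← Fin.insertNth_removeNth]
  rw [he]
  exact h

/-- The same exchange in the presence of a spectator coordinate. -/
def spectatorSwap {N : ℕ} {Y : Type*} (m : Fin N) (p : Pos × (Y × Config N)) :
    Pos × (Y × Config N) :=
  (p.2.2 m, (p.2.1, Function.update p.2.2 m p.1))

lemma measurePreserving_spectatorSwap {N : ℕ} {Y : Type*} [MeasureSpace Y]
    [SigmaFinite (volume : Measure Y)] (m : Fin N) :
    MeasurePreserving (spectatorSwap (Y := Y) m) volume volume := by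
  have h1 := measurePreserving_swapFst (X := Config N) (Y := Pos) (Z := Y)
  have h2 := (MeasurePreserving.id (volume : Measure Y)).prod (measurePreserving_slotSwap m)
  exact (measurePreserving_swapFst (X := Config N) (Y := Y) (Z := Pos)).comp (h2.comp h1)

lemma spectatorSwap_spectatorSwap {N : ℕ} {Y : Type*} (m : Fin N) (p : Pos × (Y × Config N)) :
    spectatorSwap m (spectatorSwap m p) = p := by
  simp [spectatorSwap]

/-! ### One-particle rank-one operators -/

section SlotOp

variable {X : Type*} [MeasureSpace X] [SigmaFinite (volume : Measure X)]

/-- The operator `f ↦ (x ↦ ∫ conj (w z) (u ⊗ f)(τ (z, x)) dz)`. -/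
def slotOp (τ : Pos × X → Pos × X) (hτ : MeasurePreserving τ volume volume) (u w : OneBody) :
    SqInt X →L[ℂ] SqInt X :=
  (ContinuousLinearMap.adjoint (tensor w)) ∘L (compMP τ hτ) ∘L (tensor u)

variable {τ : Pos × X → Pos × X} (hτ : MeasurePreserving τ volume volume)

lemma inner_slotOp_right (u w : OneBody) (f g : SqInt X) :
    inner ℂ f (slotOp τ hτ u w g) = inner ℂ (tensor w f) (compMP τ hτ (tensor u g)) := by
  simp only [slotOp, ContinuousLinearMap.comp_apply, ContinuousLinearMap.adjoint_inner_right]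

/-- Composition with an involution `τ` is self-adjoint, so passing to the adjoint only interchanges
the two orbitals. -/
lemma inner_slotOp_left (hi : ∀ p, τ (τ p) = p) (u w : OneBody) (f g : SqInt X) :
    inner ℂ (slotOp τ hτ u w f) g = inner ℂ f (slotOp τ hτ w u g) := by
  rw [inner_slotOp_right, ← inner_conj_symm, inner_slotOp_right, inner_conj_symm,
    inner_compMP_left hτ hτ hi]

lemma adjoint_slotOp (hi : ∀ p, τ (τ p) = p) (u w : OneBody) :
    ContinuousLinearMap.adjoint (slotOp τ hτ u w) = slotOp τ hτ w u := by
  refine ContinuousLinearMap.ext fun g => ext_inner_left ℂ fun f => ?_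
  rw [ContinuousLinearMap.adjoint_inner_right, inner_slotOp_left hτ hi]

lemma partialInner_congr {w : Pos → ℂ} {F G : Pos × X → ℂ} (h : F =ᵐ[volume] G) :
    partialInner w F =ᵐ[volume] partialInner w G := by
  filter_upwards [ae_ae_of_ae_snd h] with x hx
  refine integral_congr_ae ?_
  filter_upwards [hx] with z hz
  rw [hz]

lemma slotOp_coeFn {f : SqInt X} {f' : X → ℂ} (u w : OneBody) (h : f =ᵐ[volume] f') :
    slotOp τ hτ u w f =ᵐ[volume]
      fun x => ∫ z, conj (w z) * (u (τ (z, x)).1 * f' (τ (z, x)).2) := by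
  refine (adjoint_tensor_coeFn w _).trans 
    (partialInner_congr (w := w) (G := fun p => u (τ p).1 * f' (τ p).2) ?_)
  refine coeFn_compMP_of_ae hτ (F' := fun p : Pos × X => u p.1 * f' p.2) ?_
  filter_upwards [coeFn_tensor u f, ae_snd (Y := Pos) h] with p h1 h2
  exact h1.trans (by rw [h2])

end SlotOp

section Config

variable {N : ℕ}

/-- The operator `|u⟩⟨w|` acting on the `m`-th particle. -/
def rankOne (m : Fin N) (u w : OneBody) : ManyBody N →L[ℂ] ManyBody N :=
  slotOp (slotSwap m) (measurePreserving_slotSwap m) u w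

lemma rankOne_coeFn (m : Fin N) (u w : OneBody) {f : ManyBody N} {f' : Config N → ℂ}
    (h : f =ᵐ[volume] f') :
    rankOne m u w f =ᵐ[volume]
      fun x => u (x m) * ∫ z, conj (w z) * f' (Function.update x m z) := by
  refine (slotOp_coeFn _ u w h).trans (Filter.Eventually.of_forall fun x => ?_)
  simp only [slotSwap]
  rw [← integral_const_mul]
  refine integral_congr_ae (Filter.Eventually.of_forall fun z => ?_)
  ring_nf

lemma adjoint_rankOne (m : Fin N) (u w : OneBody) :
    ContinuousLinearMap.adjoint (rankOne m u w) = rankOne m w u :=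
  adjoint_slotOp _ (slotSwap_slotSwap m) u w

lemma inner_rankOne (m : Fin N) (u w : OneBody) (f g : ManyBody N) :
    inner ℂ f (rankOne m u w g) =
      inner ℂ (tensor w f) (compMP _ (measurePreserving_slotSwap m) (tensor u g)) :=
  inner_slotOp_right _ u w f g

lemma rankOne_comp_rankOne (m : Fin N) (u w u' w' : OneBody) (f : ManyBody N) :
    rankOne m u w (rankOne m u' w' f) = inner ℂ w u' • rankOne m u w' f := by
  refine Lp.ext ?_
  have h := rankOne_coeFn m u w (rankOne_coeFn m u' w' (f := f) Filter.EventuallyEq.rfl)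
  filter_upwards [h, rankOne_coeFn m u w' (f := f) Filter.EventuallyEq.rfl,
    Lp.coeFn_smul (inner ℂ w u') (rankOne m u w' f)] with x h1 h2 h3
  rw [h1, h3, Pi.smul_apply, h2, inner_eq_integral, smul_eq_mul]
  simp only [Function.update_self, Function.update_idem, ← mul_assoc]
  rw [integral_mul_const]
  ring

lemma spectator_tensor (m : Fin N) (u w u' : OneBody) (f : ManyBody N) :
    slotOp _ (measurePreserving_spectatorSwap (Y := Pos) m) u w (tensor u' f) =
      tensor u' (rankOne m u w f) := by
  refine Lp.ext ?_
  have h := slotOp_coeFn (measurePreserving_spectatorSwap (Y := Pos) m) u w (coeFn_tensor u' f)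
  filter_upwards [h, coeFn_tensor u' (rankOne m u w f),
    ae_snd (Y := Pos) (rankOne_coeFn m u w (f := f) Filter.EventuallyEq.rfl)] with p h1 h2 h3
  rw [h1, h2, h3]
  simp only [spectatorSwap]
  rw [← integral_const_mul, ← integral_const_mul]
  refine integral_congr_ae (Filter.Eventually.of_forall fun z => ?_)
  ring_nf

lemma spectator_compMP {m n : Fin N} (hmn : m ≠ n) (u w : OneBody) (F : SqInt (Pos × Config N)) :
    slotOp _ (measurePreserving_spectatorSwap (Y := Pos) m) u w
        (compMP _ (measurePreserving_slotSwap n) F) =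
      compMP _ (measurePreserving_slotSwap n)
        (slotOp _ (measurePreserving_spectatorSwap (Y := Pos) m) u w F) := by
  refine Lp.ext ?_
  have h := slotOp_coeFn (measurePreserving_spectatorSwap (Y := Pos) m) u w
    (coeFn_compMP (measurePreserving_slotSwap n) F)
  have h' := coeFn_compMP_of_ae (measurePreserving_slotSwap n)
    (slotOp_coeFn (measurePreserving_spectatorSwap (Y := Pos) m) u w
      (f := F) Filter.EventuallyEq.rfl)
  filter_upwards [h, h'] with p h1 h2
  rw [h1, h2]
  simp only [spectatorSwap, slotSwap, Function.comp]
  refine integral_congr_ae (Filter.Eventually.of_forall fun z => ?_)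
  simp only
  rw [Function.update_of_ne hmn.symm, Function.update_of_ne hmn, Function.update_comm hmn]

/-- Checked on matrix elements. By `inner_rankOne` the outer operator becomes a scalar product in
`L²(ℝ³ × ℝ^{3N})`. There the operator on particle `m` commutes both with tensoring by an orbital and
with the exchange of `x_n`, so it can be moved to the other side. No pointwise interchange of two
partial integrals is needed. -/
lemma rankOne_comm {m n : Fin N} (hmn : m ≠ n) (u w u' w' : OneBody) (f : ManyBody N) :
    rankOne n u' w' (rankOne m u w f) = rankOne m u w (rankOne n u' w' f) := by
  refine ext_inner_left ℂ fun g => ?_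
  have hi : ∀ p, spectatorSwap (Y := Pos) m (spectatorSwap m p) = p := spectatorSwap_spectatorSwap m
  rw [inner_rankOne, ← spectator_tensor, ← spectator_compMP hmn,
    ← inner_slotOp_left _ hi, spectator_tensor, ← inner_rankOne,
    ← adjoint_rankOne m u w, ContinuousLinearMap.adjoint_inner_left]

end Config

end

noncomputable section

/-! ### The projections `p_m` and `q_m` -/

section Projections

variable {N : ℕ}

/-- The operator `p_m = ∑_k |φ_k⟩⟨φ_k|_m` on `L²(ℝ^{3N})`. -/
def orbProj {M : ℕ} (φ : Fin M → OneBody) (m : Fin N) : ManyBody N →L[ℂ] ManyBody N :=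
  ∑ k, rankOne m (φ k) (φ k)

/-- The operator `q_m = 1 - p_m` on `L²(ℝ^{3N})`. -/
def orbCoproj {M : ℕ} (φ : Fin M → OneBody) (m : Fin N) : ManyBody N →L[ℂ] ManyBody N :=
  1 - orbProj φ m

lemma orbProj_apply {M : ℕ} (φ : Fin M → OneBody) (m : Fin N) (f : ManyBody N) :
    orbProj φ m f = ∑ k, rankOne m (φ k) (φ k) f := by
  simp [orbProj]

lemma orbCoproj_apply {M : ℕ} (φ : Fin M → OneBody) (m : Fin N) (f : ManyBody N) :
    orbCoproj φ m f = f - orbProj φ m f := by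
  simp [orbCoproj]

lemma orbProj_add_orbCoproj {M : ℕ} (φ : Fin M → OneBody) (m : Fin N) (f : ManyBody N) :
    orbProj φ m f + orbCoproj φ m f = f := by
  simp [orbCoproj_apply]

lemma orbProj_coeFn (φ : Fin N → OneBody) (m : Fin N) {f : ManyBody N} {f' : Config N → ℂ}
    (h : f =ᵐ[volume] f') : orbProj φ m f =ᵐ[volume] projP φ m f' := by
  rw [orbProj_apply]
  refine (Lp.coeFn_finsetSum _ _).trans ?_
  have h2 : ∀ᵐ x, ∀ k, rankOne m (φ k) (φ k) f x =
      φ k (x m) * ∫ z, conj (φ k z) * f' (Function.update x m z) :=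
    ae_all_iff.2 fun k => rankOne_coeFn m (φ k) (φ k) h
  filter_upwards [h2] with x hx
  rw [Finset.sum_apply]
  exact Finset.sum_congr rfl fun k _ => hx k

lemma orbCoproj_coeFn (φ : Fin N → OneBody) (m : Fin N) {f : ManyBody N} {f' : Config N → ℂ}
    (h : f =ᵐ[volume] f') : orbCoproj φ m f =ᵐ[volume] projQ φ m f' := by
  rw [orbCoproj_apply]
  filter_upwards [Lp.coeFn_sub f (orbProj φ m f), h, orbProj_coeFn φ m h] with x h1 h2 h3
  rw [h1, Pi.sub_apply, h2, h3, projQ]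

lemma inner_orbProj_left {M : ℕ} (φ : Fin M → OneBody) (m : Fin N) (f g : ManyBody N) :
    inner ℂ (orbProj φ m f) g = inner ℂ f (orbProj φ m g) := by
  rw [orbProj_apply, orbProj_apply, sum_inner, inner_sum]
  refine Finset.sum_congr rfl fun k _ => ?_
  rw [← ContinuousLinearMap.adjoint_inner_right, adjoint_rankOne]

lemma inner_orbCoproj_left {M : ℕ} (φ : Fin M → OneBody) (m : Fin N) (f g : ManyBody N) :
    inner ℂ (orbCoproj φ m f) g = inner ℂ f (orbCoproj φ m g) := by
  rw [orbCoproj_apply, orbCoproj_apply, inner_sub_left, inner_sub_right, inner_orbProj_left]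

lemma orbProj_orbProj {M : ℕ} {φ : Fin M → OneBody} (hφ : Orthonormal ℂ φ) (m : Fin N)
    (f : ManyBody N) : orbProj φ m (orbProj φ m f) = orbProj φ m f := by
  simp only [orbProj_apply, map_sum, rankOne_comp_rankOne]
  rw [Finset.sum_comm]
  refine Finset.sum_congr rfl fun k _ => ?_
  rw [Finset.sum_eq_single k]
  · rw [(orthonormal_iff_ite.1 hφ) k k]
    simp
  · intro l _ hl
    rw [(orthonormal_iff_ite.1 hφ), if_neg hl.symm, zero_smul]
  · simp

lemma orbCoproj_orbCoproj {M : ℕ} {φ : Fin M → OneBody} (hφ : Orthonormal ℂ φ) (m : Fin N)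
    (f : ManyBody N) : orbCoproj φ m (orbCoproj φ m f) = orbCoproj φ m f := by
  simp [orbCoproj_apply, orbProj_orbProj hφ]

lemma orbProj_comm {M : ℕ} (φ : Fin M → OneBody) {m n : Fin N} (hmn : m ≠ n) (f : ManyBody N) :
    orbProj φ m (orbProj φ n f) = orbProj φ n (orbProj φ m f) := by
  simp only [orbProj_apply, map_sum]
  rw [Finset.sum_comm]
  exact Finset.sum_congr rfl fun k _ => Finset.sum_congr rfl fun l _ =>
    rankOne_comm hmn.symm _ _ _ _ _

lemma orbProj_orbCoproj_comm {M : ℕ} (φ : Fin M → OneBody) {m n : Fin N} (hmn : m ≠ n)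
    (f : ManyBody N) : orbProj φ m (orbCoproj φ n f) = orbCoproj φ n (orbProj φ m f) := by
  simp only [orbCoproj_apply, map_sub, orbProj_comm φ hmn]

lemma orbCoproj_comm {M : ℕ} (φ : Fin M → OneBody) {m n : Fin N} (hmn : m ≠ n)
    (f : ManyBody N) : orbCoproj φ m (orbCoproj φ n f) = orbCoproj φ n (orbCoproj φ m f) := by
  rw [orbCoproj_apply φ m, orbCoproj_apply φ m, map_sub, orbProj_orbCoproj_comm φ hmn]

lemma inner_orbCoproj_self {M : ℕ} {φ : Fin M → OneBody} (hφ : Orthonormal ℂ φ) (m : Fin N)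
    (f : ManyBody N) : inner ℂ f (orbCoproj φ m f) = ((‖orbCoproj φ m f‖ ^ 2 : ℝ) : ℂ) := by
  rw [← orbCoproj_orbCoproj hφ, ← inner_orbCoproj_left, orbCoproj_orbCoproj hφ,
    inner_self_eq_norm_sq_to_K]
  simp

lemma norm_orbCoproj_le {M : ℕ} {φ : Fin M → OneBody} (hφ : Orthonormal ℂ φ) (m : Fin N)
    (f : ManyBody N) : ‖orbCoproj φ m f‖ ≤ ‖f‖ := by
  have h := inner_orbCoproj_self hφ m f
  have h2 : ‖orbCoproj φ m f‖ ^ 2 ≤ ‖f‖ * ‖orbCoproj φ m f‖ := by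
    have := norm_inner_le_norm (𝕜 := ℂ) f (orbCoproj φ m f)
    rw [h, Complex.norm_real, Real.norm_of_nonneg (by positivity)] at this
    exact this
  by_contra hc
  push Not at hc
  nlinarith [norm_nonneg f]

lemma norm_sq_orbProj_add {M : ℕ} {φ : Fin M → OneBody} (hφ : Orthonormal ℂ φ) (m : Fin N)
    (f : ManyBody N) : ‖orbProj φ m f‖ ^ 2 + ‖orbCoproj φ m f‖ ^ 2 = ‖f‖ ^ 2 := by
  have h0 : inner ℂ (orbProj φ m f) (orbCoproj φ m f) = 0 := by
    rw [inner_orbProj_left, orbCoproj_apply, map_sub, orbProj_orbProj hφ, sub_self,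
      inner_zero_right]
  have := norm_add_sq_eq_norm_sq_add_norm_sq_of_inner_eq_zero _ _ h0
  rw [orbProj_add_orbCoproj] at this
  nlinarith

lemma norm_orbProj_le {M : ℕ} {φ : Fin M → OneBody} (hφ : Orthonormal ℂ φ) (m : Fin N)
    (f : ManyBody N) : ‖orbProj φ m f‖ ≤ ‖f‖ := by
  have := norm_sq_orbProj_add hφ m f
  refine (pow_le_pow_iff_left₀ (norm_nonneg _) (norm_nonneg _) two_ne_zero).1 ?_
  nlinarith [sq_nonneg ‖orbCoproj φ m f‖]

end Projections

/-! ### Permutations of the particles -/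

section Permutations

variable {N : ℕ}

/-- The action of a permutation on configurations. -/
def permConfig (σ : Equiv.Perm (Fin N)) (x : Config N) : Config N := fun i => x (σ i)

lemma measurePreserving_permConfig (σ : Equiv.Perm (Fin N)) :
    MeasurePreserving (permConfig σ) volume volume := by
  have h := volume_measurePreserving_piCongrLeft (fun _ : Fin N => Pos) σ.symm
  have he : permConfig σ = MeasurableEquiv.piCongrLeft (fun _ : Fin N => Pos) σ.symm := by
    funext x i
    rw [MeasurableEquiv.coe_piCongrLeft]
    have := Equiv.piCongrLeft_apply_apply (fun _ : Fin N => Pos) σ.symm x (σ i)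
    rw [Equiv.symm_apply_apply] at this
    exact this.symm
  rw [he]
  exact h

/-- The action of a permutation on wave functions. -/
def permOp (σ : Equiv.Perm (Fin N)) : ManyBody N →L[ℂ] ManyBody N :=
  compMP (permConfig σ) (measurePreserving_permConfig σ)

lemma permOp_coeFn (σ : Equiv.Perm (Fin N)) {f : ManyBody N} {f' : Config N → ℂ}
    (h : f =ᵐ[volume] f') : permOp σ f =ᵐ[volume] fun x => f' (permConfig σ x) :=
  coeFn_compMP_of_ae _ h

lemma norm_permOp (σ : Equiv.Perm (Fin N)) (f : ManyBody N) : ‖permOp σ f‖ = ‖f‖ :=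
  norm_compMP _ f

lemma permConfig_permConfig_symm (σ : Equiv.Perm (Fin N)) (x : Config N) :
    permConfig σ (permConfig σ.symm x) = x := by
  funext i
  simp [permConfig]

lemma inner_permOp_left (σ : Equiv.Perm (Fin N)) (f g : ManyBody N) :
    inner ℂ (permOp σ f) g = inner ℂ f (permOp σ.symm g) :=
  inner_compMP_left _ _ (permConfig_permConfig_symm σ) f g

lemma permConfig_update (σ : Equiv.Perm (Fin N)) (m : Fin N) (x : Config N) (z : Pos) :
    permConfig σ (Function.update x m z) = Function.update (permConfig σ x) (σ.symm m) z := by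
  funext i
  simp only [permConfig, Function.update_apply, Equiv.eq_symm_apply]

lemma orbProj_permOp (φ : Fin N → OneBody) (m : Fin N) (σ : Equiv.Perm (Fin N))
    (f : ManyBody N) : orbProj φ m (permOp σ f) = permOp σ (orbProj φ (σ.symm m) f) := by
  refine Lp.ext ?_
  have h1 := orbProj_coeFn φ m (permOp_coeFn σ (f := f) Filter.EventuallyEq.rfl)
  have h2 := permOp_coeFn σ (orbProj_coeFn φ (σ.symm m) (f := f) Filter.EventuallyEq.rfl)
  filter_upwards [h1, h2] with x h1 h2
  rw [h1, h2]
  simp only [projP, permConfig_update]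
  refine Finset.sum_congr rfl fun k _ => ?_
  simp [permConfig]

lemma orbCoproj_permOp (φ : Fin N → OneBody) (m : Fin N) (σ : Equiv.Perm (Fin N))
    (f : ManyBody N) : orbCoproj φ m (permOp σ f) = permOp σ (orbCoproj φ (σ.symm m) f) := by
  rw [orbCoproj_apply, orbProj_permOp, orbCoproj_apply, map_sub]

/-- Antisymmetry with respect to the particles with labels in `J`. -/
def AntisymmetricOn (J : Finset (Fin N)) (f : ManyBody N) : Prop :=
  ∀ i ∈ J, ∀ j ∈ J, i ≠ j → permOp (Equiv.swap i j) f = -f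

lemma AntisymmetricOn.mono {J J' : Finset (Fin N)} {f : ManyBody N} (h : AntisymmetricOn J' f)
    (hJ : J ⊆ J') : AntisymmetricOn J f :=
  fun i hi j hj hij => h i (hJ hi) j (hJ hj) hij

/-- Transpositions inside `J` fix `m ∉ J` and therefore commute with `p_m`. -/
lemma AntisymmetricOn.orbProj {J : Finset (Fin N)} {f : ManyBody N} (h : AntisymmetricOn J f)
    (φ : Fin N → OneBody) {m : Fin N} (hm : m ∉ J) : AntisymmetricOn J (orbProj φ m f) := by
  intro i hi j hj hij
  have h1 := orbProj_permOp φ m (Equiv.swap i j) f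
  rw [h i hi j hj hij, Equiv.symm_swap, Equiv.swap_apply_of_ne_of_ne (by grind) (by grind)] at h1
  rw [← h1, map_neg]

lemma AntisymmetricOn.orbCoproj {J : Finset (Fin N)} {f : ManyBody N} (h : AntisymmetricOn J f)
    (φ : Fin N → OneBody) {m : Fin N} (hm : m ∉ J) : AntisymmetricOn J (orbCoproj φ m f) := by
  intro i hi j hj hij
  rw [orbCoproj_apply, map_sub, h i hi j hj hij, h.orbProj φ hm i hi j hj hij]
  abel

lemma permOp_eq_of_isAntisymmetric {f : ManyBody N} (h : IsAntisymmetric f)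
    (σ : Equiv.Perm (Fin N)) : permOp σ f = ((Equiv.Perm.sign σ : ℤ) : ℂ) • f := by
  refine Lp.ext ?_
  filter_upwards [permOp_coeFn σ (f := f) Filter.EventuallyEq.rfl, h σ,
    Lp.coeFn_smul ((Equiv.Perm.sign σ : ℤ) : ℂ) f] with x h1 h2 h3
  rw [h1, h3, Pi.smul_apply, smul_eq_mul, ← h2]
  rfl

lemma antisymmetricOn_of_permOp {f : ManyBody N}
    (h : ∀ σ : Equiv.Perm (Fin N), permOp σ f = ((Equiv.Perm.sign σ : ℤ) : ℂ) • f) :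
    AntisymmetricOn Finset.univ f := by
  intro i _ j _ hij
  rw [h, Equiv.Perm.sign_swap hij]
  simp

/-- The transposition of `i` and `j` changes `f` only by a sign and carries one projection into the
other. -/
lemma norm_orbCoproj_eq {f : ManyBody N} (h : AntisymmetricOn Finset.univ f)
    (φ : Fin N → OneBody) (i j : Fin N) : ‖orbCoproj φ i f‖ = ‖orbCoproj φ j f‖ := by
  obtain rfl | hij := eq_or_ne i j
  · rfl
  have h1 := orbCoproj_permOp φ i (Equiv.swap i j) f
  rw [h i (Finset.mem_univ _) j (Finset.mem_univ _) hij, Equiv.symm_swap, Equiv.swap_apply_left,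
    map_neg] at h1
  rw [← norm_neg, h1, norm_permOp]

end Permutations

/-! ### The counting functional -/

section Counting

variable {N : ℕ}

/-- Both identities follow by induction from `p_i + q_i = 1` alone: expanding the product of all
`p_i + q_i` gives the first, and weighting each term by its number of factors `q` gives the second.
Commutativity of the factors plays no role. -/
lemma sum_powerset_foldr {E ι : Type*} [AddCommGroup E] [DecidableEq ι] (p q : ι → E →+ E)
    (hpq : ∀ i x, p i x + q i x = x) (x : E) (l : List ι) (hl : l.Nodup) :
    ∑ S ∈ l.toFinset.powerset, l.foldr (fun i y => if i ∈ S then q i y else p i y) x = x ∧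
    ∑ S ∈ l.toFinset.powerset,
      S.card • l.foldr (fun i y => if i ∈ S then q i y else p i y) x = ∑ i ∈ l.toFinset, q i x := by
  induction l with
  | nil => simp
  | cons a l ih =>
    obtain ⟨ha, hl⟩ := List.nodup_cons.1 hl
    obtain ⟨ih1, ih2⟩ := ih hl
    have ha' : a ∉ l.toFinset := by simpa using ha
    have e1 : ∀ S ∈ l.toFinset.powerset,
        (a :: l).foldr (fun i y => if i ∈ S then q i y else p i y) x =
          p a (l.foldr (fun i y => if i ∈ S then q i y else p i y) x) := by
      intro S hS
      have : a ∉ S := fun h => ha' (Finset.mem_powerset.1 hS h)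
      simp [this]
    have e2 : ∀ S ∈ l.toFinset.powerset,
        (a :: l).foldr (fun i y => if i ∈ insert a S then q i y else p i y) x =
          q a (l.foldr (fun i y => if i ∈ S then q i y else p i y) x) := by
      intro S _
      rw [List.foldr_cons, if_pos (Finset.mem_insert_self a S)]
      congr 1
      refine List.foldr_ext _ _ _ fun i hi y => ?_
      have : i ≠ a := fun h => ha (h ▸ hi)
      simp [this]
    have e3 : ∀ S ∈ l.toFinset.powerset, (insert a S).card = S.card + 1 := by
      intro S hS
      exact Finset.card_insert_of_notMem fun h => ha' (Finset.mem_powerset.1 hS h)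
    rw [List.toFinset_cons]
    constructor
    · rw [Finset.sum_powerset_insert ha', Finset.sum_congr rfl e1, Finset.sum_congr rfl e2,
        ← map_sum, ← map_sum, ih1, hpq]
    · have e4 : ∀ S ∈ l.toFinset.powerset,
          S.card • (a :: l).foldr (fun i y => if i ∈ S then q i y else p i y) x =
            p a (S.card • l.foldr (fun i y => if i ∈ S then q i y else p i y) x) := by
        intro S hS
        rw [e1 S hS, map_nsmul]
      have e5 : ∀ S ∈ l.toFinset.powerset,
          (insert a S).card •
              (a :: l).foldr (fun i y => if i ∈ insert a S then q i y else p i y) x =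
            q a (S.card • l.foldr (fun i y => if i ∈ S then q i y else p i y) x) +
              q a (l.foldr (fun i y => if i ∈ S then q i y else p i y) x) := by
        intro S hS
        rw [e2 S hS, e3 S hS, add_smul, one_smul, map_nsmul]
      rw [Finset.sum_powerset_insert ha', Finset.sum_congr rfl e4, Finset.sum_congr rfl e5,
        Finset.sum_add_distrib, ← map_sum, ← map_sum, ← map_sum, ih1, ih2, ← add_assoc, hpq,
        Finset.sum_insert ha', add_comm]

/-- Grouping subsets by cardinality, `∑_k k P_{N,k} = ∑_m q_m`; the functional thus averages the
`q_m` over the particles. -/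
lemma alphaN_eq (ψ : ManyBody N) (φ : Fin N → OneBody) :
    alphaN ψ φ = (N : ℝ)⁻¹ * ∑ m, (inner ℂ ψ (orbCoproj φ m ψ)).re := by
  set F : Finset (Fin N) → ManyBody N := fun S => (List.finRange N).foldr
    (fun m χ => if m ∈ S then orbCoproj φ m χ else orbProj φ m χ) ψ with hF
  have hFc : ∀ S, F S =ᵐ[volume] (List.finRange N).foldr
      (fun m χ => if m ∈ S then projQ φ m χ else projP φ m χ) ψ := by
    intro S
    rw [hF]
    generalize List.finRange N = l
    induction l with
    | nil => exact Filter.EventuallyEq.rfl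
    | cons a l ih =>
      simp only [List.foldr_cons]
      split_ifs
      · exact orbCoproj_coeFn φ a ih
      · exact orbProj_coeFn φ a ih
  have h1 : ∀ k, (∫ x, conj (ψ x) * projPNk φ k ψ x) =
      ∑ S ∈ Finset.powersetCard k (Finset.univ : Finset (Fin N)), inner ℂ ψ (F S) := by
    intro k
    rw [← inner_sum]
    refine (inner_eq_integral_of_ae Filter.EventuallyEq.rfl ?_).symm
    refine (Lp.coeFn_finsetSum _ _).trans ?_
    filter_upwards [ae_all_iff.2 hFc] with x hx
    rw [Finset.sum_apply, projPNk]
    exact Finset.sum_congr rfl fun S _ => hx S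
  have h2 := (sum_powerset_foldr (fun m => (orbProj φ m : ManyBody N →+ ManyBody N))
    (fun m => (orbCoproj φ m : ManyBody N →+ ManyBody N))
    (fun m x => orbProj_add_orbCoproj φ m x) ψ (List.finRange N) (List.nodup_finRange N)).2
  rw [List.toFinset_finRange] at h2
  have h3 : ∑ S ∈ (Finset.univ : Finset (Fin N)).powerset, S.card • F S =
      ∑ m, orbCoproj φ m ψ := h2
  have h4 : ∑ m, (inner ℂ ψ (orbCoproj φ m ψ)).re =
      ∑ S ∈ (Finset.univ : Finset (Fin N)).powerset, (S.card : ℝ) * (inner ℂ ψ (F S)).re := by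
    rw [← Complex.re_sum, ← inner_sum, ← h3, inner_sum, Complex.re_sum]
    refine Finset.sum_congr rfl fun S _ => ?_
    rw [← Nat.cast_smul_eq_nsmul ℂ, inner_smul_right, Complex.mul_re]
    simp
  rw [h4, Finset.sum_powerset, Finset.card_univ, Fintype.card_fin, Finset.mul_sum, alphaN,
    alphaFunctional]
  refine Finset.sum_congr rfl fun k _ => ?_
  rw [h1, Complex.re_sum, Finset.mul_sum, Finset.mul_sum]
  refine Finset.sum_congr rfl fun S hS => ?_
  rw [(Finset.mem_powersetCard.1 hS).2]
  ring

lemma alphaN_eq_norm_sq {ψ : ManyBody N} (hψ : AntisymmetricOn Finset.univ ψ)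
    {φ : Fin N → OneBody} (hφ : Orthonormal ℂ φ) (m : Fin N) :
    alphaN ψ φ = ‖orbCoproj φ m ψ‖ ^ 2 := by
  have hN : (N : ℝ) ≠ 0 := by
    have := m.pos
    positivity
  rw [alphaN_eq]
  have : ∀ i, (inner ℂ ψ (orbCoproj φ i ψ)).re = ‖orbCoproj φ m ψ‖ ^ 2 := by
    intro i
    rw [inner_orbCoproj_self hφ, Complex.ofReal_re, norm_orbCoproj_eq hψ φ i m]
  simp only [this, Finset.sum_const, Finset.card_univ, Fintype.card_fin, nsmul_eq_mul]
  field_simp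

end Counting

end

noncomputable section

/-! ### The Pauli principle -/

section Abstract

variable {H ι : Type*} [NormedAddCommGroup H] [InnerProductSpace ℂ H] (J : Finset ι)
  (τ : ι → H →L[ℂ] H)

/-- The operator `1 - ∑_{j ∈ J} τ_j`, a multiple of an antisymmetrization if the `τ_j` are
transpositions with a common index. -/
def antisymmetrizer : H →L[ℂ] H := 1 - ∑ j ∈ J, τ j

lemma antisymmetrizer_apply (F : H) : antisymmetrizer J τ F = F - ∑ j ∈ J, τ j F := by
  simp [antisymmetrizer]

variable {J τ} (hself : ∀ j F G, inner ℂ (τ j F) G = inner ℂ F (τ j G))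
  (hinv : ∀ j F, τ j (τ j F) = F)

include hinv in
-- For transpositions with a common index the hypothesis expresses antisymmetry of `F` in the
-- particles of `J`. Each `τ_i` then maps the image of `F` to its negative, so the operator acts on
-- that image as the scalar `|J| + 1`.
lemma antisymmetrizer_antisymmetrizer {F : H}
    (hF : ∀ i ∈ J, ∀ j ∈ J, i ≠ j → τ i (τ j F) = -τ j F) :
    antisymmetrizer J τ (antisymmetrizer J τ F) = ((J.card : ℂ) + 1) • antisymmetrizer J τ F := by
  classical
  have h : ∀ i ∈ J, τ i (antisymmetrizer J τ F) = -antisymmetrizer J τ F := by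
    intro i hi
    rw [antisymmetrizer_apply, map_sub, map_sum, ← Finset.add_sum_erase J _ hi,
      ← Finset.add_sum_erase J (fun j => τ j F) hi, hinv,
      Finset.sum_congr rfl fun j hj => hF i hi j (Finset.mem_of_mem_erase hj)
        (Finset.ne_of_mem_erase hj).symm, Finset.sum_neg_distrib]
    abel
  rw [antisymmetrizer_apply J τ (antisymmetrizer J τ F), Finset.sum_congr rfl h,
    Finset.sum_neg_distrib, Finset.sum_const, sub_neg_eq_add, ← Nat.cast_smul_eq_nsmul ℂ, add_smul,
    one_smul, add_comm]

include hself in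
lemma inner_antisymmetrizer_left (F G : H) :
    inner ℂ (antisymmetrizer J τ F) G = inner ℂ F (antisymmetrizer J τ G) := by
  simp only [antisymmetrizer_apply, inner_sub_left, inner_sub_right, sum_inner, inner_sum, hself]

include hself hinv in
lemma inner_antisymmetrizer {F G : H}
    (hG : ∀ i ∈ J, ∀ j ∈ J, i ≠ j → τ i (τ j G) = -τ j G) :
    inner ℂ (antisymmetrizer J τ F) (antisymmetrizer J τ G) =
      ((J.card : ℂ) + 1) * inner ℂ F (antisymmetrizer J τ G) := by
  rw [inner_antisymmetrizer_left hself, antisymmetrizer_antisymmetrizer hinv hG, inner_smul_right]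

include hself hinv in
lemma norm_antisymmetrizer_sq {F : H}
    (hF : ∀ i ∈ J, ∀ j ∈ J, i ≠ j → τ i (τ j F) = -τ j F) :
    ‖antisymmetrizer J τ F‖ ^ 2 =
      ((J.card : ℝ) + 1) * (inner ℂ F (antisymmetrizer J τ F)).re := by
  have h := congrArg Complex.re (inner_antisymmetrizer hself hinv (F := F) hF)
  have h2 : ((J.card : ℂ) + 1) = (((J.card : ℝ) + 1 : ℝ) : ℂ) := by push_cast; rfl
  rw [inner_self_eq_norm_sq_to_K, h2, Complex.re_ofReal_mul] at h
  rw [← h]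
  norm_cast

include hself hinv in
-- Since the symmetric operator squares to `|J| + 1` times itself on `F`, its form at `F` is a
-- positive multiple of a squared norm.
lemma inner_self_antisymmetrizer_nonneg {F : H}
    (hF : ∀ i ∈ J, ∀ j ∈ J, i ≠ j → τ i (τ j F) = -τ j F) :
    0 ≤ (inner ℂ F (antisymmetrizer J τ F)).re := by
  have h := norm_antisymmetrizer_sq hself hinv hF
  have h2 : (0 : ℝ) < (J.card : ℝ) + 1 := by positivity
  by_contra hc
  push Not at hc
  nlinarith [sq_nonneg ‖antisymmetrizer J τ F‖]

include hself hinv in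
/-- The Cauchy-Schwarz inequality for the antisymmetrizer. -/
lemma norm_inner_antisymmetrizer_le {F G : H}
    (hF : ∀ i ∈ J, ∀ j ∈ J, i ≠ j → τ i (τ j F) = -τ j F)
    (hG : ∀ i ∈ J, ∀ j ∈ J, i ≠ j → τ i (τ j G) = -τ j G) :
    ‖inner ℂ F (antisymmetrizer J τ G)‖ ≤
      √(inner ℂ F (antisymmetrizer J τ F)).re * √(inner ℂ G (antisymmetrizer J τ G)).re := by
  have h2 : (0 : ℝ) < (J.card : ℝ) + 1 := by positivity
  have h := inner_antisymmetrizer hself hinv (F := F) hG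
  have hn : ((J.card : ℝ) + 1) * ‖inner ℂ F (antisymmetrizer J τ G)‖ ≤
      ‖antisymmetrizer J τ F‖ * ‖antisymmetrizer J τ G‖ := by
    refine le_trans (le_of_eq ?_) (norm_inner_le_norm (𝕜 := ℂ) _ _)
    rw [h, norm_mul]
    congr 1
    have : ((J.card : ℂ) + 1) = (((J.card : ℝ) + 1 : ℝ) : ℂ) := by push_cast; rfl
    rw [this, Complex.norm_real, Real.norm_of_nonneg h2.le]
  have e : ∀ {F : H}, (∀ i ∈ J, ∀ j ∈ J, i ≠ j → τ i (τ j F) = -τ j F) →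
      ‖antisymmetrizer J τ F‖ =
        √((J.card : ℝ) + 1) * √(inner ℂ F (antisymmetrizer J τ F)).re := by
    intro F hF
    rw [← Real.sqrt_mul h2.le, ← norm_antisymmetrizer_sq hself hinv hF,
      Real.sqrt_sq (norm_nonneg _)]
  rw [e hF, e hG] at hn
  have h3 := Real.mul_self_sqrt h2.le
  refine le_of_mul_le_mul_left (hn.trans (le_of_eq ?_)) h2
  calc _ = (√((J.card : ℝ) + 1) * √((J.card : ℝ) + 1)) *
        (√(inner ℂ F (antisymmetrizer J τ F)).re * √(inner ℂ G (antisymmetrizer J τ G)).re) := by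
        ring
    _ = _ := by rw [h3]

end Abstract

section Concrete

variable {N : ℕ} {Z : Type*} [MeasureSpace Z]

/-- Two exchanges of the extra variable act with a sign on functions of the form `u · f`, where `f`
is antisymmetric and `u` does not depend on the exchanged particles. -/
lemma compMP_compMP_of_antisymmetric {J : Finset (Fin N)} {f : ManyBody N}
    (hf : AntisymmetricOn J f) {τ : Fin N → Z → Z}
    (hτ : ∀ j, MeasurePreserving (τ j) volume volume) {c : Z → Config N}
    (hc : Measure.QuasiMeasurePreserving c volume volume) {u : Z → ℂ}
    (hu : ∀ i ∈ J, ∀ j ∈ J, i ≠ j → ∀ p, u (τ j (τ i p)) = u (τ j p))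
    (hcτ : ∀ i ∈ J, ∀ j ∈ J, i ≠ j → ∀ p,
      c (τ j (τ i p)) = permConfig (Equiv.swap i j) (c (τ j p)))
    {F : SqInt Z} (hF : F =ᵐ[volume] fun p => u p * f (c p)) {i j : Fin N} (hi : i ∈ J)
    (hj : j ∈ J) (hij : i ≠ j) :
    compMP (τ i) (hτ i) (compMP (τ j) (hτ j) F) = -compMP (τ j) (hτ j) F := by
  refine Lp.ext ?_
  have h1 := coeFn_compMP_of_ae (hτ j) hF
  have h2 := coeFn_compMP_of_ae (hτ i) h1
  have h3 : ∀ᵐ x, f (permConfig (Equiv.swap i j) x) = -f x := by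
    have := hf i hi j hj hij
    filter_upwards [permOp_coeFn (Equiv.swap i j) (f := f) Filter.EventuallyEq.rfl,
      Lp.coeFn_neg f] with x h1 h2
    rw [← h1, this, h2, Pi.neg_apply]
  have h4 := (hc.comp (hτ j).quasiMeasurePreserving).ae h3
  filter_upwards [h1, h2, h4, Lp.coeFn_neg (compMP (τ j) (hτ j) F)] with p h1 h2 h4 h5
  rw [h2, h5, Pi.neg_apply, h1]
  simp only [Function.comp] at h4 ⊢
  rw [hu i hi j hj hij, hcτ i hi j hj hij, h4]
  ring

/-- Two successive exchanges of the extra variable amount to a single exchange followed by a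
transposition of two particles; antisymmetry turns the latter into a sign. -/
lemma update_update_eq_permConfig {i j : Fin N} (hij : i ≠ j) (x : Config N) (z : Pos) :
    Function.update (Function.update x i z) j (x i) =
      permConfig (Equiv.swap i j) (Function.update x j z) := by
  funext k
  simp only [permConfig, Function.update_apply, Equiv.swap_apply_def]
  grind

/-- The exchange operators on `L²(ℝ³ × ℝ^{3N})`. -/
def slotSwapOp (m : Fin N) : SqInt (Pos × Config N) →L[ℂ] SqInt (Pos × Config N) :=
  compMP (slotSwap m) (measurePreserving_slotSwap m)

lemma inner_slotSwapOp (m : Fin N) (F G : SqInt (Pos × Config N)) :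
    inner ℂ (slotSwapOp m F) G = inner ℂ F (slotSwapOp m G) :=
  inner_compMP_left _ _ (slotSwap_slotSwap m) F G

lemma slotSwapOp_slotSwapOp (m : Fin N) (F : SqInt (Pos × Config N)) :
    slotSwapOp m (slotSwapOp m F) = F :=
  compMP_compMP_inverse _ _ (slotSwap_slotSwap m) F

lemma slotSwapOp_antisymm {J : Finset (Fin N)} {f : ManyBody N}
    (hf : AntisymmetricOn J f) {u : Pos × Config N → ℂ}
    (hu : ∀ i ∈ J, ∀ z x y, u (z, Function.update x i y) = u (z, x))
    {F : SqInt (Pos × Config N)} (hF : F =ᵐ[volume] fun p => u p * f p.2) :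
    ∀ i ∈ J, ∀ j ∈ J, i ≠ j → slotSwapOp i (slotSwapOp j F) = -slotSwapOp j F := by
  intro i hi j hj hij
  refine compMP_compMP_of_antisymmetric hf (τ := slotSwap) measurePreserving_slotSwap
    (c := Prod.snd) Measure.quasiMeasurePreserving_snd (u := u) ?_ ?_ hF hi hj hij
  · intro i hi j hj hij p
    simp only [slotSwap]
    rw [Function.update_of_ne hij.symm, hu j hj, hu i hi, hu j hj]
  · intro i _ j _ hij p
    exact update_update_eq_permConfig hij _ _

/-- The exchange operators on `L²(ℝ³ × (ℝ³ × ℝ^{3N}))`, which leave the second variable alone. -/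
def spectatorSwapOp (m : Fin N) :
    SqInt (Pos × (Pos × Config N)) →L[ℂ] SqInt (Pos × (Pos × Config N)) :=
  compMP (spectatorSwap m) (measurePreserving_spectatorSwap m)

lemma inner_spectatorSwapOp (m : Fin N) (F G : SqInt (Pos × (Pos × Config N))) :
    inner ℂ (spectatorSwapOp m F) G = inner ℂ F (spectatorSwapOp m G) :=
  inner_compMP_left _ _ (spectatorSwap_spectatorSwap m) F G

lemma spectatorSwapOp_spectatorSwapOp (m : Fin N) (F : SqInt (Pos × (Pos × Config N))) :
    spectatorSwapOp m (spectatorSwapOp m F) = F :=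
  compMP_compMP_inverse _ _ (spectatorSwap_spectatorSwap m) F

lemma spectatorSwapOp_antisymm {J : Finset (Fin N)} {f : ManyBody N}
    (hf : AntisymmetricOn J f) {u : Pos × (Pos × Config N) → ℂ}
    (hu : ∀ i ∈ J, ∀ z y x a, u (z, y, Function.update x i a) = u (z, y, x))
    {F : SqInt (Pos × (Pos × Config N))} (hF : F =ᵐ[volume] fun p => u p * f p.2.2) :
    ∀ i ∈ J, ∀ j ∈ J, i ≠ j → spectatorSwapOp i (spectatorSwapOp j F) = -spectatorSwapOp j F := by
  intro i hi j hj hij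
  refine compMP_compMP_of_antisymmetric hf (τ := spectatorSwap) measurePreserving_spectatorSwap
    (c := fun p => p.2.2)
    ((Measure.quasiMeasurePreserving_snd (μ := (volume : Measure Pos))
      (ν := (volume : Measure (Config N)))).comp Measure.quasiMeasurePreserving_snd)
    (u := u) ?_ ?_ hF hi hj hij
  · intro i hi j hj hij p
    simp only [spectatorSwap]
    rw [Function.update_of_ne hij.symm, hu j hj, hu i hi, hu j hj]
  · intro i _ j _ hij p
    exact update_update_eq_permConfig hij _ _

/-- Integration over `ℝ³ × ℝ^{3(n+1)}` with the `m`-th coordinate singled out. -/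
lemma integral_slot {n : ℕ} (m : Fin (n + 1)) {E : Type*} [NormedAddCommGroup E]
    [NormedSpace ℝ E] (f : Pos × Config (n + 1) → E)
    (hf : Integrable f volume) :
    ∫ p, f p = ∫ r : Config n, ∫ q : Pos × Pos, f (q.1, m.insertNth q.2 r) := by
  have h1 := (MeasurePreserving.id (volume : Measure Pos)).prod (measurePreserving_insertNth m)
  have h2 := measurePreserving_prodAssoc (volume : Measure Pos) (volume : Measure Pos)
    (volume : Measure (Config n))
  have h := h1.comp h2
  have hemb : MeasurableEmbedding (Prod.map (id : Pos → Pos)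
      (fun p : Pos × Config n => (m.insertNth p.1 p.2 : Config (n + 1))) ∘
        (MeasurableEquiv.prodAssoc : (Pos × Pos) × Config n ≃ᵐ Pos × Pos × Config n)) := by
    refine MeasurableEmbedding.comp ?_ (MeasurableEquiv.measurableEmbedding _)
    exact MeasurableEmbedding.id.prodMap
      (MeasurableEquiv.piFinSuccAbove (fun _ => Pos) m).symm.measurableEmbedding
  have e := h.integral_comp hemb f
  refine e.symm.trans ?_
  have hint := (h.integrable_comp_emb hemb).2 hf
  exact integral_prod_symm _ hint

/-- As `u` is independent of `x_m`, the integrand factorizes in `z` and `x_m` once the other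
particles are frozen, and the scalar product equals `∫ |∫ conj (u(z, r)) f(z, r) dz|² dr`. -/
lemma inner_slotSwapOp_nonneg {f : ManyBody N} (m : Fin N) {u : Pos × Config N → ℂ}
    (hu : ∀ z x y, u (z, Function.update x m y) = u (z, x))
    {F : SqInt (Pos × Config N)} (hF : F =ᵐ[volume] fun p => u p * f p.2) :
    0 ≤ (inner ℂ F (slotSwapOp m F)).re := by
  obtain _ | n := N
  · exact m.elim0
  have hG := coeFn_compMP_of_ae (measurePreserving_slotSwap m) hF
  have hint : Integrable (fun p : Pos × Config (n + 1) => conj (u p * f p.2) *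
      ((fun p => u p * f p.2) ∘ slotSwap m) p) volume := by
    refine (L2.integrable_inner (𝕜 := ℂ) F (slotSwapOp m F)).congr ?_
    filter_upwards [hF, hG] with p h1 h2
    rw [RCLike.inner_apply', h1, slotSwapOp, h2]
  rw [slotSwapOp, inner_eq_integral_of_ae hF hG, integral_slot m _ hint]
  have hval : ∀ r : Config n, (∫ q : Pos × Pos,
      conj (u (q.1, m.insertNth q.2 r) * f (m.insertNth q.2 r)) *
        ((fun p => u p * f p.2) ∘ slotSwap m) (q.1, m.insertNth q.2 r)) =
      ((‖∫ z, conj (u (z, m.insertNth 0 r)) * f (m.insertNth z r)‖ ^ 2 : ℝ) : ℂ) := by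
    intro r
    -- The value of `u` is read off with `0` in the irrelevant slot `x_m`.
    have hu2 : ∀ z y, u (z, m.insertNth y r) = u (z, m.insertNth 0 r) := by
      intro z y
      rw [← hu z (m.insertNth 0 r) y, Fin.update_insertNth]
    rw [Complex.ofReal_pow, ← Complex.mul_conj', ← integral_conj, ← integral_prod_mul]
    refine integral_congr_ae (Filter.Eventually.of_forall fun q => ?_)
    simp only [Function.comp, slotSwap, Fin.insertNth_apply_same, Fin.update_insertNth, hu2,
      map_mul, Complex.conj_conj]
    ring
  simp only [hval]
  rw [integral_complex_ofReal, Complex.ofReal_re]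
  positivity

end Concrete

end

noncomputable section

/-! ### Bounds on the mean field -/

section MeanField

variable {N : ℕ} {v : Pos → ℝ} {φ : Fin N → OneBody} {κ : ℝ}

lemma measurable_orbital (u : OneBody) : Measurable (u : Pos → ℂ) :=
  (Lp.stronglyMeasurable u).measurable

lemma measurable_density (φ : Fin N → OneBody) : Measurable (density φ) :=
  Finset.measurable_sum _ fun k _ => (measurable_orbital (φ k)).norm.pow_const 2

lemma density_nonneg (φ : Fin N → OneBody) (x : Pos) : 0 ≤ density φ x :=
  Finset.sum_nonneg fun _ _ => by positivity

lemma norm_sq_le_density (φ : Fin N → OneBody) (k : Fin N) (x : Pos) :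
    ‖φ k x‖ ^ 2 ≤ density φ x :=
  Finset.single_le_sum (f := fun k => ‖φ k x‖ ^ 2) (fun _ _ => by positivity) (Finset.mem_univ k)

lemma integrable_norm_sq {Y : Type*} [MeasureSpace Y] (u : SqInt Y) :
    Integrable (fun x => ‖u x‖ ^ 2) volume :=
  (memLp_two_iff_integrable_sq_norm (Lp.aestronglyMeasurable u)).1 (Lp.memLp u)

lemma integrable_density (φ : Fin N → OneBody) : Integrable (density φ) volume :=
  integrable_finsetSum _ fun k _ => integrable_norm_sq (φ k)

lemma integral_density (φ : Fin N → OneBody) : ∫ x, density φ x = ∑ k, ‖φ k‖ ^ 2 := by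
  simp only [density]
  rw [integral_finsetSum _ fun k _ => integrable_norm_sq (φ k)]
  exact Finset.sum_congr rfl fun k _ => (norm_sq_eq_integral Filter.EventuallyEq.rfl).symm

variable (hv : Measurable v) (hκ : 0 ≤ κ)
  (hb : ∀ y, ∫⁻ x, ENNReal.ofReal (v (y - x) ^ 2 * density φ x) ≤ ENNReal.ofReal κ)

include hv hb in
lemma integrable_sq_mul_density (y : Pos) :
    Integrable (fun x => v (y - x) ^ 2 * density φ x) volume := by
  have hm : Measurable fun x => v (y - x) ^ 2 * density φ x :=
    ((hv.comp (measurable_const.sub measurable_id)).pow_const 2).mul (measurable_density φ)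
  refine ⟨hm.aestronglyMeasurable, ?_⟩
  rw [hasFiniteIntegral_iff_ofReal (Filter.Eventually.of_forall fun x =>
    mul_nonneg (sq_nonneg _) (density_nonneg φ x))]
  exact (hb y).trans_lt ENNReal.ofReal_lt_top

include hκ hb in
lemma integral_sq_mul_density_le (y : Pos) : ∫ x, v (y - x) ^ 2 * density φ x ≤ κ := by
  by_cases h : AEStronglyMeasurable (fun x => v (y - x) ^ 2 * density φ x) volume
  · rw [integral_eq_lintegral_of_nonneg_ae (Filter.Eventually.of_forall fun x =>
      mul_nonneg (sq_nonneg _) (density_nonneg φ x)) h]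
    exact ENNReal.toReal_le_of_le_ofReal hκ (hb y)
  -- A non-measurable integrand has Bochner integral `0`, so the bound still holds.
  · rw [integral_non_aestronglyMeasurable h]
    exact hκ

include hv hb in
-- The elementary bound `|v| ≤ 1 + v²` dominates the integrand by `ρ + v² ρ`, both integrable; the
-- bound on the mean field below arises in the same way.
lemma integrable_mul_density (y : Pos) :
    Integrable (fun x => v (y - x) * density φ x) volume := by
  refine ((integrable_density φ).add (integrable_sq_mul_density hv hb y)).mono'
    ((hv.comp (measurable_const.sub measurable_id)).mul
      (measurable_density φ)).aestronglyMeasurable (Filter.Eventually.of_forall fun x => ?_)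
  have h := density_nonneg φ x
  rw [norm_mul, Real.norm_of_nonneg h, Real.norm_eq_abs, Pi.add_apply]
  have : |v (y - x)| ≤ 1 + v (y - x) ^ 2 := by
    rw [← sq_abs]
    nlinarith [sq_nonneg (|v (y - x)| - 1)]
  nlinarith

include hv hκ hb in
lemma abs_meanField_le (y : Pos) : |meanField v φ y| ≤ ∑ k, ‖φ k‖ ^ 2 + κ := by
  have h1 : |meanField v φ y| ≤ ∫ x, (density φ x + v (y - x) ^ 2 * density φ x) := by
    rw [← Real.norm_eq_abs, meanField]
    refine norm_integral_le_of_norm_le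
      ((integrable_density φ).add (integrable_sq_mul_density hv hb y))
      (Filter.Eventually.of_forall fun x => ?_)
    have h := density_nonneg φ x
    rw [norm_mul, Real.norm_of_nonneg h, Real.norm_eq_abs]
    have : |v (y - x)| ≤ 1 + v (y - x) ^ 2 := by
      rw [← sq_abs]
      nlinarith [sq_nonneg (|v (y - x)| - 1)]
    nlinarith
  rw [integral_add (integrable_density φ) (integrable_sq_mul_density hv hb y),
    integral_density] at h1
  have := integral_sq_mul_density_le hκ hb y
  linarith

include hv in
lemma measurable_meanField (φ : Fin N → OneBody) : Measurable (meanField v φ) := by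
  have : StronglyMeasurable fun q : Pos × Pos => v (q.1 - q.2) * density φ q.2 :=
    ((hv.comp (measurable_fst.sub measurable_snd)).mul
      ((measurable_density φ).comp measurable_snd)).stronglyMeasurable
  exact this.integral_prod_right.measurable

end MeanField

/-! ### Consequences of the Pauli principle -/

/-- The interaction `v` satisfies `sup (v² ⋆ ρ) ≤ κ` for the density `ρ` of the orthonormal
orbitals `φ`. -/
structure InteractionBound {N : ℕ} (v : Pos → ℝ) (φ : Fin N → OneBody) (κ : ℝ) : Prop where
  measurable : Measurable v
  even : ∀ x, v (-x) = v x
  orthonormal : Orthonormal ℂ φ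
  nonneg : 0 ≤ κ
  bound : ∀ y, ∫⁻ x, ENNReal.ofReal (v (y - x) ^ 2 * density φ x) ≤ ENNReal.ofReal κ

section Pauli

variable {N : ℕ} {v : Pos → ℝ} {φ : Fin N → OneBody} {κ : ℝ}

/-- Integrating over `z` first and summing over `k` produces `(v² ⋆ ρ)(x_j)`, at most `κ` wherever
`x_j` is. Only `|u_k| = |φ_k|` is assumed because both the orbitals and their conjugates are needed.
-/
lemma exists_interTensor (h : InteractionBound v φ κ) (j : Fin N) (f : ManyBody N)
    {u : Fin N → Pos → ℂ} (hu : ∀ k, Measurable (u k)) (hu2 : ∀ k z, ‖u k z‖ = ‖φ k z‖) :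
    ∃ E : Fin N → SqInt (Pos × Config N),
      (∀ k, E k =ᵐ[volume] fun p => ((v (p.2 j - p.1) : ℝ) : ℂ) * u k p.1 * f p.2) ∧
      ∑ k, ‖E k‖ ^ 2 ≤ κ * ‖f‖ ^ 2 := by
  set G : Pos × Config N → ℝ := fun p => v (p.2 j - p.1) ^ 2 * density φ p.1 * ‖f p.2‖ ^ 2 with hG
  have hvm : Measurable fun p : Pos × Config N => v (p.2 j - p.1) :=
    h.measurable.comp (((measurable_pi_apply j).comp measurable_snd).sub measurable_fst)
  have hfm : Measurable fun p : Pos × Config N => f p.2 :=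
    (Lp.stronglyMeasurable f).measurable.comp measurable_snd
  have hGm : Measurable G :=
    ((hvm.pow_const 2).mul ((measurable_density φ).comp measurable_fst)).mul
      (hfm.norm.pow_const 2)
  have hG0 : ∀ p, 0 ≤ G p := fun p =>
    mul_nonneg (mul_nonneg (sq_nonneg _) (density_nonneg φ _)) (sq_nonneg _)
  have hGl : ∫⁻ p, ENNReal.ofReal (G p) ≤ ENNReal.ofReal (κ * ‖f‖ ^ 2) := by
    have e1 : ∫⁻ p, ENNReal.ofReal (G p) =
        ∫⁻ x : Config N, ∫⁻ z : Pos, ENNReal.ofReal (G (z, x)) :=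
      lintegral_prod_symm' _ hGm.ennreal_ofReal
    rw [e1]
    have e2 : ∀ x : Config N, ∫⁻ z : Pos, ENNReal.ofReal (G (z, x)) ≤
        ENNReal.ofReal κ * ENNReal.ofReal (‖f x‖ ^ 2) := by
      intro x
      have : ∀ z : Pos, ENNReal.ofReal (G (z, x)) =
          ENNReal.ofReal (v (x j - z) ^ 2 * density φ z) * ENNReal.ofReal (‖f x‖ ^ 2) :=
        fun z => ENNReal.ofReal_mul (mul_nonneg (sq_nonneg _) (density_nonneg φ _))
      simp only [this]
      rw [lintegral_mul_const' _ _ ENNReal.ofReal_ne_top]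
      gcongr
      exact h.bound _
    refine (lintegral_mono e2).trans ?_
    rw [lintegral_const_mul' _ _ ENNReal.ofReal_ne_top, ENNReal.ofReal_mul h.nonneg,
      ← ofReal_integral_eq_lintegral_ofReal (integrable_norm_sq f)
        (Filter.Eventually.of_forall fun x => by positivity),
      norm_sq_eq_integral (F := f) Filter.EventuallyEq.rfl]
  have hGi : Integrable G volume := by
    refine ⟨hGm.aestronglyMeasurable, ?_⟩
    rw [hasFiniteIntegral_iff_ofReal (Filter.Eventually.of_forall hG0)]
    exact hGl.trans_lt ENNReal.ofReal_lt_top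
  have hEm : ∀ k, Measurable fun p : Pos × Config N =>
      ((v (p.2 j - p.1) : ℝ) : ℂ) * u k p.1 * f p.2 := fun k =>
    ((Complex.measurable_ofReal.comp hvm).mul ((hu k).comp measurable_fst)).mul hfm
  have hsq : ∀ k (p : Pos × Config N), ‖((v (p.2 j - p.1) : ℝ) : ℂ) * u k p.1 * f p.2‖ ^ 2 =
      v (p.2 j - p.1) ^ 2 * ‖φ k p.1‖ ^ 2 * ‖f p.2‖ ^ 2 := by
    intro k p
    rw [norm_mul, norm_mul, mul_pow, mul_pow, hu2, Complex.norm_real, Real.norm_eq_abs, sq_abs]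
  have hE : ∀ k, MemLp (fun p : Pos × Config N =>
      ((v (p.2 j - p.1) : ℝ) : ℂ) * u k p.1 * f p.2) 2 := by
    intro k
    rw [memLp_two_iff_integrable_sq_norm (hEm k).aestronglyMeasurable]
    refine hGi.mono' ((hEm k).norm.pow_const 2).aestronglyMeasurable
      (Filter.Eventually.of_forall fun p => ?_)
    rw [Real.norm_of_nonneg (by positivity), hsq]
    have := norm_sq_le_density φ k p.1
    simp only [hG]
    gcongr
  refine ⟨fun k => (hE k).toLp _, fun k => (hE k).coeFn_toLp, ?_⟩
  simp only [norm_toLp_sq, hsq]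
  rw [← integral_finsetSum]
  · have e : ∀ p : Pos × Config N, ∑ k, v (p.2 j - p.1) ^ 2 * ‖φ k p.1‖ ^ 2 * ‖f p.2‖ ^ 2 =
        G p := by
      intro p
      simp only [hG, density]
      rw [← Finset.sum_mul, ← Finset.mul_sum]
    simp only [e]
    rw [integral_eq_lintegral_of_nonneg_ae (Filter.Eventually.of_forall hG0)
      hGm.aestronglyMeasurable]
    exact ENNReal.toReal_le_of_le_ofReal (mul_nonneg h.nonneg (sq_nonneg _)) hGl
  · intro k _
    have := (memLp_two_iff_integrable_sq_norm (hEm k).aestronglyMeasurable).1 (hE k)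
    exact this.congr (Filter.Eventually.of_forall fun p => hsq k p)

lemma integral_two_slots {X E : Type*} [MeasureSpace X] [SigmaFinite (volume : Measure X)]
    [NormedAddCommGroup E] [NormedSpace ℝ E] (f : Pos × (Pos × X) → E)
    (hf : Integrable f volume) :
    Integrable (fun x : X => ∫ q : Pos × Pos, f (q.1, (q.2, x))) volume ∧
      ∫ p, f p = ∫ x : X, ∫ q : Pos × Pos, f (q.1, (q.2, x)) := by
  have h := measurePreserving_prodAssoc (volume : Measure Pos) (volume : Measure Pos)
    (volume : Measure X)
  have hemb := (MeasurableEquiv.prodAssoc : (Pos × Pos) × X ≃ᵐ Pos × Pos × X).measurableEmbedding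
  have e := h.integral_comp hemb f
  have hint := (h.integrable_comp_emb hemb).2 hf
  exact ⟨hint.integral_prod_right, e.symm.trans (integral_prod_symm _ hint)⟩

/-- This is `⟨v |u'⟩⟨u'|_i f, v |u⟩⟨u|_i f⟩`, with `v = v(x_j - x_i)`. After exchanging the second
variable with `x_i`, the integrand is a function of the first variable times a function of the
second, the configuration being a parameter, and the two integrals are the partial scalar products.
-/
lemma inner_spectatorSwapOp_tensor {i j : Fin N} (hij : i ≠ j) (f : ManyBody N)
    {E E' : SqInt (Pos × Config N)} {u u' : OneBody}
    (hE : E =ᵐ[volume] fun p => ((v (p.2 j - p.1) : ℝ) : ℂ) * conj (u p.1) * f p.2)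
    (hE' : E' =ᵐ[volume] fun p => ((v (p.2 j - p.1) : ℝ) : ℂ) * conj (u' p.1) * f p.2) :
    Integrable (fun x : Config N =>
      (((v (x j - x i) : ℝ) : ℂ) * (u (x i) * ∫ z, conj (u z) * f (Function.update x i z))) *
      conj (((v (x j - x i) : ℝ) : ℂ) *
        (u' (x i) * ∫ z, conj (u' z) * f (Function.update x i z)))) volume ∧
    inner ℂ (tensor u E) (spectatorSwapOp i (tensor u' E')) = ∫ x : Config N,
      (((v (x j - x i) : ℝ) : ℂ) * (u (x i) * ∫ z, conj (u z) * f (Function.update x i z))) *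
      conj (((v (x j - x i) : ℝ) : ℂ) *
        (u' (x i) * ∫ z, conj (u' z) * f (Function.update x i z))) := by
  -- This change of variables exchanges the second variable with `x_i`, which moves the singular
  -- factor to `v(x_j - x_i)`.
  have hθ : MeasurePreserving (Prod.map (id : Pos → Pos) (slotSwap i)) volume volume :=
    (MeasurePreserving.id (volume : Measure Pos)).prod (measurePreserving_slotSwap i)
  have h1 : tensor u E =ᵐ[volume] fun p : Pos × (Pos × Config N) =>
      u p.1 * (((v (p.2.2 j - p.2.1) : ℝ) : ℂ) * conj (u p.2.1) * f p.2.2) := by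
    filter_upwards [coeFn_tensor u E, ae_snd (Y := Pos) hE] with p h1 h2
    rw [h1, h2]
  have h2 : tensor u' E' =ᵐ[volume] fun p : Pos × (Pos × Config N) =>
      u' p.1 * (((v (p.2.2 j - p.2.1) : ℝ) : ℂ) * conj (u' p.2.1) * f p.2.2) := by
    filter_upwards [coeFn_tensor u' E', ae_snd (Y := Pos) hE'] with p h1 h2
    rw [h1, h2]
  have h3 := coeFn_compMP_of_ae hθ h1
  have h4 := coeFn_compMP_of_ae hθ (coeFn_compMP_of_ae (measurePreserving_spectatorSwap i) h2)
  have hint := L2.integrable_inner (𝕜 := ℂ) (compMP _ hθ (tensor u E))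
    (compMP _ hθ (spectatorSwapOp i (tensor u' E')))
  have e : inner ℂ (tensor u E) (spectatorSwapOp i (tensor u' E')) =
      inner ℂ (compMP _ hθ (tensor u E)) (compMP _ hθ (spectatorSwapOp i (tensor u' E'))) :=
    (inner_compMP_compMP hθ _ _).symm
  obtain ⟨g, hg⟩ : ∃ g : Pos × (Pos × Config N) → ℂ, g = fun p =>
    (((v (p.2.2 j - p.2.2 i) : ℝ) : ℂ) * ((v (p.2.2 j - p.2.2 i) : ℝ) : ℂ) * u (p.2.2 i) *
      conj (u' (p.2.2 i))) * ((conj (u p.1) * f (Function.update p.2.2 i p.1)) *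
        (u' p.2.1 * conj (f (Function.update p.2.2 i p.2.1)))) := ⟨_, rfl⟩
  have hgae : (fun p => inner ℂ (compMP _ hθ (tensor u E) p)
      (compMP _ hθ (spectatorSwapOp i (tensor u' E')) p)) =ᵐ[volume] g := by
    filter_upwards [h3, h4] with p h3 h4
    rw [RCLike.inner_apply', h3, spectatorSwapOp, h4]
    simp only [Function.comp, Prod.map, id, slotSwap, spectatorSwap, Function.update_self,
      Function.update_idem, Function.update_of_ne hij.symm, map_mul, Complex.conj_conj,
      Complex.conj_ofReal, hg]
    ring
  have hgi : Integrable g volume := hint.congr hgae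
  have hfin := integral_two_slots g hgi
  have hval : ∀ x : Config N, (∫ q : Pos × Pos, g (q.1, (q.2, x))) =
      (((v (x j - x i) : ℝ) : ℂ) * (u (x i) * ∫ z, conj (u z) * f (Function.update x i z))) *
      conj (((v (x j - x i) : ℝ) : ℂ) *
        (u' (x i) * ∫ z, conj (u' z) * f (Function.update x i z))) := by
    intro x
    simp only [hg, map_mul, Complex.conj_ofReal]
    rw [← integral_conj]
    have e3 := integral_prod_mul (μ := (volume : Measure Pos)) (ν := (volume : Measure Pos))
      (fun z => conj (u z) * f (Function.update x i z))
      (fun z => u' z * conj (f (Function.update x i z)))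
    have e4 := integral_const_mul (μ := (volume : Measure (Pos × Pos)))
      (((v (x j - x i) : ℝ) : ℂ) * ((v (x j - x i) : ℝ) : ℂ) * u (x i) * conj (u' (x i)))
      (fun q : Pos × Pos => (conj (u q.1) * f (Function.update x i q.1)) *
        (u' q.2 * conj (f (Function.update x i q.2))))
    rw [e4]
    refine (congrArg _ e3).trans ?_
    simp only [map_mul, Complex.conj_conj]
    ring
  simp only [hval] at hfin
  refine ⟨hfin.1, ?_⟩
  rw [e, L2.inner_def, integral_congr_ae hgae]
  exact hfin.2

end Pauli

/-! ### The factor `1 / |J|` gained from antisymmetry -/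

section AbstractBound

variable {H ι : Type*} [NormedAddCommGroup H] [InnerProductSpace ℂ H] {J : Finset ι}
  {τ : ι → H →L[ℂ] H} (hself : ∀ j F G, inner ℂ (τ j F) G = inner ℂ F (τ j G))
  (hinv : ∀ j F, τ j (τ j F) = F)

include hself hinv in
-- By antisymmetry `⟨F, τ_j F⟩ = -⟨τ_i F, τ_j F⟩` for `i ≠ j`, so the real parts are the same for
-- all `j ∈ J`. Nonnegativity of the antisymmetrizer then reads `‖F‖² - |J| Re ⟨F, τ_i F⟩ ≥ 0`.
lemma card_mul_inner_le {F : H} (hF : ∀ i ∈ J, ∀ j ∈ J, i ≠ j → τ i (τ j F) = -τ j F) {i : ι}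
    (hi : i ∈ J) : (J.card : ℝ) * (inner ℂ F (τ i F)).re ≤ ‖F‖ ^ 2 := by
  have h := inner_self_antisymmetrizer_nonneg hself hinv hF
  have hj : ∀ j ∈ J, (inner ℂ F (τ j F)).re = (inner ℂ F (τ i F)).re := by
    intro j hj
    obtain rfl | hij := eq_or_ne i j
    · rfl
    have e1 : inner ℂ F (τ j F) = -inner ℂ (τ i F) (τ j F) := by
      rw [hself, hF i hi j hj hij, inner_neg_right, neg_neg]
    have e2 : inner ℂ F (τ i F) = -inner ℂ (τ j F) (τ i F) := by
      rw [hself, hF j hj i hi hij.symm, inner_neg_right, neg_neg]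
    rw [e1, e2, ← inner_conj_symm (τ j F) (τ i F), Complex.neg_re, Complex.neg_re, Complex.conj_re]
  rw [antisymmetrizer_apply, inner_sub_right, inner_sum, Complex.sub_re, Complex.re_sum,
    Finset.sum_congr rfl hj, Finset.sum_const, nsmul_eq_mul, inner_self_eq_norm_sq_to_K] at h
  have e : (((‖F‖ : ℝ) : ℂ) ^ 2).re = ‖F‖ ^ 2 := by norm_cast
  have e' : ((RCLike.ofReal ‖F‖ : ℂ) ^ 2).re = ‖F‖ ^ 2 := e
  rw [e'] at h
  linarith

end AbstractBound

end

/-! ### The operators `v(x_i - x_j) p_i` and their comparison with the mean field -/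

noncomputable section

section InterProj

variable {N : ℕ} {v : Pos → ℝ} {φ : Fin N → OneBody} {κ : ℝ}

/-- The function `v(x_i - x_j) (p_i f)(x)` is square integrable, and its norm gains a factor
`|J|^{-1/2}` if `f` is antisymmetric in the particles `J`. -/
lemma memLp_inter_projP (h : InteractionBound v φ κ) {i j : Fin N} (hij : i ≠ j)
    (f : ManyBody N) {J : Finset (Fin N)} (hi : i ∈ J) (hj : j ∉ J) (hf : AntisymmetricOn J f) :
    MemLp (fun x => ((v (x i - x j) : ℝ) : ℂ) * projP φ i f x) 2 ∧
      (J.card : ℝ) * ∫ x, ‖((v (x i - x j) : ℝ) : ℂ) * projP φ i f x‖ ^ 2 ≤ κ * ‖f‖ ^ 2 := by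
  obtain ⟨E, hE, hEn⟩ := exists_interTensor h j f (u := fun k z => conj (φ k z))
    (fun k => Complex.continuous_conj.measurable.comp (measurable_orbital (φ k)))
    (fun k z => by simp)
  -- `F(z, y, x) = ∑_k φ_k(z) conj (φ_k(y)) v(x_j - y) f(x)` carries the integral kernel of the
  -- projection. Orthonormality in `z` gives `‖F‖² = ∑ ‖E_k‖² ≤ κ ‖f‖²`, while `⟨F, τ_i F⟩`, with
  -- `τ_i` exchanging `z` and `x_i`, equals `‖v(x_i - x_j) p_i f‖²`.
  obtain ⟨F, hF⟩ : ∃ F : SqInt (Pos × (Pos × Config N)), F = ∑ k, tensor (φ k) (E k) := ⟨_, rfl⟩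
  have hFn : ‖F‖ ^ 2 = ∑ k, ‖E k‖ ^ 2 := by
    have e : inner ℂ F F = ∑ k, ((‖E k‖ ^ 2 : ℝ) : ℂ) := by
      rw [hF, sum_inner]
      refine Finset.sum_congr rfl fun k _ => ?_
      rw [inner_sum, Finset.sum_eq_single k]
      · rw [inner_tensor, orthonormal_iff_ite.1 h.orthonormal, if_pos rfl, one_mul,
          inner_self_eq_norm_sq_to_K]
        simp
      · intro l _ hl
        rw [inner_tensor, orthonormal_iff_ite.1 h.orthonormal, if_neg hl.symm, zero_mul]
      · simp
    rw [inner_self_eq_norm_sq_to_K] at e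
    have e2 : ((‖F‖ ^ 2 : ℝ) : ℂ) = ((∑ k, ‖E k‖ ^ 2 : ℝ) : ℂ) := by
      rw [Complex.ofReal_sum, ← e]
      simp
    exact Complex.ofReal_injective e2
  have hFc : F =ᵐ[volume] fun p : Pos × (Pos × Config N) =>
      (∑ k, φ k p.1 * (((v (p.2.2 j - p.2.1) : ℝ) : ℂ) * conj (φ k p.2.1))) * f p.2.2 := by
    rw [hF]
    refine (Lp.coeFn_finsetSum _ _).trans ?_
    filter_upwards [ae_all_iff.2 fun k => coeFn_tensor (φ k) (E k),
      ae_snd (Y := Pos) (ae_all_iff.2 hE)] with p h1 h2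
    rw [Finset.sum_apply, Finset.sum_mul]
    refine Finset.sum_congr rfl fun k _ => ?_
    rw [h1, h2]
    ring
  have hanti := spectatorSwapOp_antisymm hf
    (u := fun p => ∑ k, φ k p.1 * (((v (p.2.2 j - p.2.1) : ℝ) : ℂ) * conj (φ k p.2.1)))
    (fun l hl z y x a => by
      have : j ≠ l := fun hjl => hj (hjl ▸ hl)
      simp only [Function.update_of_ne this]) hFc
  have hbound := card_mul_inner_le inner_spectatorSwapOp spectatorSwapOp_spectatorSwapOp hanti hi
  have hkl := fun k l => inner_spectatorSwapOp_tensor (v := v) hij f (hE k) (hE l)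
  obtain ⟨g, hg⟩ : ∃ g : Config N → ℂ,
    g = fun x => ((v (x i - x j) : ℝ) : ℂ) * projP φ i f x := ⟨_, rfl⟩
  have hsum : ∀ x : Config N, ∑ k, ∑ l,
      (((v (x j - x i) : ℝ) : ℂ) *
        (φ k (x i) * ∫ z, conj (φ k z) * f (Function.update x i z))) *
      conj (((v (x j - x i) : ℝ) : ℂ) *
        (φ l (x i) * ∫ z, conj (φ l z) * f (Function.update x i z))) = ((‖g x‖ ^ 2 : ℝ) : ℂ) := by
    intro x
    have e : g x = ∑ k, ((v (x j - x i) : ℝ) : ℂ) *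
        (φ k (x i) * ∫ z, conj (φ k z) * f (Function.update x i z)) := by
      simp only [hg, projP]
      rw [← Finset.mul_sum, ← h.even (x i - x j), neg_sub]
    rw [Complex.ofReal_pow, ← Complex.mul_conj', e, map_sum, Finset.sum_mul]
    exact Finset.sum_congr rfl fun k _ => (Finset.mul_sum _ _ _).symm
  have hint : Integrable (fun x => ((‖g x‖ ^ 2 : ℝ) : ℂ)) volume := by
    have : Integrable (fun x : Config N => ∑ k, ∑ l,
      (((v (x j - x i) : ℝ) : ℂ) *
        (φ k (x i) * ∫ z, conj (φ k z) * f (Function.update x i z))) *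
      conj (((v (x j - x i) : ℝ) : ℂ) *
        (φ l (x i) * ∫ z, conj (φ l z) * f (Function.update x i z)))) volume :=
      integrable_finsetSum _ fun k _ => integrable_finsetSum _ fun l _ => (hkl k l).1
    exact this.congr (Filter.Eventually.of_forall hsum)
  have hval : inner ℂ F (spectatorSwapOp i F) = ((∫ x, ‖g x‖ ^ 2 : ℝ) : ℂ) := by
    rw [hF, sum_inner]
    simp only [map_sum, inner_sum]
    simp only [(hkl _ _).2]
    rw [← integral_complex_ofReal, ← integral_congr_ae (Filter.Eventually.of_forall hsum),
      integral_finsetSum _ fun k _ => integrable_finsetSum _ fun l _ => (hkl k l).1]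
    refine Finset.sum_congr rfl fun k _ => ?_
    rw [integral_finsetSum _ fun l _ => (hkl k l).1]
  have hgm : AEStronglyMeasurable g volume := by
    have h1 : AEStronglyMeasurable (projP φ i f) volume :=
      (Lp.aestronglyMeasurable (orbProj φ i f)).congr
        (orbProj_coeFn φ i (f := f) Filter.EventuallyEq.rfl)
    have h2 : Measurable fun x : Config N => ((v (x i - x j) : ℝ) : ℂ) :=
      Complex.measurable_ofReal.comp
        (h.measurable.comp ((measurable_pi_apply i).sub (measurable_pi_apply j)))
    rw [hg]
    exact h2.aestronglyMeasurable.mul h1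
  rw [← hg]
  refine ⟨(memLp_two_iff_integrable_sq_norm hgm).2 ?_, ?_⟩
  · exact hint.re.congr (Filter.Eventually.of_forall fun x => Complex.ofReal_re _)
  · rw [hval, Complex.ofReal_re, hFn] at hbound
    have e : ∀ x, ‖((v (x i - x j) : ℝ) : ℂ) * projP φ i f x‖ ^ 2 = ‖g x‖ ^ 2 := by
      intro x; rw [hg]
    simp only [e]
    exact hbound.trans hEn

lemma antisymmetricOn_singleton (i : Fin N) (f : ManyBody N) : AntisymmetricOn {i} f := by
  intro a ha b hb hab
  rw [Finset.mem_singleton] at ha hb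
  exact absurd (ha.trans hb.symm) hab

lemma memLp_inter_orbProj (h : InteractionBound v φ κ) {i j : Fin N} (hij : i ≠ j)
    (f : ManyBody N) : MemLp (fun x => ((v (x i - x j) : ℝ) : ℂ) * orbProj φ i f x) 2 := by
  have h1 := (memLp_inter_projP h hij f (Finset.mem_singleton_self i)
    (by simpa using hij.symm) (antisymmetricOn_singleton i f)).1
  refine h1.ae_eq ?_
  filter_upwards [orbProj_coeFn φ i (f := f) Filter.EventuallyEq.rfl] with x hx
  rw [hx]

/-- The bounded operator `v(x_i - x_j) p_i`, as a function. -/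
def interProjFun (h : InteractionBound v φ κ) {i j : Fin N} (hij : i ≠ j) (f : ManyBody N) :
    ManyBody N :=
  (memLp_inter_orbProj h hij f).toLp _

lemma interProjFun_coeFn (h : InteractionBound v φ κ) {i j : Fin N} (hij : i ≠ j)
    (f : ManyBody N) : interProjFun h hij f =ᵐ[volume]
      fun x => ((v (x i - x j) : ℝ) : ℂ) * orbProj φ i f x :=
  MemLp.coeFn_toLp _

lemma card_mul_norm_interProjFun_le (h : InteractionBound v φ κ) {i j : Fin N} (hij : i ≠ j)
    (f : ManyBody N) {J : Finset (Fin N)} (hi : i ∈ J) (hj : j ∉ J) (hf : AntisymmetricOn J f) :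
    (J.card : ℝ) * ‖interProjFun h hij f‖ ^ 2 ≤ κ * ‖f‖ ^ 2 := by
  have h1 := (memLp_inter_projP h hij f hi hj hf).2
  rw [norm_sq_eq_integral (F' := fun x => ((v (x i - x j) : ℝ) : ℂ) * projP φ i f x)]
  · exact h1
  · filter_upwards [interProjFun_coeFn h hij f,
      orbProj_coeFn φ i (f := f) Filter.EventuallyEq.rfl] with x h1 h2
    rw [h1, h2]

/-- The bounded operator `v(x_i - x_j) p_i`. -/
def interProj (h : InteractionBound v φ κ) {i j : Fin N} (hij : i ≠ j) :
    ManyBody N →L[ℂ] ManyBody N :=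
  LinearMap.mkContinuous
    { toFun := interProjFun h hij
      map_add' := fun f g => by
        refine Lp.ext ?_
        filter_upwards [interProjFun_coeFn h hij (f + g), interProjFun_coeFn h hij f,
          interProjFun_coeFn h hij g, Lp.coeFn_add (interProjFun h hij f) (interProjFun h hij g),
          Lp.coeFn_add (orbProj φ i f) (orbProj φ i g)] with x h1 h2 h3 h4 h5
        rw [h1, h4, Pi.add_apply, h2, h3, map_add, h5, Pi.add_apply, mul_add]
      map_smul' := fun c f => by
        refine Lp.ext ?_
        filter_upwards [interProjFun_coeFn h hij (c • f), interProjFun_coeFn h hij f,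
          Lp.coeFn_smul c (interProjFun h hij f), Lp.coeFn_smul c (orbProj φ i f)]
          with x h1 h2 h3 h4
        rw [RingHom.id_apply, h1, h3, Pi.smul_apply, h2, map_smul, h4, Pi.smul_apply, smul_eq_mul,
          smul_eq_mul]
        ring }
    (√κ) (fun f => by
      -- For the plain operator bound `J = {i}` suffices, since antisymmetry in one particle is no
      -- condition.
      have h1 := card_mul_norm_interProjFun_le h hij f (Finset.mem_singleton_self i)
        (by simpa using hij.symm) (antisymmetricOn_singleton i f)
      rw [Finset.card_singleton, Nat.cast_one, one_mul] at h1
      refine (pow_le_pow_iff_left₀ (norm_nonneg _) (by positivity) two_ne_zero).1 ?_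
      rw [mul_pow, Real.sq_sqrt h.nonneg]
      exact h1)

lemma norm_interProj_le (h : InteractionBound v φ κ) {i j : Fin N} (hij : i ≠ j) :
    ‖interProj h hij‖ ≤ √κ :=
  LinearMap.mkContinuous_norm_le _ (Real.sqrt_nonneg _) _

lemma interProj_coeFn (h : InteractionBound v φ κ) {i j : Fin N} (hij : i ≠ j)
    (f : ManyBody N) : interProj h hij f =ᵐ[volume]
      fun x => ((v (x i - x j) : ℝ) : ℂ) * orbProj φ i f x :=
  interProjFun_coeFn h hij f

lemma card_mul_norm_interProj_le (h : InteractionBound v φ κ) {i j : Fin N} (hij : i ≠ j)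
    (f : ManyBody N) {J : Finset (Fin N)} (hi : i ∈ J) (hj : j ∉ J) (hf : AntisymmetricOn J f) :
    (J.card : ℝ) * ‖interProj h hij f‖ ^ 2 ≤ κ * ‖f‖ ^ 2 :=
  card_mul_norm_interProjFun_le h hij f hi hj hf

/-- `p_m` commutes with multiplication by functions which do not depend on `x_m`. -/
lemma orbProj_mul_coeFn (φ : Fin N → OneBody) (m : Fin N) {c : Config N → ℂ}
    (hc : ∀ x z, c (Function.update x m z) = c x) {f g : ManyBody N}
    (hg : g =ᵐ[volume] fun x => c x * f x) :
    orbProj φ m g =ᵐ[volume] fun x => c x * orbProj φ m f x := by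
  filter_upwards [orbProj_coeFn φ m hg, orbProj_coeFn φ m (f := f) Filter.EventuallyEq.rfl]
    with x h1 h2
  rw [h1, h2]
  simp only [projP, Finset.mul_sum, hc]
  refine Finset.sum_congr rfl fun k _ => ?_
  have e : ∀ z, conj (φ k z) * (c x * f (Function.update x m z)) =
      c x * (conj (φ k z) * f (Function.update x m z)) := fun z => by ring
  simp only [e]
  rw [integral_const_mul]
  ring

lemma interProj_orbProj_comm (h : InteractionBound v φ κ) {i j m : Fin N} (hij : i ≠ j)
    (hmi : m ≠ i) (hmj : m ≠ j) (f : ManyBody N) :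
    orbProj φ m (interProj h hij f) = interProj h hij (orbProj φ m f) := by
  refine Lp.ext ?_
  have h1 := orbProj_mul_coeFn φ m (c := fun x => ((v (x i - x j) : ℝ) : ℂ))
    (fun x z => by simp only [Function.update_of_ne hmi.symm, Function.update_of_ne hmj.symm])
    (interProj_coeFn h hij f)
  filter_upwards [h1, interProj_coeFn h hij (orbProj φ m f)] with x h1 h2
  rw [h1, h2, orbProj_comm φ hmi.symm]

lemma interProj_orbCoproj_comm (h : InteractionBound v φ κ) {i j m : Fin N} (hij : i ≠ j)
    (hmi : m ≠ i) (hmj : m ≠ j) (f : ManyBody N) :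
    orbCoproj φ m (interProj h hij f) = interProj h hij (orbCoproj φ m f) := by
  rw [orbCoproj_apply, orbCoproj_apply, map_sub, interProj_orbProj_comm h hij hmi hmj]

/-- The estimate for the difference of the mean field and the projected interaction. -/
lemma norm_inner_meanField_sub_le (h : InteractionBound v φ κ) {J : Finset (Fin N)} {i : Fin N}
    (hi : i ∉ J) {f g Vg : ManyBody N} (hf : AntisymmetricOn J f) (hg : AntisymmetricOn J g)
    (hVg : Vg =ᵐ[volume] fun x => ((meanField v φ (x i) : ℝ) : ℂ) * g x)
    {w : Fin N → ManyBody N}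
    (hw : ∀ j ∈ J, w j =ᵐ[volume] fun x => ((v (x i - x j) : ℝ) : ℂ) * g x) :
    ‖inner ℂ f (Vg - ∑ j ∈ J, orbProj φ j (w j))‖ ≤
      √(κ * ‖f‖ ^ 2) * √(N * ‖g‖ ^ 2 - ∑ j ∈ J, (inner ℂ g (orbProj φ j g)).re) := by
  -- Here `F_k(z, x) = v(x_i - z) φ_k(z) f(x)`. Paired with `φ_k ⊗ g` and summed over `k` it gives
  -- the mean field (`e1`). Paired with the exchange of `φ_k ⊗ g` in slot `j` it gives the
  -- interaction projected by `p_j` (`e2`). The difference is a pairing with the antisymmetrizer.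
  obtain ⟨F, hF, hFn⟩ := exists_interTensor h i f (u := fun k => φ k)
    (fun k => measurable_orbital (φ k)) (fun k z => rfl)
  have e1 : ∑ k, inner ℂ (F k) (tensor (φ k) g) = inner ℂ f Vg := by
    have hint : ∀ k, Integrable (fun p : Pos × Config N =>
        ((v (p.2 i - p.1) : ℝ) : ℂ) * (‖φ k p.1‖ ^ 2 : ℝ) * (conj (f p.2) * g p.2)) volume ∧
        inner ℂ (F k) (tensor (φ k) g) = ∫ p : Pos × Config N,
        ((v (p.2 i - p.1) : ℝ) : ℂ) * (‖φ k p.1‖ ^ 2 : ℝ) * (conj (f p.2) * g p.2) := by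
      intro k
      have hae : (fun p => inner ℂ (F k p) (tensor (φ k) g p)) =ᵐ[volume]
          fun p : Pos × Config N =>
          ((v (p.2 i - p.1) : ℝ) : ℂ) * (‖φ k p.1‖ ^ 2 : ℝ) * (conj (f p.2) * g p.2) := by
        filter_upwards [hF k, coeFn_tensor (φ k) g] with p h1 h2
        rw [RCLike.inner_apply', h1, h2, Complex.ofReal_pow, ← Complex.conj_mul']
        simp only [map_mul, Complex.conj_ofReal]
        ring
      refine ⟨(L2.integrable_inner (𝕜 := ℂ) (F k) (tensor (φ k) g)).congr hae, ?_⟩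
      rw [L2.inner_def, integral_congr_ae hae]
    rw [Finset.sum_congr rfl fun k _ => (hint k).2, ← integral_finsetSum _ fun k _ => (hint k).1,
      inner_eq_integral_of_ae Filter.EventuallyEq.rfl hVg]
    have hsum := integrable_finsetSum Finset.univ fun k _ => (hint k).1
    refine (integral_prod_symm _ hsum).trans ?_
    refine integral_congr_ae (Filter.Eventually.of_forall fun x => ?_)
    simp only [meanField]
    rw [← integral_complex_ofReal, mul_left_comm, ← integral_mul_const]
    refine integral_congr_ae (Filter.Eventually.of_forall fun z => ?_)
    simp only [density, Complex.ofReal_mul, Complex.ofReal_sum]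
    rw [← Finset.sum_mul, ← Finset.mul_sum]
  have e2 : ∀ j ∈ J, ∑ k, inner ℂ (F k) (slotSwapOp j (tensor (φ k) g)) =
      inner ℂ f (orbProj φ j (w j)) := by
    intro j hj
    have hij : i ≠ j := fun hij => hi (hij ▸ hj)
    rw [orbProj_apply, inner_sum]
    refine Finset.sum_congr rfl fun k _ => ?_
    rw [inner_rankOne, slotSwapOp,
      inner_eq_integral_of_ae (hF k) (coeFn_compMP_of_ae _ (coeFn_tensor (φ k) g))]
    have h1 : tensor (φ k) (w j) =ᵐ[volume] fun p : Pos × Config N =>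
        φ k p.1 * (((v (p.2 i - p.2 j) : ℝ) : ℂ) * g p.2) := by
      filter_upwards [coeFn_tensor (φ k) (w j), ae_snd (Y := Pos) (hw j hj)] with p h1 h2
      rw [h1, h2]
    rw [inner_eq_integral_of_ae (coeFn_tensor (φ k) f) (coeFn_compMP_of_ae _ h1)]
    refine integral_congr_ae (Filter.Eventually.of_forall fun p => ?_)
    simp only [Function.comp, slotSwap, Function.update_self, Function.update_of_ne hij, map_mul,
      Complex.conj_ofReal]
    ring
  have hFa := fun k => slotSwapOp_antisymm hf
    (u := fun p => ((v (p.2 i - p.1) : ℝ) : ℂ) * φ k p.1)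
    (fun l hl z x y => by
      have : i ≠ l := fun hil => hi (hil ▸ hl)
      simp only [Function.update_of_ne this]) (hF k)
  have hGa := fun k => slotSwapOp_antisymm hg (u := fun p => φ k p.1)
    (fun l hl z x y => rfl) (coeFn_tensor (φ k) g)
  have e3 : inner ℂ f (Vg - ∑ j ∈ J, orbProj φ j (w j)) =
      ∑ k, inner ℂ (F k) (antisymmetrizer J slotSwapOp (tensor (φ k) g)) := by
    simp only [antisymmetrizer_apply, inner_sub_right, inner_sum, Finset.sum_sub_distrib]
    rw [e1, Finset.sum_comm, Finset.sum_congr rfl e2]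
  -- The exchange terms of `F_k` are nonnegative, as its prefactor does not involve `x_j`, and they
  -- enter with a minus sign; dropping them leaves `‖F_k‖²`.
  have hF1 : ∀ k, (inner ℂ (F k) (antisymmetrizer J slotSwapOp (F k))).re ≤ ‖F k‖ ^ 2 := by
    intro k
    rw [antisymmetrizer_apply, inner_sub_right, inner_sum, Complex.sub_re, Complex.re_sum]
    have h1 : (inner ℂ (F k) (F k)).re = ‖F k‖ ^ 2 := by
      rw [inner_self_eq_norm_sq_to_K]
      norm_cast
    have h2 : 0 ≤ ∑ j ∈ J, (inner ℂ (F k) (slotSwapOp j (F k))).re := by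
      refine Finset.sum_nonneg fun j hj => ?_
      have hij : i ≠ j := fun hij => hi (hij ▸ hj)
      exact inner_slotSwapOp_nonneg j (u := fun p => ((v (p.2 i - p.1) : ℝ) : ℂ) * φ k p.1)
        (fun z x y => by simp only [Function.update_of_ne hij]) (hF k)
    rw [h1]
    linarith
  -- The Pauli principle: the `N` orbitals contribute `N ‖g‖²`, which the exchange terms almost
  -- cancel when `g` nearly lies in the ranges of the `p_j`.
  have hG1 : ∑ k, (inner ℂ (tensor (φ k) g)
      (antisymmetrizer J slotSwapOp (tensor (φ k) g))).re =
      N * ‖g‖ ^ 2 - ∑ j ∈ J, (inner ℂ g (orbProj φ j g)).re := by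
    simp only [antisymmetrizer_apply, inner_sub_right, inner_sum, Complex.sub_re, Complex.re_sum,
      Finset.sum_sub_distrib]
    congr 1
    · have : ∀ k, (inner ℂ (tensor (φ k) g) (tensor (φ k) g)).re = ‖g‖ ^ 2 := by
        intro k
        rw [inner_self_eq_norm_sq_to_K, norm_tensor, h.orthonormal.1 k, one_mul]
        norm_cast
      rw [Finset.sum_congr rfl fun k _ => this k]
      simp
    · rw [Finset.sum_comm]
      refine Finset.sum_congr rfl fun j _ => ?_
      rw [orbProj_apply, inner_sum, Complex.re_sum]
      refine Finset.sum_congr rfl fun k _ => ?_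
      rw [inner_rankOne]
      rfl
  rw [e3]
  refine (norm_sum_le _ _).trans ((Finset.sum_le_sum fun k _ =>
    norm_inner_antisymmetrizer_le inner_slotSwapOp slotSwapOp_slotSwapOp (hFa k) (hGa k)).trans ?_)
  refine (Real.sum_sqrt_mul_sqrt_le _
    (fun k => inner_self_antisymmetrizer_nonneg inner_slotSwapOp slotSwapOp_slotSwapOp (hFa k))
    (fun k => inner_self_antisymmetrizer_nonneg inner_slotSwapOp slotSwapOp_slotSwapOp
      (hGa k))).trans ?_
  rw [hG1]
  gcongr
  exact (Finset.sum_le_sum fun k _ => hF1 k).trans hFn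

end InterProj

end

/-! ### The interaction minus its mean field at a fixed time -/

noncomputable section

section Estimate

variable {N : ℕ} {v : Pos → ℝ} {φ : Fin N → OneBody} {κ : ℝ}

/-- The operator `∑_{j ≠ i} v(x_i - x_j) p_i`. -/
def sumInterProj (h : InteractionBound v φ κ) (i : Fin N) : ManyBody N →L[ℂ] ManyBody N :=
  ∑ j ∈ (Finset.univ.erase i).attach, interProj h (Finset.ne_of_mem_erase j.2).symm

/-- The norm of `∑_{j ≠ i} q_j v(x_i - x_j) p_i ψ` for antisymmetric `ψ`. -/
lemma norm_sum_orbCoproj_interProj_sq_le (h : InteractionBound v φ κ) {ψ : ManyBody N}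
    (hψ : AntisymmetricOn Finset.univ ψ) (i : Fin N) :
    ‖∑ j ∈ (Finset.univ.erase i).attach,
        orbCoproj φ j (interProj h (Finset.ne_of_mem_erase j.2).symm ψ)‖ ^ 2 ≤
      κ * ‖ψ‖ ^ 2 + N * κ * ‖orbCoproj φ i ψ‖ ^ 2 := by
  have hN : 0 < N := i.pos
  set α := ‖orbCoproj φ i ψ‖ ^ 2 with hα
  have hκ := h.nonneg
  set R : {j // j ∈ Finset.univ.erase i} → ManyBody N := fun j =>
    orbCoproj φ j (interProj h (Finset.ne_of_mem_erase j.2).symm ψ) with hR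
  have hcard : (Finset.univ.erase i).attach.card = N - 1 := by simp
  -- Antisymmetry in all particles except `j` gains `1 / (N - 1)`, so that the `N - 1` diagonal
  -- terms together cost only `κ ‖ψ‖²`.
  have hdiag : ∀ j, ((N : ℝ) - 1) * ‖R j‖ ^ 2 ≤ κ * ‖ψ‖ ^ 2 := by
    intro j
    have hij : i ≠ j := (Finset.ne_of_mem_erase j.2).symm
    have h1 := card_mul_norm_interProj_le h hij ψ (J := Finset.univ.erase j.1)
      (by simpa using hij) (by simp) (hψ.mono (Finset.subset_univ _))
    have h2 : ((Finset.univ.erase j.1).card : ℝ) = (N : ℝ) - 1 := by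
      rw [Finset.card_erase_of_mem (Finset.mem_univ _), Finset.card_univ, Fintype.card_fin,
        Nat.cast_sub hN]
      simp
    rw [h2] at h1
    have h3 : ‖R j‖ ^ 2 ≤ ‖interProj h hij ψ‖ ^ 2 :=
      pow_le_pow_left₀ (norm_nonneg _) (norm_orbCoproj_le h.orthonormal _ _) 2
    have h4 : (0 : ℝ) ≤ (N : ℝ) - 1 := by
      have : (1 : ℝ) ≤ N := by exact_mod_cast hN
      linarith
    nlinarith
  -- Each of `q_j` and `q_k` commutes past the interaction that does not involve its particle and
  -- reaches `ψ` on the opposite side of the scalar product. Antisymmetry in all particles but `j`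
  -- and `k` then bounds each squared norm by `κ α / (N - 2)`, and the `N - 2` off-diagonal terms of
  -- a row sum to at most `κ α`.
  have hoff : ∀ j k, j ≠ k → ((N : ℝ) - 2) * (inner ℂ (R j) (R k)).re ≤ κ * α := by
    intro j k hjk
    have hjk' : j.1 ≠ k.1 := fun e => hjk (Subtype.ext e)
    have hij : i ≠ j := (Finset.ne_of_mem_erase j.2).symm
    have hik : i ≠ k := (Finset.ne_of_mem_erase k.2).symm
    have e : inner ℂ (R j) (R k) = inner ℂ (interProj h hij (orbCoproj φ k ψ))
        (interProj h hik (orbCoproj φ j ψ)) := by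
      simp only [hR]
      rw [← inner_orbCoproj_left, orbCoproj_comm φ hjk'.symm, inner_orbCoproj_left,
        interProj_orbCoproj_comm h hij hik.symm hjk'.symm,
        interProj_orbCoproj_comm h hik hij.symm hjk']
    have hN2 : (0 : ℝ) ≤ (N : ℝ) - 2 := by
      have : 2 ≤ N := by
        have := Finset.one_lt_card.2 ⟨i, Finset.mem_univ _, j.1, Finset.mem_univ _, hij⟩
        simp only [Finset.card_univ, Fintype.card_fin] at this
        omega
      have : (2 : ℝ) ≤ N := by exact_mod_cast this
      linarith
    have key : ∀ {a b : Fin N} (hia : i ≠ a) (hib : i ≠ b) (hab : a ≠ b),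
        ((N : ℝ) - 2) * ‖interProj h hia (orbCoproj φ b ψ)‖ ^ 2 ≤ κ * α := by
      intro a b hia hib hab
      have h1 := card_mul_norm_interProj_le h hia (orbCoproj φ b ψ)
        (J := (Finset.univ.erase a).erase b) (by simp [hia, hib]) (by simp)
        ((hψ.mono (Finset.subset_univ _)).orbCoproj φ (by simp))
      have h2 : (((Finset.univ.erase a).erase b).card : ℝ) = (N : ℝ) - 2 := by
        have hc : ((Finset.univ.erase a).erase b).card + 2 = N := by
          rw [Finset.card_erase_of_mem (by simp [hab.symm]),
            Finset.card_erase_of_mem (Finset.mem_univ _), Finset.card_univ, Fintype.card_fin]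
          have := Finset.one_lt_card.2 ⟨a, Finset.mem_univ _, b, Finset.mem_univ _, hab⟩
          simp at this
          omega
        rw [eq_sub_iff_add_eq]
        exact_mod_cast hc
      rw [h2, norm_orbCoproj_eq hψ φ b i] at h1
      exact h1
    have h1 := key hij hik hjk'
    have h2 := key hik hij hjk'.symm
    have h3 : (inner ℂ (R j) (R k)).re ≤ ‖interProj h hij (orbCoproj φ k ψ)‖ *
        ‖interProj h hik (orbCoproj φ j ψ)‖ := by
      rw [e]
      exact (Complex.re_le_norm _).trans (norm_inner_le_norm _ _)
    nlinarith [mul_le_mul_of_nonneg_left (two_mul_le_add_sq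
      ‖interProj h hij (orbCoproj φ k ψ)‖ ‖interProj h hik (orbCoproj φ j ψ)‖) hN2,
      mul_le_mul_of_nonneg_left h3 hN2]
  have hexp : ‖∑ j ∈ (Finset.univ.erase i).attach, R j‖ ^ 2 =
      ∑ j ∈ (Finset.univ.erase i).attach, ∑ k ∈ (Finset.univ.erase i).attach,
        (inner ℂ (R j) (R k)).re := by
    have : inner ℂ (∑ j ∈ (Finset.univ.erase i).attach, R j)
        (∑ j ∈ (Finset.univ.erase i).attach, R j) = ∑ j ∈ (Finset.univ.erase i).attach,
          ∑ k ∈ (Finset.univ.erase i).attach, inner ℂ (R j) (R k) := by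
      rw [sum_inner]
      exact Finset.sum_congr rfl fun j _ => inner_sum _ _ _
    rw [inner_self_eq_norm_sq_to_K] at this
    have h2 := congrArg Complex.re this
    simp only [Complex.re_sum] at h2
    rw [← h2]
    norm_cast
  rw [hexp]
  have hrow : ∀ j ∈ (Finset.univ.erase i).attach, ∑ k ∈ (Finset.univ.erase i).attach,
      (inner ℂ (R j) (R k)).re ≤ ‖R j‖ ^ 2 + κ * α := by
    intro j hj
    rw [← Finset.add_sum_erase _ _ hj]
    have h1 : (inner ℂ (R j) (R j)).re = ‖R j‖ ^ 2 := by
      rw [inner_self_eq_norm_sq_to_K]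
      norm_cast
    rw [h1]
    gcongr
    have hc : ((Finset.univ.erase i).attach.erase j).card = N - 2 := by
      rw [Finset.card_erase_of_mem hj, hcard]
      omega
    -- For `N ≤ 2` there are no off-diagonal terms, and the division by `N - 2` must be avoided.
    obtain hN2 | hN2 := Nat.lt_or_ge 2 N
    · have hN2' : (0 : ℝ) < (N : ℝ) - 2 := by
        have : (2 : ℝ) < N := by exact_mod_cast hN2
        linarith
      have : ∀ k ∈ (Finset.univ.erase i).attach.erase j,
          (inner ℂ (R j) (R k)).re ≤ κ * α / ((N : ℝ) - 2) := by
        intro k hk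
        rw [le_div_iff₀ hN2', mul_comm]
        exact hoff j k (Finset.ne_of_mem_erase hk).symm
      refine (Finset.sum_le_sum this).trans (le_of_eq ?_)
      rw [Finset.sum_const, hc, nsmul_eq_mul, Nat.cast_sub hN2.le]
      push_cast
      field_simp
    · have : (Finset.univ.erase i).attach.erase j = ∅ := by
        rw [← Finset.card_eq_zero, hc]
        omega
      rw [this, Finset.sum_empty]
      positivity
  refine (Finset.sum_le_sum hrow).trans ?_
  rw [Finset.sum_add_distrib, Finset.sum_const, hcard, nsmul_eq_mul]
  gcongr ?_ + ?_
  · obtain hN1 | hN1 := Nat.lt_or_ge 1 N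
    · have hN1' : (0 : ℝ) < (N : ℝ) - 1 := by
        have : (1 : ℝ) < N := by exact_mod_cast hN1
        linarith
      have : ∀ j ∈ (Finset.univ.erase i).attach, ‖R j‖ ^ 2 ≤ κ * ‖ψ‖ ^ 2 / ((N : ℝ) - 1) := by
        intro j _
        rw [le_div_iff₀ hN1', mul_comm]
        exact hdiag j
      refine (Finset.sum_le_sum this).trans (le_of_eq ?_)
      rw [Finset.sum_const, hcard, nsmul_eq_mul, Nat.cast_sub hN1.le]
      push_cast
      field_simp
    · have : (Finset.univ.erase i).attach = ∅ := by
        rw [← Finset.card_eq_zero, hcard]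
        omega
      rw [this, Finset.sum_empty]
      positivity
  · have : ((N - 1 : ℕ) : ℝ) ≤ N := by exact_mod_cast Nat.sub_le _ _
    nlinarith [mul_nonneg hκ (sq_nonneg ‖orbCoproj φ i ψ‖)]

/-- The main estimate: the interaction minus the mean field, between `q_i ψ` and `p_i ψ`. -/
lemma norm_inner_interaction_sub_meanField_le (h : InteractionBound v φ κ) {ψ Vψ : ManyBody N}
    (hψ : AntisymmetricOn Finset.univ ψ) (i : Fin N)
    (hV : Vψ =ᵐ[volume] fun x => ((meanField v φ (x i) : ℝ) : ℂ) * orbProj φ i ψ x) :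
    ‖inner ℂ (orbCoproj φ i ψ) (sumInterProj h i ψ - Vψ)‖ ≤
      2 * √(N * κ) * (‖orbCoproj φ i ψ‖ ^ 2 + ‖ψ‖ ^ 2 / N) := by
  have hN : 0 < N := i.pos
  have hNr : (0 : ℝ) < N := by exact_mod_cast hN
  have hκ := h.nonneg
  set α := ‖orbCoproj φ i ψ‖ ^ 2 with hα
  set b := α + ‖ψ‖ ^ 2 / N with hb
  have hα0 : 0 ≤ α := by positivity
  have hb0 : 0 ≤ b := by positivity
  have hαb : α ≤ b := by
    have : 0 ≤ ‖ψ‖ ^ 2 / N := by positivity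
    linarith
  have hJ : AntisymmetricOn (Finset.univ.erase i) ψ := hψ.mono (Finset.subset_univ _)
  -- the term with the mean field
  have hA : ‖inner ℂ (orbCoproj φ i ψ) (Vψ - ∑ j ∈ (Finset.univ.erase i).attach,
      orbProj φ j (interProj h (Finset.ne_of_mem_erase j.2).symm ψ))‖ ≤ √(N * κ) * b := by
    have h1 := norm_inner_meanField_sub_le h (J := Finset.univ.erase i) (i := i)
      (Finset.notMem_erase i _) (hJ.orbCoproj φ (Finset.notMem_erase i _))
      (hJ.orbProj φ (Finset.notMem_erase i _)) hV
      -- The family is indexed by all particles; its value at `j = i` never enters.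
      (w := fun j => if hij : i ≠ j then interProj h hij ψ else 0) (by
        intro j hj
        have hij : i ≠ j := (Finset.ne_of_mem_erase hj).symm
        simp only [dif_pos hij]
        exact interProj_coeFn h hij ψ)
    rw [← Finset.sum_attach] at h1
    have e : ∀ j ∈ (Finset.univ.erase i).attach,
        orbProj φ j.1 (if hij : i ≠ j.1 then interProj h hij ψ else 0) =
          orbProj φ j (interProj h (Finset.ne_of_mem_erase j.2).symm ψ) := by
      intro j _
      rw [dif_pos (Finset.ne_of_mem_erase j.2).symm]
    rw [Finset.sum_congr rfl e] at h1
    refine h1.trans ?_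
    -- For each `j ≠ i`, `‖p_i ψ‖² - ⟨p_i ψ, p_j p_i ψ⟩ = ‖p_i q_j ψ‖² ≤ α`. The `N - 1` exchange
    -- terms therefore cancel `N ‖p_i ψ‖²` up to one copy of `‖p_i ψ‖²` and at most `N α`.
    have h2 : N * ‖orbProj φ i ψ‖ ^ 2 - ∑ j ∈ Finset.univ.erase i,
        (inner ℂ (orbProj φ i ψ) (orbProj φ j (orbProj φ i ψ))).re ≤ N * b := by
      have h3 : ∀ j ∈ Finset.univ.erase i, ‖orbProj φ i ψ‖ ^ 2 - α ≤
          (inner ℂ (orbProj φ i ψ) (orbProj φ j (orbProj φ i ψ))).re := by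
        intro j hj
        have hij : i ≠ j := (Finset.ne_of_mem_erase hj).symm
        have h4 : orbProj φ j (orbProj φ i ψ) =
            orbProj φ i ψ - orbCoproj φ j (orbProj φ i ψ) := by
          rw [orbCoproj_apply]; abel
        rw [h4, inner_sub_right, inner_orbCoproj_self h.orthonormal, Complex.sub_re,
          Complex.ofReal_re, ← orbProj_orbCoproj_comm φ hij]
        have h5 : (inner ℂ (orbProj φ i ψ) (orbProj φ i ψ)).re = ‖orbProj φ i ψ‖ ^ 2 := by
          rw [inner_self_eq_norm_sq_to_K]
          norm_cast
        rw [h5]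
        have h6 : ‖orbProj φ i (orbCoproj φ j ψ)‖ ^ 2 ≤ α := by
          rw [hα, norm_orbCoproj_eq hψ φ i j]
          exact pow_le_pow_left₀ (norm_nonneg _) (norm_orbProj_le h.orthonormal _ _) 2
        linarith
      have h7 := Finset.sum_le_sum h3
      rw [Finset.sum_const, Finset.card_erase_of_mem (Finset.mem_univ _), Finset.card_univ,
        Fintype.card_fin, nsmul_eq_mul, Nat.cast_sub hN] at h7
      have h8 : N * b = N * α + ‖ψ‖ ^ 2 := by
        rw [hb]
        field_simp
      have h9 : ‖orbProj φ i ψ‖ ^ 2 ≤ ‖ψ‖ ^ 2 :=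
        pow_le_pow_left₀ (norm_nonneg _) (norm_orbProj_le h.orthonormal _ _) 2
      push_cast at h7
      nlinarith
    refine (mul_le_mul_of_nonneg_left (Real.sqrt_le_sqrt h2) (Real.sqrt_nonneg _)).trans ?_
    rw [← Real.sqrt_mul (by positivity)]
    refine Real.sqrt_le_iff.2 ⟨by positivity, ?_⟩
    rw [mul_pow, Real.sq_sqrt (by positivity)]
    have : κ * α * (N * b) = N * κ * (α * b) := by ring
    rw [this]
    have h10 : α * b ≤ b ^ 2 := by nlinarith
    exact mul_le_mul_of_nonneg_left h10 (by positivity)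
  -- the remaining term
  have hB : ‖inner ℂ (orbCoproj φ i ψ) (∑ j ∈ (Finset.univ.erase i).attach,
      orbCoproj φ j (interProj h (Finset.ne_of_mem_erase j.2).symm ψ))‖ ≤ √(N * κ) * b := by
    refine (norm_inner_le_norm _ _).trans ?_
    have h1 := norm_sum_orbCoproj_interProj_sq_le h hψ i
    have h2 : κ * ‖ψ‖ ^ 2 + N * κ * ‖orbCoproj φ i ψ‖ ^ 2 = N * κ * b := by
      rw [hb, hα]
      field_simp
      ring
    rw [h2] at h1
    refine (pow_le_pow_iff_left₀ (by positivity) (by positivity) two_ne_zero).1 ?_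
    rw [mul_pow, mul_pow, Real.sq_sqrt (by positivity)]
    calc _ ≤ α * (N * κ * b) := mul_le_mul_of_nonneg_left h1 hα0
      _ ≤ b * (N * κ * b) := mul_le_mul_of_nonneg_right hαb (by positivity)
      _ = _ := by ring
  -- Insertion of `1 = p_j + q_j` to the left of each pair interaction.
  have hdec : sumInterProj h i ψ - Vψ =
      (∑ j ∈ (Finset.univ.erase i).attach,
        orbCoproj φ j (interProj h (Finset.ne_of_mem_erase j.2).symm ψ)) -
      (Vψ - ∑ j ∈ (Finset.univ.erase i).attach,
        orbProj φ j (interProj h (Finset.ne_of_mem_erase j.2).symm ψ)) := by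
    have : sumInterProj h i ψ = ∑ j ∈ (Finset.univ.erase i).attach,
        (orbProj φ j (interProj h (Finset.ne_of_mem_erase j.2).symm ψ) +
          orbCoproj φ j (interProj h (Finset.ne_of_mem_erase j.2).symm ψ)) := by
      simp only [orbProj_add_orbCoproj, sumInterProj, _root_.sum_apply]
    rw [this, Finset.sum_add_distrib]
    abel
  rw [hdec, inner_sub_right]
  refine (norm_sub_le _ _).trans ?_
  linarith

end Estimate

end

noncomputable section

/-! ### The Coulomb singularity -/

/-- The surface area of the unit sphere, as three times the volume of the unit ball. -/
def sphereArea : ℝ := 3 * (volume : Measure Pos).real (Metric.ball 0 1)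

lemma sphereArea_nonneg : 0 ≤ sphereArea := by
  unfold sphereArea
  positivity

/-- In polar coordinates the Jacobian `r²` cancels the singularity and the length of `(0, R)`
remains. -/
lemma lintegral_inv_norm_sq_ball {R : ℝ} (hR : 0 < R) (y : Pos) :
    ∫⁻ x : Pos, ENNReal.ofReal ((Set.Iio R).indicator (fun r : ℝ => r⁻¹ ^ 2) ‖y - x‖) =
      ENNReal.ofReal (sphereArea * R) := by
  rw [lintegral_sub_left_eq_self
    (fun x : Pos => ENNReal.ofReal ((Set.Iio R).indicator (fun r : ℝ => r⁻¹ ^ 2) ‖x‖))]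
  have hdim : Module.finrank ℝ Pos = 3 := by simp
  have hfun : Set.EqOn (fun r : ℝ => r ^ (Module.finrank ℝ Pos - 1) •
      (Set.Iio R).indicator (fun r : ℝ => r⁻¹ ^ 2) r) ((Set.Iio R).indicator fun _ => 1)
      (Set.Ioi 0) := by
    intro r hr
    have hr0 : r ≠ 0 := (Set.mem_Ioi.1 hr).ne'
    simp only [hdim, Set.indicator_apply, smul_eq_mul]
    split_ifs
    · field_simp
    · simp
  have hset : Set.Ioi (0 : ℝ) ∩ Set.Iio R = Set.Ioo 0 R := rfl
  have hint : Integrable (fun x : Pos => (Set.Iio R).indicator (fun r : ℝ => r⁻¹ ^ 2) ‖x‖)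
      volume := by
    rw [integrable_fun_norm_addHaar (volume : Measure Pos)
      (f := (Set.Iio R).indicator fun r : ℝ => r⁻¹ ^ 2),
      integrableOn_congr_fun hfun measurableSet_Ioi, integrableOn_indicator_iff measurableSet_Iio,
      Set.inter_comm, hset]
    simp
  rw [← ofReal_integral_eq_lintegral_ofReal hint (Filter.Eventually.of_forall fun x =>
    Set.indicator_nonneg (fun r _ => by positivity) _),
    integral_fun_norm_addHaar (volume : Measure Pos) ((Set.Iio R).indicator fun r : ℝ => r⁻¹ ^ 2),
    setIntegral_congr_fun measurableSet_Ioi hfun, setIntegral_indicator measurableSet_Iio, hset]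
  congr 1
  simp only [hdim, sphereArea, integral_const, measureReal_restrict_apply_univ, Real.volume_real_Ioo,
    sub_zero, smul_eq_mul, mul_one, nsmul_eq_mul, Nat.cast_ofNat, max_eq_left hR.le]
  ring

/-- The convolution of `|x|⁻²` with a bounded integrable function. -/
lemma lintegral_inv_norm_sq_mul_le {ρ : Pos → ℝ} {D M R : ℝ} (hρ0 : ∀ x, 0 ≤ ρ x) (hD0 : 0 ≤ D)
    (hρD : ∀ᵐ x, ρ x ≤ D) (hρ : Integrable ρ volume) (hM : ∫ x, ρ x ≤ M) (hR : 0 < R) (y : Pos) :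
    ∫⁻ x, ENNReal.ofReal (‖y - x‖⁻¹ ^ 2 * ρ x) ≤
      ENNReal.ofReal (sphereArea * D * R + M / R ^ 2) := by
  have hM0 : 0 ≤ M := (integral_nonneg hρ0).trans hM
  -- Inside the ball of radius `R` the density is replaced by `D`, outside it `|y - x|⁻²` is
  -- replaced by `R⁻²`.
  have h1 : ∀ᵐ x, ENNReal.ofReal (‖y - x‖⁻¹ ^ 2 * ρ x) ≤
      ENNReal.ofReal D *
        ENNReal.ofReal ((Set.Iio R).indicator (fun r : ℝ => r⁻¹ ^ 2) ‖y - x‖) +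
      ENNReal.ofReal (R⁻¹ ^ 2) * ENNReal.ofReal (ρ x) := by
    filter_upwards [hρD] with x hx
    rw [← ENNReal.ofReal_mul hD0, ← ENNReal.ofReal_mul (by positivity),
      ← ENNReal.ofReal_add (mul_nonneg hD0 (Set.indicator_nonneg (fun r _ => by positivity) _))
        (mul_nonneg (by positivity) (hρ0 x))]
    refine ENNReal.ofReal_le_ofReal ?_
    simp only [Set.indicator_apply, Set.mem_Iio]
    split_ifs with hlt
    · have : 0 ≤ R⁻¹ ^ 2 * ρ x := mul_nonneg (by positivity) (hρ0 x)
      have h2 : ‖y - x‖⁻¹ ^ 2 * ρ x ≤ D * ‖y - x‖⁻¹ ^ 2 := by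
        rw [mul_comm]
        gcongr
      linarith
    · rw [mul_zero, zero_add]
      have h2 := hρ0 x
      push Not at hlt
      gcongr
  refine (lintegral_mono_ae h1).trans ?_
  have hm : AEMeasurable (fun x => ENNReal.ofReal (R⁻¹ ^ 2) * ENNReal.ofReal (ρ x)) volume :=
    hρ.1.aemeasurable.ennreal_ofReal.const_mul _
  rw [lintegral_add_right' _ hm, lintegral_const_mul' _ _ ENNReal.ofReal_ne_top,
    lintegral_const_mul' _ _ ENNReal.ofReal_ne_top, lintegral_inv_norm_sq_ball hR,
    ← ofReal_integral_eq_lintegral_ofReal hρ (Filter.Eventually.of_forall hρ0),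
    ← ENNReal.ofReal_mul hD0, ← ENNReal.ofReal_mul (by positivity),
    ← ENNReal.ofReal_add (mul_nonneg hD0 (mul_nonneg sphereArea_nonneg hR.le))
      (mul_nonneg (by positivity) (integral_nonneg hρ0))]
  refine ENNReal.ofReal_le_ofReal ?_
  have : R⁻¹ ^ 2 * ∫ x, ρ x ≤ R⁻¹ ^ 2 * M := by gcongr
  have e : M / R ^ 2 = R⁻¹ ^ 2 * M := by rw [inv_pow]; ring
  rw [e]
  linarith

/-! ### Calculus with test functions -/

section TestFunction

variable {E : Type*} [NormedAddCommGroup E] [NormedSpace ℝ E]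

/-- The derivative in the direction `v`. -/
def dirDeriv (v : E) (f : E → ℂ) (x : E) : ℂ := fderiv ℝ f x v

namespace IsTestFunction

variable {f g : E → ℂ}

lemma contDiff (hf : IsTestFunction f) {n : ℕ∞} : ContDiff ℝ n f :=
  hf.1.of_le (by exact_mod_cast le_top)

lemma continuous (hf : IsTestFunction f) : Continuous f := hf.1.continuous

lemma differentiable (hf : IsTestFunction f) : Differentiable ℝ f :=
  hf.1.differentiable (by simp)

lemma dirDeriv (hf : IsTestFunction f) (v : E) : IsTestFunction (dirDeriv v f) :=
  ⟨(hf.1.fderiv_right (m := ((⊤ : ℕ∞) : WithTop ℕ∞)) (by simp)).clm_apply contDiff_const,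
    hf.2.fderiv_apply (𝕜 := ℝ) v⟩

lemma star_comp (hf : IsTestFunction f) : IsTestFunction (fun x => conj (f x)) :=
  ⟨Complex.conjCLE.contDiff.comp hf.1, hf.2.comp_left (g := fun z => (starRingEnd ℂ) z) (map_zero _)⟩

lemma mul_left (hf : IsTestFunction f) (hg : ContDiff ℝ ((⊤ : ℕ∞) : WithTop ℕ∞) g) :
    IsTestFunction (fun x => g x * f x) :=
  ⟨hg.mul hf.1, hf.2.mul_left⟩

lemma add (hf : IsTestFunction f) (hg : IsTestFunction g) : IsTestFunction (fun x => f x + g x) :=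
  ⟨hf.1.add hg.1, hf.2.add hg.2⟩

lemma sum {ι : Type*} (s : Finset ι) {f : ι → E → ℂ} (hf : ∀ i ∈ s, IsTestFunction (f i)) :
    IsTestFunction (fun x => ∑ i ∈ s, f i x) := by
  classical
  induction s using Finset.induction_on with
  | empty =>
    simp only [Finset.sum_empty]
    exact ⟨contDiff_const, HasCompactSupport.zero⟩
  | insert a s ha ih =>
    simp only [Finset.sum_insert ha]
    exact (hf a (Finset.mem_insert_self a s)).add
      (ih fun i hi => hf i (Finset.mem_insert_of_mem hi))

lemma exists_bound (hf : IsTestFunction f) : ∃ C, ∀ x, ‖f x‖ ≤ C :=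
  hf.2.exists_bound_of_continuous hf.continuous

variable [MeasurableSpace E] [BorelSpace E] {μ : Measure E} [IsFiniteMeasureOnCompacts μ]

lemma integrable (hf : IsTestFunction f) : Integrable f μ :=
  hf.continuous.integrable_of_hasCompactSupport hf.2

lemma memLp (hf : IsTestFunction f) (p : ℝ≥0∞) : MemLp f p μ :=
  hf.continuous.memLp_of_hasCompactSupport hf.2

lemma integral_mul_dirDeriv [FiniteDimensional ℝ E] {μ : Measure E} [μ.IsAddHaarMeasure]
    (hf : IsTestFunction f) (hg : IsTestFunction g) (v : E) :
    ∫ x, f x * _root_.dirDeriv v g x ∂μ = -∫ x, _root_.dirDeriv v f x * g x ∂μ :=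
  integral_mul_fderiv_eq_neg_fderiv_mul_of_integrable
    (hg.mul_left (hf.dirDeriv v).1).integrable ((hg.dirDeriv v).mul_left hf.1).integrable
    (hg.mul_left hf.1).integrable (fun x _ => hf.differentiable x) (fun x _ => hg.differentiable x)

lemma integral_mul_dirDeriv_dirDeriv [FiniteDimensional ℝ E] {μ : Measure E} [μ.IsAddHaarMeasure]
    (hf : IsTestFunction f) (hg : IsTestFunction g) (v : E) :
    ∫ x, f x * _root_.dirDeriv v (_root_.dirDeriv v g) x ∂μ =
      ∫ x, _root_.dirDeriv v (_root_.dirDeriv v f) x * g x ∂μ := by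
  rw [hf.integral_mul_dirDeriv (hg.dirDeriv v), (hf.dirDeriv v).integral_mul_dirDeriv hg, neg_neg]

end IsTestFunction

lemma dirDeriv_dirDeriv {f : E → ℂ} (hf : ContDiff ℝ 2 f) (v w : E) (x : E) :
    dirDeriv w (dirDeriv v f) x = fderiv ℝ (fderiv ℝ f) x w v := by
  have h : DifferentiableAt ℝ (fderiv ℝ f) x :=
    (hf.fderiv_right (m := 1) (by norm_num)).differentiable (by simp) x
  unfold dirDeriv
  rw [fderiv_clm_apply h (differentiableAt_const v)]
  simp

lemma dirDeriv_conj {f : E → ℂ} (hf : Differentiable ℝ f) (v : E) :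
    dirDeriv v (fun x => conj (f x)) = fun x => conj (dirDeriv v f x) := by
  funext x
  have h := (Complex.conjCLE : ℂ ≃L[ℝ] ℂ).toContinuousLinearMap.hasFDerivAt.comp x
    (hf x).hasFDerivAt
  have h2 : HasFDerivAt (fun x => conj (f x))
      ((Complex.conjCLE : ℂ ≃L[ℝ] ℂ).toContinuousLinearMap.comp (fderiv ℝ f x)) x := h
  unfold dirDeriv
  rw [h2.fderiv]
  simp

end TestFunction

section Laplacians

/-- The `k`-th standard basis vector of `ℝ³`. -/
def stdVec (k : Fin 3) : Pos := EuclideanSpace.single k 1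

lemma laplacian_eq_sum_dirDeriv {f : Pos → ℂ} (hf : ContDiff ℝ 2 f) (x : Pos) :
    Laplacian.laplacian f x = ∑ k, dirDeriv (stdVec k) (dirDeriv (stdVec k) f) x := by
  rw [InnerProductSpace.laplacian_eq_iteratedFDeriv_orthonormalBasis f
    (EuclideanSpace.basisFun (Fin 3) ℝ)]
  refine Finset.sum_congr rfl fun k _ => ?_
  rw [dirDeriv_dirDeriv hf, iteratedFDeriv_two_apply]
  simp [stdVec]

variable {N : ℕ}

lemma dirDeriv_comp_update {f : Config N → ℂ} (hf : Differentiable ℝ f) (j : Fin N) (x : Config N)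
    (v y : Pos) : dirDeriv v (fun y => f (Function.update x j y)) y =
      dirDeriv (Pi.single j v) f (Function.update x j y) := by
  have h := (hf (Function.update x j y)).hasFDerivAt.comp y (hasFDerivAt_update x y)
  have h2 : HasFDerivAt (fun y => f (Function.update x j y)) _ y := h
  unfold dirDeriv
  rw [h2.fderiv]
  simp only [ContinuousLinearMap.comp_apply]
  congr 1
  funext i
  by_cases hi : i = j
  · subst hi; simp
  · simp [hi]

lemma particleLaplacian_eq_sum_dirDeriv {f : Config N → ℂ} (hf : IsTestFunction f) (j : Fin N)
    (x : Config N) : particleLaplacian j f x =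
      ∑ k, dirDeriv (Pi.single j (stdVec k)) (dirDeriv (Pi.single j (stdVec k)) f) x := by
  unfold particleLaplacian
  have hc : ContDiff ℝ 2 (fun y => f (Function.update x j y)) :=
    (hf.contDiff (n := 2)).comp (contDiff_update 2 x j)
  rw [laplacian_eq_sum_dirDeriv hc]
  refine Finset.sum_congr rfl fun k _ => ?_
  have h1 : dirDeriv (stdVec k) (fun y => f (Function.update x j y)) =
      fun y => dirDeriv (Pi.single j (stdVec k)) f (Function.update x j y) :=
    funext fun y => dirDeriv_comp_update hf.differentiable j x _ y
  rw [h1, dirDeriv_comp_update (hf.dirDeriv _).differentiable, Function.update_eq_self]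

lemma IsTestFunction.particleLaplacian {f : Config N → ℂ} (hf : IsTestFunction f) (j : Fin N) :
    IsTestFunction (particleLaplacian j f) := by
  have : _root_.particleLaplacian j f = fun x =>
      ∑ k, _root_.dirDeriv (Pi.single j (stdVec k)) (_root_.dirDeriv (Pi.single j (stdVec k)) f) x :=
    funext fun x => particleLaplacian_eq_sum_dirDeriv hf j x
  rw [this]
  exact IsTestFunction.sum _ fun k _ => (hf.dirDeriv _).dirDeriv _

/-- Green's identity for the Laplacian in one particle coordinate. -/
lemma integral_conj_mul_particleLaplacian {f g : Config N → ℂ} (hf : IsTestFunction f)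
    (hg : IsTestFunction g) (j : Fin N) :
    ∫ x, conj (f x) * particleLaplacian j g x = ∫ x, conj (particleLaplacian j f x) * g x := by
  simp only [particleLaplacian_eq_sum_dirDeriv hf, particleLaplacian_eq_sum_dirDeriv hg,
    Finset.mul_sum, map_sum, Finset.sum_mul]
  rw [integral_finsetSum _ fun k _ => (((hg.dirDeriv _).dirDeriv _).mul_left hf.star_comp.1).integrable,
    integral_finsetSum _ fun k _ => (hg.mul_left ((hf.dirDeriv _).dirDeriv _).star_comp.1).integrable]
  refine Finset.sum_congr rfl fun k _ => ?_
  rw [hf.star_comp.integral_mul_dirDeriv_dirDeriv hg, dirDeriv_conj hf.differentiable,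
    dirDeriv_conj (hf.dirDeriv _).differentiable]

end Laplacians

end

noncomputable section

/-! ### Local square integrability -/

section LocallySqInt

variable {X Y : Type*} [TopologicalSpace X] [MeasureSpace X] [TopologicalSpace Y] [MeasureSpace Y]

/-- Real functions that are square integrable on every compact set. -/
def LocallySqInt (W : X → ℝ) : Prop :=
  ∀ K : Set X, IsCompact K → MemLp W 2 (volume.restrict K)

lemma LocallySqInt.add {V W : X → ℝ} (hV : LocallySqInt V) (hW : LocallySqInt W) :
    LocallySqInt (fun x => V x + W x) := fun K hK => (hV K hK).add (hW K hK)

lemma LocallySqInt.sum {ι : Type*} (s : Finset ι) {W : ι → X → ℝ}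
    (hW : ∀ i ∈ s, LocallySqInt (W i)) : LocallySqInt (fun x => ∑ i ∈ s, W i x) := fun K hK =>
  memLp_finsetSum s fun i hi => hW i hi K hK

lemma LocallySqInt.comp_measurePreserving [OpensMeasurableSpace Y] [T2Space Y] {W : Y → ℝ}
    (hW : LocallySqInt W) {e : X → Y} (he : Continuous e) (hm : MeasurePreserving e volume volume) :
    LocallySqInt (fun x => W (e x)) := by
  intro K hK
  have hS : IsCompact (e '' K) := hK.image he
  have h := (hW _ hS).comp_measurePreserving (hm.restrict_preimage hS.measurableSet)
  exact h.mono_measure (Measure.restrict_mono (Set.subset_preimage_image e K) le_rfl)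

lemma locallySqInt_of_bounded [IsFiniteMeasureOnCompacts (volume : Measure X)] {W : X → ℝ}
    (hW : Measurable W) {M : ℝ} (hM : ∀ x, |W x| ≤ M) : LocallySqInt W := by
  intro K hK
  have : IsFiniteMeasure ((volume : Measure X).restrict K) := ⟨by simpa using hK.measure_lt_top⟩
  exact MemLp.of_bound hW.aestronglyMeasurable M (Filter.Eventually.of_forall hM)

lemma LocallySqInt.comp_fst [T2Space X] [T2Space Y] [OpensMeasurableSpace X]
    [OpensMeasurableSpace Y] [SFinite (volume : Measure X)] [SFinite (volume : Measure Y)]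
    [IsFiniteMeasureOnCompacts (volume : Measure Y)] {W : X → ℝ} (hW : LocallySqInt W) :
    LocallySqInt (fun p : X × Y => W p.1) := by
  intro K hK
  have h1 : IsCompact (Prod.fst '' K) := hK.image continuous_fst
  have h2 : IsCompact (Prod.snd '' K) := hK.image continuous_snd
  have : IsFiniteMeasure ((volume : Measure Y).restrict (Prod.snd '' K)) :=
    ⟨by simpa using h2.measure_lt_top⟩
  have h := (hW _ h1).comp_fst ((volume : Measure Y).restrict (Prod.snd '' K))
  rw [Measure.prod_restrict] at h
  refine h.mono_measure (Measure.restrict_mono (fun p hp => ?_) le_rfl)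
  exact ⟨⟨p, hp, rfl⟩, ⟨p, hp, rfl⟩⟩

end LocallySqInt

lemma LocallySqInt.memLp_mul {X : Type*} [NormedAddCommGroup X] [NormedSpace ℝ X] [MeasureSpace X]
    [OpensMeasurableSpace X] {W : X → ℝ} (hW : LocallySqInt W) {f : X → ℂ}
    (hf : IsTestFunction f) : MemLp (fun x => (W x : ℂ) * f x) 2 volume := by
  obtain ⟨C, hC⟩ := hf.exists_bound
  have hK : MeasurableSet (tsupport f) := (isClosed_tsupport f).measurableSet
  have h0 := hW _ hf.2
  have h1 : MemLp (fun x => (W x : ℂ) * f x) 2 (volume.restrict (tsupport f)) := by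
    refine h0.of_le_mul (c := C)
      ((Complex.continuous_ofReal.comp_aestronglyMeasurable h0.1).mul
        hf.continuous.aestronglyMeasurable) (Filter.Eventually.of_forall fun x => ?_)
    rw [norm_mul, Complex.norm_real, mul_comm]
    exact mul_le_mul_of_nonneg_right (hC x) (norm_nonneg _)
  rw [← memLp_indicator_iff_restrict hK] at h1
  convert h1 using 1
  funext x
  by_cases hx : x ∈ tsupport f
  · rw [Set.indicator_of_mem hx]
  · rw [Set.indicator_of_notMem hx, image_eq_zero_of_notMem_tsupport hx, mul_zero]

/-! ### The Coulomb interaction -/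

/-- The Coulomb interaction with coupling constant `c`. -/
def coulomb (c : ℝ) (x : Pos) : ℝ := c * ‖x‖⁻¹

lemma measurable_coulomb (c : ℝ) : Measurable (coulomb c) :=
  (measurable_norm.inv).const_mul c

lemma coulomb_neg (c : ℝ) (x : Pos) : coulomb c (-x) = coulomb c x := by
  simp [coulomb]

lemma lintegral_coulomb_sq_mul_le (c : ℝ) {ρ : Pos → ℝ} {D M R : ℝ} (hρ0 : ∀ x, 0 ≤ ρ x)
    (hD0 : 0 ≤ D) (hρD : ∀ᵐ x, ρ x ≤ D) (hρ : Integrable ρ volume) (hM : ∫ x, ρ x ≤ M)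
    (hR : 0 < R) (y : Pos) :
    ∫⁻ x, ENNReal.ofReal (coulomb c (y - x) ^ 2 * ρ x) ≤
      ENNReal.ofReal (c ^ 2 * (sphereArea * D * R + M / R ^ 2)) := by
  rw [ENNReal.ofReal_mul (sq_nonneg c)]
  refine le_trans ?_ (mul_le_mul_right (lintegral_inv_norm_sq_mul_le hρ0 hD0 hρD hρ hM hR y) _)
  rw [← lintegral_const_mul' _ _ ENNReal.ofReal_ne_top]
  refine lintegral_mono fun x => ?_
  rw [← ENNReal.ofReal_mul (sq_nonneg c)]
  refine ENNReal.ofReal_le_ofReal (le_of_eq ?_)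
  simp only [coulomb]
  ring

/-- For fixed `y` the squared singularity, integrated over the compact first projection of `K`, is a
convolution with an indicator function. The estimate with `D = R = 1` is uniform in `y`, and
integrating over the second projection concludes. -/
lemma locallySqInt_coulomb_sub_comp {Y : Type*} [TopologicalSpace Y] [T2Space Y] [MeasureSpace Y]
    [OpensMeasurableSpace Y] [SecondCountableTopology Y] [SFinite (volume : Measure Y)]
    [IsFiniteMeasureOnCompacts (volume : Measure Y)] (c : ℝ) {a : Y → Pos} (ha : Measurable a) :
    LocallySqInt (fun p : Pos × Y => coulomb c (p.1 - a p.2)) := by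
  intro K hK
  have h1 : IsCompact (Prod.fst '' K) := hK.image continuous_fst
  have h2 : IsCompact (Prod.snd '' K) := hK.image continuous_snd
  have hmeas : Measurable (fun p : Pos × Y => coulomb c (p.1 - a p.2)) :=
    (measurable_coulomb c).comp (measurable_fst.sub (ha.comp measurable_snd))
  have hle : volume.restrict K ≤ ((volume : Measure Pos).restrict (Prod.fst '' K)).prod
      ((volume : Measure Y).restrict (Prod.snd '' K)) := by
    rw [Measure.prod_restrict]
    refine Measure.restrict_mono (fun p hp => ?_) le_rfl
    exact ⟨⟨p, hp, rfl⟩, ⟨p, hp, rfl⟩⟩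
  refine MemLp.mono_measure hle ?_
  refine ⟨hmeas.aestronglyMeasurable, ?_⟩
  rw [eLpNorm_lt_top_iff_lintegral_rpow_enorm_lt_top (by norm_num) (by norm_num)]
  have hm2 : Measurable fun p : Pos × Y =>
      ‖coulomb c (p.1 - a p.2)‖ₑ ^ (2 : ℝ≥0∞).toReal := hmeas.enorm.pow_const _
  rw [lintegral_prod_symm' _ hm2]
  set B : ℝ := c ^ 2 * (sphereArea * 1 * 1 + volume.real (Prod.fst '' K) / 1 ^ 2)
  have hb : ∀ y, ∫⁻ x in Prod.fst '' K, ‖coulomb c (x - a y)‖ₑ ^ (2 : ℝ≥0∞).toReal ≤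
      ENNReal.ofReal B := by
    intro y
    have hS : MeasurableSet (Prod.fst '' K) := h1.measurableSet
    have hi : Integrable ((Prod.fst '' K).indicator fun _ : Pos => (1 : ℝ)) volume :=
      (integrable_indicator_iff hS).2 (integrableOn_const h1.measure_lt_top.ne)
    have h := lintegral_coulomb_sq_mul_le c (ρ := (Prod.fst '' K).indicator fun _ => 1)
      (D := 1) (M := volume.real (Prod.fst '' K)) (R := 1)
      (fun x => Set.indicator_nonneg (fun _ _ => zero_le_one) x) zero_le_one
      (Filter.Eventually.of_forall fun x => Set.indicator_le_self' (fun _ _ => zero_le_one) x) hi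
      (by rw [integral_indicator hS]; simp) one_pos (a y)
    refine le_trans (le_of_eq ?_) h
    rw [← lintegral_indicator hS]
    refine lintegral_congr fun x => ?_
    by_cases hx : x ∈ Prod.fst '' K
    · rw [Set.indicator_of_mem hx, Set.indicator_of_mem hx, mul_one, ← coulomb_neg, neg_sub,
        ← sq_abs, ← Real.norm_eq_abs, ENNReal.ofReal_pow (norm_nonneg _), ofReal_norm]
      simp
    · rw [Set.indicator_of_notMem hx, Set.indicator_of_notMem hx, mul_zero, ENNReal.ofReal_zero]
  refine lt_of_le_of_lt (lintegral_mono hb) ?_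
  rw [lintegral_const, Measure.restrict_apply_univ]
  exact ENNReal.mul_lt_top ENNReal.ofReal_lt_top h2.measure_lt_top

section ManyParticles

variable {N : ℕ}

lemma continuous_removeNth {n : ℕ} (m : Fin (n + 1)) :
    Continuous (fun x : Config (n + 1) => ((x m, m.removeNth x) : Pos × Config n)) :=
  (continuous_apply m).prodMk (continuous_pi fun i => continuous_apply (m.succAbove i))

lemma LocallySqInt.comp_eval {W : Pos → ℝ} (hW : LocallySqInt W) (m : Fin N) :
    LocallySqInt (fun x : Config N => W (x m)) := by
  cases N with
  | zero => exact m.elim0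
  | succ n =>
    exact (hW.comp_fst (Y := Config n)).comp_measurePreserving (continuous_removeNth m)
      (measurePreserving_removeNth m)

lemma locallySqInt_coulomb_sub (c : ℝ) {i j : Fin N} (hij : i ≠ j) :
    LocallySqInt (fun x : Config N => coulomb c (x i - x j)) := by
  cases N with
  | zero => exact i.elim0
  | succ n =>
    obtain ⟨k, rfl⟩ := Fin.exists_succAbove_eq hij.symm
    have h := (locallySqInt_coulomb_sub_comp (Y := Config n) c (a := fun r => r k)
      (measurable_pi_apply k)).comp_measurePreserving
      (continuous_removeNth i) (measurePreserving_removeNth i)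
    simpa only [Fin.removeNth] using h

end ManyParticles

end

noncomputable section

/-! ### Partial Laplacians on product spaces -/

section PartialLaplacian

variable {Y : Type*} [NormedAddCommGroup Y] [NormedSpace ℝ Y]

/-- The Laplacian in the first variable. -/
def fstLaplacian (F : Pos × Y → ℂ) (p : Pos × Y) : ℂ :=
  Laplacian.laplacian (fun z => F (z, p.2)) p.1

lemma IsTestFunction.section_fst {F : Pos × Y → ℂ} (hF : IsTestFunction F) (y : Y) :
    IsTestFunction (fun z => F (z, y)) :=
  ⟨hF.1.comp (contDiff_id.prodMk contDiff_const), hF.2.comp_isClosedEmbedding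
    (Topology.IsClosedEmbedding.of_continuous_injective_isClosedMap (by fun_prop)
      (fun a b h => congrArg Prod.fst h)
      (by
        intro C hC
        have : (fun z : Pos => (z, y)) '' C = C ×ˢ {y} := by
          ext p
          simp only [Set.mem_image, Set.mem_prod, Set.mem_singleton_iff]
          constructor
          · rintro ⟨z, hz, rfl⟩
            exact ⟨hz, rfl⟩
          · rintro ⟨h1, h2⟩
            exact ⟨p.1, h1, by rw [← h2]⟩
        rw [this]
        exact hC.prod isClosed_singleton))⟩

lemma dirDeriv_comp_prodMk {F : Pos × Y → ℂ} (hF : Differentiable ℝ F) (v z : Pos) (y : Y) :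
    dirDeriv v (fun z => F (z, y)) z = dirDeriv (v, 0) F (z, y) := by
  have h0 : HasFDerivAt (fun z : Pos => (z, y)) ((ContinuousLinearMap.id ℝ Pos).prod 0) z :=
    (hasFDerivAt_id z).prodMk (hasFDerivAt_const y z)
  have h := (hF (z, y)).hasFDerivAt.comp z h0
  have h2 : HasFDerivAt (fun z => F (z, y)) _ z := h
  unfold dirDeriv
  rw [h2.fderiv]
  simp

lemma fstLaplacian_eq_sum_dirDeriv {F : Pos × Y → ℂ} (hF : IsTestFunction F) :
    fstLaplacian F =
      fun p => ∑ k, dirDeriv (stdVec k, 0) (dirDeriv (stdVec k, 0) F) p := by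
  funext ⟨z, y⟩
  unfold fstLaplacian
  rw [laplacian_eq_sum_dirDeriv ((hF.section_fst y).contDiff (n := 2))]
  refine Finset.sum_congr rfl fun k _ => ?_
  have h1 : dirDeriv (stdVec k) (fun z => F (z, y)) = fun z => dirDeriv (stdVec k, 0) F (z, y) :=
    funext fun z => dirDeriv_comp_prodMk hF.differentiable _ z y
  rw [h1, dirDeriv_comp_prodMk (hF.dirDeriv _).differentiable]

lemma IsTestFunction.fstLaplacian {F : Pos × Y → ℂ} (hF : IsTestFunction F) :
    IsTestFunction (fstLaplacian F) := by
  rw [fstLaplacian_eq_sum_dirDeriv hF]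
  exact IsTestFunction.sum _ fun k _ => (hF.dirDeriv _).dirDeriv _

/-- The one-particle Schrödinger expression `(-Δ + U) F` in the first variable. -/
def fstSchrodinger (U : Pos → ℝ) (F : Pos × Y → ℂ) (p : Pos × Y) : ℂ :=
  -(fstLaplacian F p) + (U p.1 : ℂ) * F p

omit [NormedSpace ℝ Y] in
lemma fstSchrodinger_eq_zero {U : Pos → ℝ} {F : Pos × Y → ℂ} {y : Y}
    (hy : y ∉ Prod.snd '' tsupport F) (z : Pos) : fstSchrodinger U F (z, y) = 0 := by
  have h0 : ∀ z, F (z, y) = 0 := fun z =>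
    image_eq_zero_of_notMem_tsupport fun h => hy ⟨(z, y), h, rfl⟩
  simp [fstSchrodinger, fstLaplacian, h0]

/-- One majorant serves all potentials bounded by `M` and all parameters `y`. It is therefore
uniform in time along the flow, as differentiation under the integral requires. -/
lemma exists_norm_fstSchrodinger_le {w : Pos → ℝ} (hw : LocallySqInt w) {F : Pos × Y → ℂ}
    (hF : IsTestFunction F) (M : ℝ) :
    ∃ E : Pos → ℝ, MemLp E 2 volume ∧ ∀ V : Pos → ℝ, (∀ x, |V x| ≤ M) →
      ∀ z y, ‖fstSchrodinger (fun x => w x + V x) F (z, y)‖ ≤ E z := by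
  obtain ⟨B, hB⟩ := hF.exists_bound
  obtain ⟨B', hB'⟩ := hF.fstLaplacian.exists_bound
  have hK : IsCompact (Prod.fst '' (tsupport F ∪ tsupport (_root_.fstLaplacian F))) :=
    (hF.2.isCompact.union hF.fstLaplacian.2.isCompact).image continuous_fst
  set K := Prod.fst '' (tsupport F ∪ tsupport (_root_.fstLaplacian F))
  have hfin : IsFiniteMeasure ((volume : Measure Pos).restrict K) :=
    ⟨by simpa using hK.measure_lt_top⟩
  refine ⟨K.indicator fun z => B' + (|w z| + M) * B, ?_, fun V hV z y => ?_⟩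
  · rw [memLp_indicator_iff_restrict hK.measurableSet]
    have h1 : MemLp (fun z => |w z| + M) 2 (volume.restrict K) :=
      (hw K hK).norm.add (memLp_const M)
    have h2 := h1.const_mul B
    have h3 := (memLp_const (μ := (volume : Measure Pos).restrict K) (p := 2) B').add h2
    refine h3.ae_eq (Filter.Eventually.of_forall fun z => ?_)
    simp only [Pi.add_apply]
    ring
  · by_cases hz : z ∈ K
    · rw [Set.indicator_of_mem hz]
      refine (norm_add_le _ _).trans (add_le_add ?_ ?_)
      · rw [norm_neg]
        exact hB' _
      · rw [norm_mul, Complex.norm_real, Real.norm_eq_abs]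
        refine mul_le_mul ((abs_add_le _ _).trans (add_le_add le_rfl (hV z))) (hB _)
          (norm_nonneg _) ?_
        exact add_nonneg (abs_nonneg _) ((abs_nonneg _).trans (hV z))
    · have h1 : F (z, y) = 0 :=
        image_eq_zero_of_notMem_tsupport fun h => hz ⟨(z, y), Or.inl h, rfl⟩
      have h2 : _root_.fstLaplacian F (z, y) = 0 :=
        image_eq_zero_of_notMem_tsupport fun h => hz ⟨(z, y), Or.inr h, rfl⟩
      rw [Set.indicator_of_notMem hz]
      simp [fstSchrodinger, h1, h2]

end PartialLaplacian

section AdjointTensor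

variable {X : Type*} [MeasureSpace X] [SigmaFinite (volume : Measure X)]

lemma adjoint_tensor_coeFn_of_ae (w : OneBody) {F : SqInt (Pos × X)} {F' : Pos × X → ℂ}
    (h : F =ᵐ[volume] F') :
    (ContinuousLinearMap.adjoint (tensor (X := X) w)) F =ᵐ[volume] partialInner w F' := by
  filter_upwards [adjoint_tensor_coeFn w F, ae_ae_of_ae_snd h] with x h1 h2
  rw [h1]
  refine integral_congr_ae ?_
  filter_upwards [h2] with z hz
  rw [hz]

omit [MeasureSpace X] [SigmaFinite (volume : Measure X)] in
lemma norm_partialInner_le (u : OneBody) {F : Pos × X → ℂ} {E : Pos → ℝ} (hE : MemLp E 2 volume)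
    {x : X} (hF : ∀ z, ‖F (z, x)‖ ≤ E z) : ‖partialInner u F x‖ ≤ ‖u‖ * ‖hE.toLp E‖ := by
  have hi : Integrable (fun z => ‖u z‖ * E z) volume :=
    (Lp.memLp u).norm.integrable_mul hE
  have h1 : ‖partialInner u F x‖ ≤ ∫ z, ‖u z‖ * E z := by
    refine norm_integral_le_of_norm_le hi (Filter.Eventually.of_forall fun z => ?_)
    rw [norm_mul, RCLike.norm_conj]
    exact mul_le_mul_of_nonneg_left (hF z) (norm_nonneg _)
  have h2 : inner ℝ ((Lp.memLp u).norm.toLp _) (hE.toLp E) = ∫ z, ‖u z‖ * E z := by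
    rw [L2.inner_def]
    refine integral_congr_ae ?_
    filter_upwards [(Lp.memLp u).norm.coeFn_toLp, hE.coeFn_toLp] with z h3 h4
    rw [h3, h4]
    simp [mul_comm]
  have h3 : ‖(Lp.memLp u).norm.toLp (fun z => ‖u z‖)‖ = ‖u‖ := by
    rw [Lp.norm_toLp, eLpNorm_norm, Lp.norm_def]
  calc _ ≤ _ := h1
    _ = inner ℝ ((Lp.memLp u).norm.toLp _) (hE.toLp E) := h2.symm
    _ ≤ _ := real_inner_le_norm _ _
    _ = _ := by rw [h3]

end AdjointTensor

/-! ### The time derivative along the Hartree flow -/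

section HartreeDerivative

variable {N : ℕ} {w v : Pos → ℝ} {T : EReal} {φ : ℝ → Fin N → OneBody}

/-- Local boundedness of the orbitals and of the mean field on the time interval `(0, τ)`. -/
structure HartreeBound (w v : Pos → ℝ) (φ : ℝ → Fin N → OneBody) (T : EReal) (τ M : ℝ) : Prop where
  solution : IsHartreeSolution w v T φ
  field : LocallySqInt w
  mem : ∀ t ∈ Set.Ioo 0 τ, t ∈ timeInterval T
  measurable : Measurable v
  orbital : ∀ t ∈ Set.Ioo 0 τ, ∀ i, ‖φ t i‖ ≤ M
  potential : ∀ t ∈ Set.Ioo 0 τ, ∀ x, |meanField v (φ t) x| ≤ M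

variable {τ M : ℝ}

lemma HartreeBound.timeInterval_mem_nhds (h : HartreeBound w v φ T τ M) {t : ℝ}
    (ht : t ∈ Set.Ioo 0 τ) : timeInterval T ∈ nhds t :=
  Filter.mem_of_superset (Ioo_mem_nhds ht.1 ht.2) fun s hs => h.mem s hs

variable {Y : Type*} [NormedAddCommGroup Y] [NormedSpace ℝ Y]

/-- A section of `F` at fixed `y` is an admissible test function. The complex conjugate of the weak
equation moves the orbital into the antilinear slot, which turns `-i` into `i`. -/
lemma HartreeBound.hasDerivAt_partialInner (h : HartreeBound w v φ T τ M) {t : ℝ}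
    (ht : t ∈ Set.Ioo 0 τ) (i : Fin N) {F : Pos × Y → ℂ} (hF : IsTestFunction F) (y : Y) :
    HasDerivAt (fun s => partialInner (φ s i) F y)
      (Complex.I * partialInner (φ t i)
        (fstSchrodinger (fun x => w x + meanField v (φ t) x) F) y) t := by
  have h1 := ((h.solution i).2 _ (hF.section_fst y) t (h.mem t ht)).hasDerivAt
    (h.timeInterval_mem_nhds ht)
  have h2 := (Complex.conjCLE : ℂ ≃L[ℝ] ℂ).toContinuousLinearMap.hasFDerivAt.comp_hasDerivAt t h1
  have e1 : ∀ (u : OneBody) (f : Pos → ℂ),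
      conj (∫ x, conj (f x) * u x) = ∫ x, conj (u x) * f x := by
    intro u f
    rw [← integral_conj]
    refine integral_congr_ae (Filter.Eventually.of_forall fun x => ?_)
    simp only [map_mul, Complex.conj_conj]
    ring
  have e3 := e1 (φ t i) (fun x => -(Laplacian.laplacian (fun z => F (z, y)) x) +
    ((w x + meanField v (φ t) x : ℝ) : ℂ) * F (x, y))
  have h3 : HasDerivAt (fun s => partialInner (φ s i) F y) (conj (-Complex.I *
      ∫ x, conj (-(Laplacian.laplacian (fun z => F (z, y)) x) +
        ((w x + meanField v (φ t) x : ℝ) : ℂ) * F (x, y)) * φ t i x)) t :=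
    h2.congr_of_eventuallyEq (Filter.Eventually.of_forall fun s => (e1 (φ s i) _).symm)
  refine h3.congr_deriv ?_
  rw [map_mul, map_neg, Complex.conj_I, neg_neg, e3]
  rfl

variable [MeasureSpace Y] [SigmaFinite (volume : Measure Y)] [OpensMeasurableSpace Y]
  [IsFiniteMeasureOnCompacts (volume : Measure Y)]

/-- The derivative of `⟨T_i† F, T_j† G⟩`, where `T_i† F = ∫ conj φ_i(z) F(z, ·) dz`. -/
theorem HartreeBound.hasDerivAt_inner_adjoint_tensor (h : HartreeBound w v φ T τ M) {t : ℝ}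
    (ht : t ∈ Set.Ioo 0 τ) (i j : Fin N) {F' G' : Pos × Y → ℂ} (hF' : IsTestFunction F')
    (hG' : IsTestFunction G') {F G HF HG : SqInt (Pos × Y)} (hF : F =ᵐ[volume] F')
    (hG : G =ᵐ[volume] G')
    (hHF : HF =ᵐ[volume] fstSchrodinger (fun x => w x + meanField v (φ t) x) F')
    (hHG : HG =ᵐ[volume] fstSchrodinger (fun x => w x + meanField v (φ t) x) G') :
    HasDerivAt (fun s => inner ℂ (ContinuousLinearMap.adjoint (tensor (X := Y) (φ s i)) F)
        (ContinuousLinearMap.adjoint (tensor (X := Y) (φ s j)) G))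
      (Complex.I * (inner ℂ (ContinuousLinearMap.adjoint (tensor (X := Y) (φ t i)) F)
          (ContinuousLinearMap.adjoint (tensor (X := Y) (φ t j)) HG) -
        inner ℂ (ContinuousLinearMap.adjoint (tensor (X := Y) (φ t i)) HF)
          (ContinuousLinearMap.adjoint (tensor (X := Y) (φ t j)) G))) t := by
  have hU : ∀ s ∈ Set.Ioo 0 τ, ∀ x, |meanField v (φ s) x| ≤ M := h.potential
  obtain ⟨EF, hEF, bF⟩ := exists_norm_fstSchrodinger_le h.field hF' M
  obtain ⟨EG, hEG, bG⟩ := exists_norm_fstSchrodinger_le h.field hG' M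
  have hz : ∀ H : Pos × Y → ℂ, IsTestFunction H →
      ∃ E : Pos → ℝ, MemLp E 2 volume ∧ ∀ z y, ‖H (z, y)‖ ≤ E z := by
    intro H hH
    obtain ⟨B, hB⟩ := hH.exists_bound
    have hK : IsCompact (Prod.fst '' tsupport H) := hH.2.isCompact.image continuous_fst
    refine ⟨(Prod.fst '' tsupport H).indicator fun _ => B,
      memLp_indicator_const 2 hK.measurableSet B (Or.inr hK.measure_lt_top.ne), fun z y => ?_⟩
    by_cases hz : z ∈ Prod.fst '' tsupport H
    · rw [Set.indicator_of_mem hz]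
      exact hB _
    · rw [Set.indicator_of_notMem hz,
        image_eq_zero_of_notMem_tsupport fun h => hz ⟨(z, y), h, rfl⟩, norm_zero]
  obtain ⟨EF', hEF', bF'⟩ := hz F' hF'
  obtain ⟨EG', hEG', bG'⟩ := hz G' hG'
  have hM : 0 ≤ M := (norm_nonneg _).trans (h.orbital t ht i)
  have hK : IsCompact (Prod.snd '' tsupport G') := hG'.2.isCompact.image continuous_snd
  -- Both summands of the time derivative contain `G'` or the Schrödinger expression of `G'`, hence
  -- vanish unless `y` lies in a compact set. There Cauchy–Schwarz in the first variable bounds them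
  -- by the two products forming `C`.
  obtain ⟨C, hC⟩ : ∃ C, C = M * ‖hEF.toLp EF‖ * (M * ‖hEG'.toLp EG'‖) +
    M * ‖hEF'.toLp EF'‖ * (M * ‖hEG.toLp EG‖) := ⟨_, rfl⟩
  have hint : ∀ {a b : SqInt Y} {a' b' : Y → ℂ}, a =ᵐ[volume] a' → b =ᵐ[volume] b' →
      Integrable (fun y => conj (a' y) * b' y) volume := by
    intro a b a' b' ha hb
    refine (L2.integrable_inner (𝕜 := ℂ) a b).congr ?_
    filter_upwards [ha, hb] with y h1 h2
    rw [h1, h2, RCLike.inner_apply']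
  have key := (hasDerivAt_integral_of_dominated_loc_of_deriv_le (μ := (volume : Measure Y))
    (F := fun s y => conj (partialInner (φ s i) F' y) * partialInner (φ s j) G' y)
    (F' := fun s y => conj (Complex.I * partialInner (φ s i)
        (fstSchrodinger (fun x => w x + meanField v (φ s) x) F') y) * partialInner (φ s j) G' y +
      conj (partialInner (φ s i) F' y) * (Complex.I * partialInner (φ s j)
        (fstSchrodinger (fun x => w x + meanField v (φ s) x) G') y))
    (x₀ := t) (s := Set.Ioo 0 τ) (bound := (Prod.snd '' tsupport G').indicator fun _ => C)
    (Ioo_mem_nhds ht.1 ht.2)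
    (Filter.Eventually.of_forall fun s =>
      (hint (adjoint_tensor_coeFn_of_ae (φ s i) hF) (adjoint_tensor_coeFn_of_ae (φ s j) hG)).1)
    (hint (adjoint_tensor_coeFn_of_ae (φ t i) hF) (adjoint_tensor_coeFn_of_ae (φ t j) hG))
    ?_ ?_ ?_ ?_).2
  · refine (key.congr_of_eventuallyEq (Filter.Eventually.of_forall fun s =>
      inner_eq_integral_of_ae (adjoint_tensor_coeFn_of_ae (φ s i) hF)
        (adjoint_tensor_coeFn_of_ae (φ s j) hG))).congr_deriv ?_
    have i1 := hint (adjoint_tensor_coeFn_of_ae (φ t i) hF) (adjoint_tensor_coeFn_of_ae (φ t j) hHG)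
    have i2 := hint (adjoint_tensor_coeFn_of_ae (φ t i) hHF) (adjoint_tensor_coeFn_of_ae (φ t j) hG)
    rw [inner_eq_integral_of_ae (adjoint_tensor_coeFn_of_ae (φ t i) hF)
        (adjoint_tensor_coeFn_of_ae (φ t j) hHG),
      inner_eq_integral_of_ae (adjoint_tensor_coeFn_of_ae (φ t i) hHF)
        (adjoint_tensor_coeFn_of_ae (φ t j) hG), ← integral_sub i1 i2, ← integral_const_mul]
    refine integral_congr_ae (Filter.Eventually.of_forall fun y => ?_)
    simp only [map_mul, Complex.conj_I]
    ring
  · have i1 := hint (adjoint_tensor_coeFn_of_ae (φ t i) hF) (adjoint_tensor_coeFn_of_ae (φ t j) hHG)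
    have i2 := hint (adjoint_tensor_coeFn_of_ae (φ t i) hHF) (adjoint_tensor_coeFn_of_ae (φ t j) hG)
    refine (((i1.sub i2).const_mul Complex.I).1).congr (Filter.Eventually.of_forall fun y => ?_)
    simp only [map_mul, Complex.conj_I, Pi.sub_apply]
    ring
  · refine Filter.Eventually.of_forall fun y s hs => ?_
    have hb : ∀ (k : Fin N) {H : Pos × Y → ℂ} {E : Pos → ℝ} (hE : MemLp E 2 volume),
        (∀ z, ‖H (z, y)‖ ≤ E z) → ‖partialInner (φ s k) H y‖ ≤ M * ‖hE.toLp E‖ :=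
      fun k H E hE hH => (norm_partialInner_le _ hE hH).trans
        (mul_le_mul_of_nonneg_right (h.orbital s hs k) (norm_nonneg _))
    by_cases hy : y ∈ Prod.snd '' tsupport G'
    · rw [Set.indicator_of_mem hy, hC]
      refine (norm_add_le _ _).trans (add_le_add ?_ ?_)
      · rw [norm_mul, RCLike.norm_conj, norm_mul, Complex.norm_I, one_mul]
        exact mul_le_mul (hb i hEF fun z => bF _ (hU s hs) z y) (hb j hEG' fun z => bG' z y)
          (norm_nonneg _) (by positivity)
      · rw [norm_mul, RCLike.norm_conj, norm_mul, Complex.norm_I, one_mul]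
        exact mul_le_mul (hb i hEF' fun z => bF' z y) (hb j hEG fun z => bG _ (hU s hs) z y)
          (norm_nonneg _) (by positivity)
    · rw [Set.indicator_of_notMem hy]
      have h1 : partialInner (φ s j) G' y = 0 := by
        have : ∀ z, G' (z, y) = 0 := fun z =>
          image_eq_zero_of_notMem_tsupport fun h => hy ⟨(z, y), h, rfl⟩
        simp [partialInner, this]
      have h2 : partialInner (φ s j)
          (fstSchrodinger (fun x => w x + meanField v (φ s) x) G') y = 0 := by
        simp [partialInner, fstSchrodinger_eq_zero hy]
      simp [h1, h2]
  · exact (integrable_indicator_iff hK.measurableSet).2 (integrableOn_const hK.measure_lt_top.ne)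
  · refine Filter.Eventually.of_forall fun y s hs => ?_
    have h1 := h.hasDerivAt_partialInner hs i hF' y
    have h2 := h.hasDerivAt_partialInner hs j hG' y
    have h3 := (Complex.conjCLE : ℂ ≃L[ℝ] ℂ).toContinuousLinearMap.hasFDerivAt.comp_hasDerivAt s h1
    have h4 : HasDerivAt (fun s => conj (partialInner (φ s i) F' y))
      (conj (Complex.I * partialInner (φ s i)
        (fstSchrodinger (fun x => w x + meanField v (φ s) x) F') y)) s := h3
    exact h4.mul h2

end HartreeDerivative

end

noncomputable section

/-! ### Mollification -/

/-- The convolution of `f` with a kernel `J`. -/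
def mollify (J f : Pos → ℂ) (x : Pos) : ℂ := ∫ z, f z * J (x - z)

lemma mollify_eq_convolution (J f : Pos → ℂ) :
    mollify J f = convolution f J (ContinuousLinearMap.mul ℝ ℂ) volume := rfl

lemma locallyIntegrable_oneBody (f : OneBody) : LocallyIntegrable f volume :=
  (Lp.memLp f).locallyIntegrable (by norm_num)

lemma contDiff_mollify {J : Pos → ℂ} (hJ : IsTestFunction J) (f : OneBody) :
    ContDiff ℝ ((⊤ : ℕ∞) : WithTop ℕ∞) (mollify J f) := by
  rw [mollify_eq_convolution]
  exact hJ.2.contDiff_convolution_right _ (locallyIntegrable_oneBody f) hJ.1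

lemma dirDeriv_mollify {J : Pos → ℂ} (hJ : IsTestFunction J) (f : OneBody) (v : Pos) :
    dirDeriv v (mollify J f) = mollify (dirDeriv v J) f := by
  funext x
  have h := hJ.2.hasFDerivAt_convolution_right (ContinuousLinearMap.mul ℝ ℂ)
    (locallyIntegrable_oneBody f) (hJ.contDiff (n := 1)) x
  rw [mollify_eq_convolution, mollify_eq_convolution]
  unfold dirDeriv
  rw [h.fderiv, convolution_precompR_apply _ (locallyIntegrable_oneBody f) (hJ.2.fderiv ℝ)
    ((hJ.contDiff (n := 1)).continuous_fderiv (by simp))]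

lemma IsTestFunction.comp_sub_left {J : Pos → ℂ} (hJ : IsTestFunction J) (x : Pos) :
    IsTestFunction (fun z => J (x - z)) :=
  ⟨hJ.1.comp (contDiff_const.sub contDiff_id),
    hJ.2.comp_homeomorph (Homeomorph.subLeft x)⟩

lemma dirDeriv_comp_sub_left {J : Pos → ℂ} (hJ : Differentiable ℝ J) (v x z : Pos) :
    dirDeriv v (fun z => J (x - z)) z = -(dirDeriv v J (x - z)) := by
  have h0 : HasFDerivAt (fun z : Pos => x - z) (-(ContinuousLinearMap.id ℝ Pos)) z :=
    (hasFDerivAt_id z).const_sub x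
  have h := (hJ (x - z)).hasFDerivAt.comp z h0
  have h2 : HasFDerivAt (fun z => J (x - z)) _ z := h
  unfold dirDeriv
  rw [h2.fderiv]
  simp

/-- The weak gradient is tested with the reflected translate `z ↦ J (x - z)`; the sign from the
reflection cancels the one from integration by parts. -/
lemma mollify_dirDeriv_eq {J : Pos → ℂ} (hJ : IsTestFunction J) {f : OneBody}
    {G : Fin 3 → OneBody} (hG : IsWeakGradient f G) (k : Fin 3) :
    mollify (dirDeriv (stdVec k) J) f = mollify J (G k) := by
  funext x
  have h := hG _ (hJ.comp_sub_left x) k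
  have e : ∀ z, fderiv ℝ (fun z => J (x - z)) z (EuclideanSpace.single k 1) =
      -(dirDeriv (stdVec k) J (x - z)) := fun z =>
    dirDeriv_comp_sub_left hJ.differentiable (stdVec k) x z
  simp only [e, neg_mul, integral_neg, neg_inj] at h
  unfold mollify
  simp only [mul_comm (f _), mul_comm (G k _)]
  exact h

/-- Smooth probability densities supported in the ball of radius `δ`. -/
structure IsMollifier (j : Pos → ℝ) (δ : ℝ) : Prop where
  contDiff : ContDiff ℝ ((⊤ : ℕ∞) : WithTop ℕ∞) j
  hasCompactSupport : HasCompactSupport j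
  nonneg : ∀ x, 0 ≤ j x
  integral : ∫ x, j x = 1
  support : ∀ x, δ ≤ ‖x‖ → j x = 0

namespace IsMollifier

variable {j : Pos → ℝ} {δ : ℝ}

lemma isTestFunction (h : IsMollifier j δ) : IsTestFunction (fun x => (j x : ℂ)) :=
  ⟨Complex.ofRealCLM.contDiff.comp h.contDiff,
    h.hasCompactSupport.comp_left (g := fun r : ℝ => (r : ℂ)) Complex.ofReal_zero⟩

lemma integrable (h : IsMollifier j δ) : Integrable j volume :=
  h.contDiff.continuous.integrable_of_hasCompactSupport h.hasCompactSupport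

lemma integrable_sub_left (h : IsMollifier j δ) (x : Pos) :
    Integrable (fun z => j (x - z)) volume := h.integrable.comp_sub_left x

lemma integral_sub_left (h : IsMollifier j δ) (x : Pos) : ∫ z, j (x - z) = 1 := by
  rw [integral_sub_left_eq_self]
  exact h.integral

lemma norm_mollify_le (h : IsMollifier j δ) {f : Pos → ℂ} {B : ℝ}
    (hB : ∀ᵐ z, ‖f z‖ ≤ B) (x : Pos) : ‖mollify (fun x => (j x : ℂ)) f x‖ ≤ B := by
  have h1 : ‖mollify (fun x => (j x : ℂ)) f x‖ ≤ ∫ z, B * j (x - z) := by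
    refine norm_integral_le_of_norm_le ((h.integrable_sub_left x).const_mul B) ?_
    filter_upwards [hB] with z hz
    rw [norm_mul, Complex.norm_real, Real.norm_of_nonneg (h.nonneg _)]
    exact mul_le_mul_of_nonneg_right hz (h.nonneg _)
  rwa [integral_const_mul, h.integral_sub_left, mul_one] at h1

/-- Jensen's inequality for the probability density `j (x - ·)`, obtained from Cauchy–Schwarz after
writing `j = √j √j`. -/
lemma norm_mollify_sq_le (h : IsMollifier j δ) (f : OneBody) (x : Pos) :
    ‖mollify (fun x => (j x : ℂ)) f x‖ ^ 2 ≤ ∫ z, ‖f z‖ ^ 2 * j (x - z) := by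
  obtain ⟨B, hB⟩ := h.hasCompactSupport.exists_bound_of_continuous h.contDiff.continuous
  have hs : Continuous fun z => ((√(j (x - z)) : ℝ) : ℂ) :=
    Complex.continuous_ofReal.comp (Real.continuous_sqrt.comp
      (h.contDiff.continuous.comp (continuous_const.sub continuous_id)))
  have hsq : ∀ z, ‖((√(j (x - z)) : ℝ) : ℂ)‖ ^ 2 = j (x - z) := fun z => by
    rw [Complex.norm_real, Real.norm_of_nonneg (Real.sqrt_nonneg _), Real.sq_sqrt (h.nonneg _)]
  have h1 : MemLp (fun z => ((√(j (x - z)) : ℝ) : ℂ)) 2 volume := by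
    rw [memLp_two_iff_integrable_sq_norm hs.aestronglyMeasurable]
    simp only [hsq]
    exact h.integrable_sub_left x
  have h2 : MemLp (fun z => ((√(j (x - z)) : ℝ) : ℂ) * f z) 2 volume := by
    refine (Lp.memLp f).of_le_mul (c := √B) (hs.aestronglyMeasurable.mul
      (Lp.aestronglyMeasurable f)) (Filter.Eventually.of_forall fun z => ?_)
    rw [norm_mul, Complex.norm_real, Real.norm_of_nonneg (Real.sqrt_nonneg _)]
    exact mul_le_mul_of_nonneg_right (Real.sqrt_le_sqrt ((Real.le_norm_self _).trans (hB _)))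
      (norm_nonneg _)
  have h3 := norm_integral_mul_sq_le h1 h2
  simp only [hsq, h.integral_sub_left, one_mul, norm_mul, mul_pow] at h3
  have e : mollify (fun x => (j x : ℂ)) f x =
      ∫ z, conj ((√(j (x - z)) : ℝ) : ℂ) * (((√(j (x - z)) : ℝ) : ℂ) * f z) := by
    refine integral_congr_ae (Filter.Eventually.of_forall fun z => ?_)
    simp only [Complex.conj_ofReal]
    rw [← mul_assoc, ← Complex.ofReal_mul, Real.mul_self_sqrt (h.nonneg _), mul_comm]
  rw [e]
  refine h3.trans (le_of_eq (integral_congr_ae (Filter.Eventually.of_forall fun z => ?_)))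
  exact mul_comm _ _

lemma integrable_convolution_norm_sq (h : IsMollifier j δ) (f : OneBody) :
    Integrable (fun x => ∫ z, ‖f z‖ ^ 2 * j (x - z)) volume :=
  (integrable_norm_sq f).integrable_convolution (ContinuousLinearMap.mul ℝ ℝ) h.integrable

lemma integral_convolution_norm_sq (h : IsMollifier j δ) (f : OneBody) :
    ∫ x, ∫ z, ‖f z‖ ^ 2 * j (x - z) = ‖f‖ ^ 2 := by
  have h1 := integral_convolution (ContinuousLinearMap.mul ℝ ℝ) (integrable_norm_sq f) h.integrable
  rw [h.integral, ← norm_sq_eq_integral (F := f) Filter.EventuallyEq.rfl] at h1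
  simp only [ContinuousLinearMap.mul_apply', mul_one] at h1
  exact h1

lemma integrable_norm_mollify_sq (h : IsMollifier j δ) (f : OneBody) :
    Integrable (fun x => ‖mollify (fun x => (j x : ℂ)) f x‖ ^ 2) volume :=
  (h.integrable_convolution_norm_sq f).mono'
    ((contDiff_mollify h.isTestFunction f).continuous.norm.pow 2).aestronglyMeasurable
    (Filter.Eventually.of_forall fun x => by
      rw [Real.norm_of_nonneg (by positivity)]
      exact h.norm_mollify_sq_le f x)

/-- Convolution with a probability density is a contraction in `L²`. -/
lemma integral_norm_mollify_sq_le (h : IsMollifier j δ) (f : OneBody) :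
    ∫ x, ‖mollify (fun x => (j x : ℂ)) f x‖ ^ 2 ≤ ‖f‖ ^ 2 := by
  rw [← h.integral_convolution_norm_sq f]
  exact integral_mono (h.integrable_norm_mollify_sq f) (h.integrable_convolution_norm_sq f)
    (h.norm_mollify_sq_le f)

end IsMollifier

/-- Integration by parts, with only one compactly supported factor. -/
lemma IsTestFunction.integral_mul_dirDeriv_of_contDiff {f g : Pos → ℂ} (hf : IsTestFunction f)
    (hg : ContDiff ℝ ((⊤ : ℕ∞) : WithTop ℕ∞) g) (v : Pos) :
    ∫ x, f x * _root_.dirDeriv v g x = -∫ x, _root_.dirDeriv v f x * g x := by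
  have hg' : ContDiff ℝ ((⊤ : ℕ∞) : WithTop ℕ∞) (_root_.dirDeriv v g) :=
    (hg.fderiv_right (m := ((⊤ : ℕ∞) : WithTop ℕ∞)) (by simp)).clm_apply contDiff_const
  refine integral_mul_fderiv_eq_neg_fderiv_mul_of_integrable ?_ ?_ ?_
    (fun x _ => hf.differentiable x) (fun x _ => hg.differentiable (by simp) x)
  · refine ((hf.dirDeriv v).mul_left hg).integrable.congr (Filter.Eventually.of_forall fun x => ?_)
    exact mul_comm _ _
  · refine (hf.mul_left hg').integrable.congr (Filter.Eventually.of_forall fun x => ?_)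
    exact mul_comm _ _
  · refine (hf.mul_left hg).integrable.congr (Filter.Eventually.of_forall fun x => ?_)
    exact mul_comm _ _

end

/-! ### Localized mollifiers and the kinetic commutator -/

noncomputable section

section DirDeriv

variable {E : Type*} [NormedAddCommGroup E] [NormedSpace ℝ E]

lemma dirDeriv_mul {f g : E → ℂ} (hf : Differentiable ℝ f) (hg : Differentiable ℝ g) (v : E) :
    dirDeriv v (fun x => f x * g x) = fun x => dirDeriv v f x * g x + f x * dirDeriv v g x := by
  funext x
  have h := (hf x).hasFDerivAt.mul (hg x).hasFDerivAt
  have h2 : HasFDerivAt (fun x => f x * g x) _ x := h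
  unfold dirDeriv
  rw [h2.fderiv]
  simp only [add_apply, smul_apply, smul_eq_mul]
  ring

lemma dirDeriv_const_mul {f : E → ℂ} (hf : Differentiable ℝ f) (c : ℂ) (v : E) :
    dirDeriv v (fun x => c * f x) = fun x => c * dirDeriv v f x := by
  rw [dirDeriv_mul (differentiable_const c) hf]
  funext x
  simp [dirDeriv]

end DirDeriv

/-- The family of localized translates `z ↦ ζ(x) j(x - z)` of a mollifier. -/
def mollifierFamily (ζ j : Pos → ℝ) (p : Pos × Pos) : ℂ := (ζ p.2 : ℂ) * (j (p.2 - p.1) : ℂ)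

section Family

variable {ζ j : Pos → ℝ} {δ : ℝ}

lemma isTestFunction_mollifierFamily (hj : IsMollifier j δ)
    (hζ : ContDiff ℝ ((⊤ : ℕ∞) : WithTop ℕ∞) ζ) (hζc : HasCompactSupport ζ) :
    IsTestFunction (mollifierFamily ζ j) := by
  refine ⟨?_, ?_⟩
  · exact (Complex.ofRealCLM.contDiff.comp (hζ.comp contDiff_snd)).mul
      (Complex.ofRealCLM.contDiff.comp (hj.contDiff.comp (contDiff_snd.sub contDiff_fst)))
  · have hK : IsCompact ((fun q : Pos × Pos => (q.1 - q.2, q.1)) '' (tsupport ζ ×ˢ tsupport j)) :=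
      (hζc.isCompact.prod hj.hasCompactSupport.isCompact).image (by fun_prop)
    refine HasCompactSupport.intro hK fun p hp => ?_
    by_cases h1 : p.2 ∈ tsupport ζ
    · by_cases h2 : p.2 - p.1 ∈ tsupport j
      · exact absurd ⟨(p.2, p.2 - p.1), ⟨h1, h2⟩, by simp⟩ hp
      · simp [mollifierFamily, image_eq_zero_of_notMem_tsupport h2]
    · simp [mollifierFamily, image_eq_zero_of_notMem_tsupport h1]

lemma partialInner_mollifierFamily (f : OneBody) (x : Pos) :
    partialInner f (mollifierFamily ζ j) x =
      (ζ x : ℂ) * conj (mollify (fun x => (j x : ℂ)) f x) := by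
  simp only [partialInner, mollifierFamily, mollify]
  rw [← integral_conj, ← integral_const_mul]
  refine integral_congr_ae (Filter.Eventually.of_forall fun z => ?_)
  simp only [map_mul, Complex.conj_ofReal]
  ring

lemma fstLaplacian_mollifierFamily (hj : IsMollifier j δ) (p : Pos × Pos) :
    fstLaplacian (mollifierFamily ζ j) p = (ζ p.2 : ℂ) *
      ∑ k, dirDeriv (stdVec k) (dirDeriv (stdVec k) fun x => (j x : ℂ)) (p.2 - p.1) := by
  have hJ := hj.isTestFunction
  have hd : ∀ (H : Pos → ℂ), IsTestFunction H → ∀ (c : ℂ) (v : Pos),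
      dirDeriv v (fun z => c * H (p.2 - z)) = fun z => (-c) * dirDeriv v H (p.2 - z) := by
    intro H hH c v
    rw [dirDeriv_const_mul (hH.comp_sub_left p.2).differentiable]
    funext z
    rw [dirDeriv_comp_sub_left hH.differentiable]
    ring
  unfold fstLaplacian
  change Laplacian.laplacian (fun z => (ζ p.2 : ℂ) * (j (p.2 - z) : ℂ)) p.1 = _
  rw [laplacian_eq_sum_dirDeriv
    (contDiff_const.mul ((hJ.comp_sub_left p.2).contDiff (n := 2))), Finset.mul_sum]
  refine Finset.sum_congr rfl fun k _ => ?_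
  have h1 := hd _ hJ (ζ p.2 : ℂ) (stdVec k)
  rw [h1, hd _ (hJ.dirDeriv (stdVec k)) (-(ζ p.2 : ℂ)) (stdVec k), neg_neg]

lemma IsMollifier.conj_dirDeriv_dirDeriv (hj : IsMollifier j δ) (v x : Pos) :
    conj (dirDeriv v (dirDeriv v fun x => (j x : ℂ)) x) =
      dirDeriv v (dirDeriv v fun x => (j x : ℂ)) x := by
  have hJ := hj.isTestFunction
  have h1 := dirDeriv_conj hJ.differentiable v
  have h2 := dirDeriv_conj (hJ.dirDeriv v).differentiable v
  simp only [Complex.conj_ofReal] at h1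
  rw [← h1] at h2
  exact (congrFun h2 x).symm

/-- One of the two derivatives is moved from the mollifier to the orbital as its weak gradient. The
remaining one acts on a smooth function and is available for integration by parts against `ζ`. -/
lemma partialInner_fstLaplacian_mollifierFamily (hj : IsMollifier j δ) {f : OneBody}
    {G : Fin 3 → OneBody} (hG : IsWeakGradient f G) (x : Pos) :
    partialInner f (fstLaplacian (mollifierFamily ζ j)) x = (ζ x : ℂ) *
      conj (∑ k, dirDeriv (stdVec k) (mollify (fun x => (j x : ℂ)) (G k)) x) := by
  have hJ := hj.isTestFunction
  have hint : ∀ k, Integrable (fun z => f z *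
      dirDeriv (stdVec k) (dirDeriv (stdVec k) fun x => (j x : ℂ)) (x - z)) volume := fun k =>
    (Lp.memLp f).integrable_mul
      ((((hJ.dirDeriv (stdVec k)).dirDeriv (stdVec k)).comp_sub_left x).memLp 2)
  have e1 : ∀ k, dirDeriv (stdVec k) (mollify (fun x => (j x : ℂ)) (G k)) x = ∫ z, f z *
      dirDeriv (stdVec k) (dirDeriv (stdVec k) fun x => (j x : ℂ)) (x - z) := by
    intro k
    rw [← mollify_dirDeriv_eq hJ hG, dirDeriv_mollify (hJ.dirDeriv _)]
    rfl
  simp only [e1]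
  rw [← integral_finsetSum _ fun k _ => hint k, ← integral_conj, ← integral_const_mul]
  refine integral_congr_ae (Filter.Eventually.of_forall fun z => ?_)
  simp only [fstLaplacian_mollifierFamily hj, map_sum, map_mul, hj.conj_dirDeriv_dirDeriv,
    Finset.mul_sum]
  refine Finset.sum_congr rfl fun k _ => ?_
  ring

/-- The kinetic part of the derivative of a localized mollified scalar product. -/
lemma IsMollifier.norm_kinetic_le (hj : IsMollifier j δ) {η : Pos → ℂ} (hη : IsTestFunction η)
    {S : ℝ} (hS : ∀ k x, ‖dirDeriv (stdVec k) η x‖ ≤ S) {f f' : OneBody}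
    {G G' : Fin 3 → OneBody} (hG : IsWeakGradient f G) (hG' : IsWeakGradient f' G') :
    ‖(∫ x, η x * (mollify (fun x => (j x : ℂ)) f x *
        conj (∑ k, dirDeriv (stdVec k) (mollify (fun x => (j x : ℂ)) (G' k)) x))) -
      ∫ x, η x * ((∑ k, dirDeriv (stdVec k) (mollify (fun x => (j x : ℂ)) (G k)) x) *
        conj (mollify (fun x => (j x : ℂ)) f' x))‖ ≤
      S * ∑ k, (‖f‖ ^ 2 + ‖G' k‖ ^ 2 + ‖f'‖ ^ 2 + ‖G k‖ ^ 2) / 2 := by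
  have hJ := hj.isTestFunction
  obtain ⟨m, hm⟩ : ∃ m : OneBody → Pos → ℂ, m = fun u : OneBody => mollify (fun x => (j x : ℂ)) u :=
    ⟨_, rfl⟩
  have hmc : ∀ u, ContDiff ℝ ((⊤ : ℕ∞) : WithTop ℕ∞) (m u) := fun u => by
    rw [hm]
    exact contDiff_mollify hJ u
  have hmd : ∀ u, Differentiable ℝ (m u) := fun u => (hmc u).differentiable (by simp)
  have hconj : ∀ u, ContDiff ℝ ((⊤ : ℕ∞) : WithTop ℕ∞) (fun x => conj (m u x)) := fun u =>
    Complex.conjCLE.contDiff.comp (hmc u)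
  have hd : ∀ k, dirDeriv (stdVec k) (m f) = m (G k) := fun k => by
    rw [hm]
    exact (dirDeriv_mollify hJ f _).trans (mollify_dirDeriv_eq hJ hG k)
  have hd' : ∀ k, dirDeriv (stdVec k) (m f') = m (G' k) := fun k => by
    rw [hm]
    exact (dirDeriv_mollify hJ f' _).trans (mollify_dirDeriv_eq hJ hG' k)
  have hcd : ∀ {g : Pos → ℂ}, ContDiff ℝ ((⊤ : ℕ∞) : WithTop ℕ∞) g → ∀ v,
      ContDiff ℝ ((⊤ : ℕ∞) : WithTop ℕ∞) (dirDeriv v g) := fun hg v =>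
    (hg.fderiv_right (m := ((⊤ : ℕ∞) : WithTop ℕ∞)) (by simp)).clm_apply contDiff_const
  have hi : ∀ {g : Pos → ℂ}, ContDiff ℝ ((⊤ : ℕ∞) : WithTop ℕ∞) g → ∀ {χ : Pos → ℂ},
      IsTestFunction χ → Integrable (fun x => χ x * g x) volume := fun hg χ hχ =>
    (hχ.mul_left hg).integrable.congr (Filter.Eventually.of_forall fun x => mul_comm _ _)
  have hs : ∀ u, IsTestFunction (fun x => η x * m u x) := fun u => by
    have := hη.mul_left (hmc u)
    simpa only [mul_comm] using this
  have hs' : ∀ u, IsTestFunction (fun x => η x * conj (m u x)) := fun u => by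
    have := hη.mul_left (hconj u)
    simpa only [mul_comm] using this
  have hdη : ∀ k, IsTestFunction (dirDeriv (stdVec k) η) := fun k => hη.dirDeriv _
  -- After one integration by parts the term with both gradients and undifferentiated `η` occurs
  -- identically in `eA` and `eB`. It cancels in the difference, and every surviving term carries a
  -- derivative of `η`.
  have eA : ∀ k, ∫ x, η x * m f x * conj (dirDeriv (stdVec k) (m (G' k)) x) =
      -((∫ x, dirDeriv (stdVec k) η x * (m f x * conj (m (G' k) x))) +
        ∫ x, η x * (m (G k) x * conj (m (G' k) x))) := by
    intro k
    have h := (hs f).integral_mul_dirDeriv_of_contDiff (hconj (G' k)) (stdVec k)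
    rw [dirDeriv_conj (hmd _), dirDeriv_mul hη.differentiable (hmd f), hd] at h
    rw [h, ← integral_add (hi ((hmc f).mul (hconj (G' k))) (hdη k))
      (hi ((hmc (G k)).mul (hconj (G' k))) hη)]
    congr 1
    refine integral_congr_ae (Filter.Eventually.of_forall fun x => ?_)
    ring
  have eB : ∀ k, ∫ x, η x * conj (m f' x) * dirDeriv (stdVec k) (m (G k)) x =
      -((∫ x, dirDeriv (stdVec k) η x * (m (G k) x * conj (m f' x))) +
        ∫ x, η x * (m (G k) x * conj (m (G' k) x))) := by
    intro k
    have h := (hs' f').integral_mul_dirDeriv_of_contDiff (hmc (G k)) (stdVec k)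
    rw [dirDeriv_mul hη.differentiable ((hconj f').differentiable (by simp)),
      dirDeriv_conj (hmd _), hd'] at h
    rw [h, ← integral_add (hi ((hmc (G k)).mul (hconj f')) (hdη k))
      (hi ((hmc (G k)).mul (hconj (G' k))) hη)]
    congr 1
    refine integral_congr_ae (Filter.Eventually.of_forall fun x => ?_)
    ring
  have e1 : ∫ x, η x * (m f x * conj (∑ k, dirDeriv (stdVec k) (m (G' k)) x)) =
      ∑ k, ∫ x, η x * m f x * conj (dirDeriv (stdVec k) (m (G' k)) x) := by
    have hi3 : ∀ k, Integrable (fun x =>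
        η x * m f x * conj (dirDeriv (stdVec k) (m (G' k)) x)) volume := fun k =>
      hi (Complex.conjCLE.contDiff.comp (hcd (hmc (G' k)) (stdVec k))) (hs f)
    rw [← integral_finsetSum _ fun k _ => hi3 k]
    refine integral_congr_ae (Filter.Eventually.of_forall fun x => ?_)
    simp only [map_sum, Finset.mul_sum, mul_assoc]
  have e2 : ∫ x, η x * ((∑ k, dirDeriv (stdVec k) (m (G k)) x) * conj (m f' x)) =
      ∑ k, ∫ x, η x * conj (m f' x) * dirDeriv (stdVec k) (m (G k)) x := by
    rw [← integral_finsetSum _ fun k _ => hi (hcd (hmc (G k)) (stdVec k)) (hs' f')]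
    refine integral_congr_ae (Filter.Eventually.of_forall fun x => ?_)
    simp only [Finset.mul_sum, Finset.sum_mul]
    refine Finset.sum_congr rfl fun k _ => ?_
    ring
  have hsq : ∀ u, Integrable (fun x => ‖m u x‖ ^ 2) volume := fun u => by
    rw [hm]
    exact hj.integrable_norm_mollify_sq u
  have hsqle : ∀ u, ∫ x, ‖m u x‖ ^ 2 ≤ ‖u‖ ^ 2 := fun u => by
    rw [hm]
    exact hj.integral_norm_mollify_sq_le u
  have hS0 : 0 ≤ S := (norm_nonneg _).trans (hS 0 0)
  have hb : ∀ k, ∀ u u' : OneBody, ‖∫ x, dirDeriv (stdVec k) η x * (m u x * conj (m u' x))‖ ≤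
      S * ((‖u‖ ^ 2 + ‖u'‖ ^ 2) / 2) := by
    intro k u u'
    have hi2 := (((hsq u).add (hsq u')).div_const 2).const_mul S
    refine (norm_integral_le_of_norm_le hi2 (Filter.Eventually.of_forall fun x => ?_)).trans ?_
    · rw [norm_mul, norm_mul, RCLike.norm_conj]
      refine mul_le_mul (hS k x) ?_ (by positivity) hS0
      simp only [Pi.add_apply]
      nlinarith [sq_nonneg (‖m u x‖ - ‖m u' x‖)]
    · rw [integral_const_mul, integral_div]
      have h1 := integral_add (hsq u) (hsq u')
      simp only [Pi.add_apply] at h1 ⊢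
      rw [h1]
      have := hsqle u
      have := hsqle u'
      gcongr
  have hfin : (∫ x, η x * (m f x * conj (∑ k, dirDeriv (stdVec k) (m (G' k)) x))) -
      (∫ x, η x * ((∑ k, dirDeriv (stdVec k) (m (G k)) x) * conj (m f' x))) =
      ∑ k, ((∫ x, dirDeriv (stdVec k) η x * (m (G k) x * conj (m f' x))) -
        ∫ x, dirDeriv (stdVec k) η x * (m f x * conj (m (G' k) x))) := by
    rw [e1, e2, ← Finset.sum_sub_distrib]
    refine Finset.sum_congr rfl fun k _ => ?_
    rw [eA, eB]
    ring
  have goal : ‖(∫ x, η x * (m f x * conj (∑ k, dirDeriv (stdVec k) (m (G' k)) x))) -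
      (∫ x, η x * ((∑ k, dirDeriv (stdVec k) (m (G k)) x) * conj (m f' x)))‖ ≤
      S * ∑ k, (‖f‖ ^ 2 + ‖G' k‖ ^ 2 + ‖f'‖ ^ 2 + ‖G k‖ ^ 2) / 2 := by
    rw [hfin, Finset.mul_sum]
    refine (norm_sum_le _ _).trans (Finset.sum_le_sum fun k _ => ?_)
    refine (norm_sub_le _ _).trans ((add_le_add (hb k _ _) (hb k _ _)).trans (le_of_eq ?_))
    ring
  rw [hm] at goal
  exact goal

end Family

end

noncomputable section

/-! ### Oscillation of the potential at the scale of a mollifier -/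

/-- The mean meanOscillation of `U` at the scale of `j`, on the support of `ζ`. -/
def meanOscillation (ζ j U : Pos → ℝ) : ℝ≥0∞ :=
  ∫⁻ x, ENNReal.ofReal (ζ x ^ 2) * ∫⁻ z, ENNReal.ofReal (|U z - U x| * j (x - z))

section Oscillation

variable {ζ j : Pos → ℝ} {δ : ℝ}

lemma IsMollifier.lintegral_sub_left (hj : IsMollifier j δ) (x : Pos) :
    ∫⁻ z, ENNReal.ofReal (j (x - z)) = 1 := by
  rw [← ofReal_integral_eq_lintegral_ofReal (hj.integrable_sub_left x)
    (Filter.Eventually.of_forall fun z => hj.nonneg _), hj.integral_sub_left, ENNReal.ofReal_one]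

/-- The commutator of multiplication by `U` with the mollifier is `∫ f(z) (U(z) - U(x)) j(x - z)
dz`; boundedness of `f` leaves only the oscillation of `U`. -/
lemma IsMollifier.norm_mollify_mul_sub_le (hj : IsMollifier j δ) {U : Pos → ℝ}
    (hU : LocallySqInt U) {f : OneBody} {B : ℝ} (hB0 : 0 ≤ B) (hB : ∀ᵐ z, ‖f z‖ ≤ B) (x : Pos) :
    ENNReal.ofReal ‖mollify (fun x => (j x : ℂ)) (fun z => (U z : ℂ) * f z) x -
        (U x : ℂ) * mollify (fun x => (j x : ℂ)) f x‖ ≤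
      ENNReal.ofReal B * ∫⁻ z, ENNReal.ofReal (|U z - U x| * j (x - z)) := by
  have hJ := hj.isTestFunction
  have i1 : Integrable (fun z => f z * ((U z : ℂ) * (j (x - z) : ℂ))) volume :=
    (Lp.memLp f).integrable_mul (hU.memLp_mul (hJ.comp_sub_left x))
  have i2 : Integrable (fun z => f z * (j (x - z) : ℂ)) volume :=
    (Lp.memLp f).integrable_mul ((hJ.comp_sub_left x).memLp 2)
  have e : mollify (fun x => (j x : ℂ)) (fun z => (U z : ℂ) * f z) x -
      (U x : ℂ) * mollify (fun x => (j x : ℂ)) f x =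
      ∫ z, f z * (((U z - U x : ℝ) : ℂ) * (j (x - z) : ℂ)) := by
    simp only [mollify]
    have e1 : ∀ z, (U z : ℂ) * f z * (j (x - z) : ℂ) = f z * ((U z : ℂ) * (j (x - z) : ℂ)) :=
      fun z => by ring
    simp only [e1]
    rw [← integral_const_mul, ← integral_sub i1 (i2.const_mul _)]
    refine integral_congr_ae (Filter.Eventually.of_forall fun z => ?_)
    simp only [Complex.ofReal_sub]
    ring
  rw [e, ofReal_norm, ← lintegral_const_mul' _ _ ENNReal.ofReal_ne_top]
  refine (enorm_integral_le_lintegral_enorm _).trans (lintegral_mono_ae ?_)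
  filter_upwards [hB] with z hz
  rw [← ofReal_norm, ← ENNReal.ofReal_mul hB0]
  refine ENNReal.ofReal_le_ofReal ?_
  rw [norm_mul, norm_mul, Complex.norm_real, Complex.norm_real, Real.norm_of_nonneg (hj.nonneg _),
    Real.norm_eq_abs]
  exact mul_le_mul_of_nonneg_right hz (mul_nonneg (abs_nonneg _) (hj.nonneg _))

/-- The potential part of the derivative of a localized mollified scalar product. -/
lemma IsMollifier.norm_potential_le (hj : IsMollifier j δ) {U : Pos → ℝ}
    (hU : LocallySqInt U) {f f' : OneBody} {B : ℝ} (hB0 : 0 ≤ B) (hB : ∀ᵐ z, ‖f z‖ ≤ B)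
    (hB' : ∀ᵐ z, ‖f' z‖ ≤ B) {ε : ℝ} (hε : 0 ≤ ε) (ho : meanOscillation ζ j U ≤ ENNReal.ofReal ε) :
    ‖∫ x, (ζ x : ℂ) ^ 2 *
      (mollify (fun x => (j x : ℂ)) f x *
          conj (mollify (fun x => (j x : ℂ)) (fun z => (U z : ℂ) * f' z) x) -
        mollify (fun x => (j x : ℂ)) (fun z => (U z : ℂ) * f z) x *
          conj (mollify (fun x => (j x : ℂ)) f' x))‖ ≤ 2 * B ^ 2 * ε := by
  refine (norm_integral_le_lintegral_norm _).trans (ENNReal.toReal_le_of_le_ofReal (by positivity) ?_)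
  rw [ENNReal.ofReal_mul (by positivity)]
  refine le_trans ?_ (mul_le_mul_right ho _)
  unfold meanOscillation
  rw [← lintegral_const_mul' _ _ ENNReal.ofReal_ne_top]
  refine lintegral_mono fun x => ?_
  have h1 := hj.norm_mollify_mul_sub_le hU hB0 hB x
  have h2 := hj.norm_mollify_mul_sub_le hU hB0 hB' x
  have h3 := hj.norm_mollify_le hB x
  have h4 := hj.norm_mollify_le hB' x
  generalize mollify (fun x => (j x : ℂ)) f x = c at *
  generalize mollify (fun x => (j x : ℂ)) f' x = c' at *
  generalize mollify (fun x => (j x : ℂ)) (fun z => (U z : ℂ) * f z) x = u at *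
  generalize mollify (fun x => (j x : ℂ)) (fun z => (U z : ℂ) * f' z) x = u' at *
  generalize (∫⁻ z, ENNReal.ofReal (|U z - U x| * j (x - z))) = o at *
  -- Because `U x` is real, the products `U x * c * conj c'` cancel and only the two commutators
  -- survive.
  have e : c * conj u' - u * conj c' =
      c * conj (u' - (U x : ℂ) * c') - (u - (U x : ℂ) * c) * conj c' := by
    simp only [map_sub, map_mul, Complex.conj_ofReal]
    ring
  have hle : ‖(ζ x : ℂ) ^ 2 * (c * conj u' - u * conj c')‖ ≤
      ζ x ^ 2 * (B * (‖u' - (U x : ℂ) * c'‖ + ‖u - (U x : ℂ) * c‖)) := by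
    rw [e, norm_mul, norm_pow, Complex.norm_real, Real.norm_eq_abs, sq_abs]
    refine mul_le_mul_of_nonneg_left ((norm_sub_le _ _).trans ?_) (sq_nonneg _)
    rw [norm_mul, norm_mul, RCLike.norm_conj, RCLike.norm_conj, mul_add]
    refine add_le_add (mul_le_mul_of_nonneg_right h3 (norm_nonneg _)) ?_
    rw [mul_comm]
    exact mul_le_mul_of_nonneg_right h4 (norm_nonneg _)
  refine (ENNReal.ofReal_le_ofReal hle).trans ?_
  rw [ENNReal.ofReal_mul (sq_nonneg _), ENNReal.ofReal_mul hB0,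
    ENNReal.ofReal_add (norm_nonneg _) (norm_nonneg _)]
  have h5 : ENNReal.ofReal (2 * B ^ 2) = 2 * (ENNReal.ofReal B * ENNReal.ofReal B) := by
    rw [ENNReal.ofReal_mul (by norm_num), pow_two, ENNReal.ofReal_mul hB0]
    simp
  rw [h5]
  calc _ ≤ ENNReal.ofReal (ζ x ^ 2) *
        (ENNReal.ofReal B * (ENNReal.ofReal B * o + ENNReal.ofReal B * o)) := by gcongr
    _ = _ := by ring

/-- The mollifier lives on `‖x - z‖ < δ`, where a function with Lipschitz constant `L` varies by at
most `L δ`. -/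
lemma IsMollifier.lintegral_abs_add_sub_le (hj : IsMollifier j δ) (hδ : 0 ≤ δ) {w V : Pos → ℝ}
    {L : ℝ} (hL : 0 ≤ L) (hV : ∀ z x, |V z - V x| ≤ L * ‖z - x‖) (x : Pos) :
    ∫⁻ z, ENNReal.ofReal (|w z + V z - (w x + V x)| * j (x - z)) ≤
      (∫⁻ z, ENNReal.ofReal (|w z - w x| * j (x - z))) + ENNReal.ofReal (L * δ) := by
  have hjm : Measurable j := hj.contDiff.continuous.measurable
  have hLδ : 0 ≤ L * δ := mul_nonneg hL hδ
  have h1 : ∀ z, ENNReal.ofReal (|w z + V z - (w x + V x)| * j (x - z)) ≤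
      ENNReal.ofReal (|w z - w x| * j (x - z)) +
        ENNReal.ofReal (L * δ) * ENNReal.ofReal (j (x - z)) := by
    intro z
    have h0 := hj.nonneg (x - z)
    rw [← ENNReal.ofReal_mul hLδ, ← ENNReal.ofReal_add (mul_nonneg (abs_nonneg _) h0)
      (mul_nonneg hLδ h0)]
    refine ENNReal.ofReal_le_ofReal ?_
    rw [← add_mul]
    by_cases hz : δ ≤ ‖x - z‖
    · rw [hj.support _ hz, mul_zero, mul_zero]
    · push Not at hz
      refine mul_le_mul_of_nonneg_right ?_ h0
      have h2 : |w z + V z - (w x + V x)| ≤ |w z - w x| + |V z - V x| := by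
        rw [add_sub_add_comm]
        exact abs_add_le _ _
      refine h2.trans (add_le_add le_rfl ((hV z x).trans ?_))
      rw [norm_sub_rev]
      exact mul_le_mul_of_nonneg_left hz.le hL
  refine (lintegral_mono h1).trans ?_
  have hm : Measurable fun z => ENNReal.ofReal (L * δ) * ENNReal.ofReal (j (x - z)) :=
    (hjm.comp (measurable_const.sub measurable_id)).ennreal_ofReal.const_mul _
  rw [lintegral_add_right _ hm, lintegral_const_mul' _ _ ENNReal.ofReal_ne_top,
    hj.lintegral_sub_left, mul_one]

/-- This separates the time-independent field `w` from the mean field. The latter changes with time,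
but a common Lipschitz constant makes its contribution small uniformly in time. -/
lemma meanOscillation_add_le (hj : IsMollifier j δ) (hδ : 0 ≤ δ) (hζ : Continuous ζ)
    (hζc : HasCompactSupport ζ) {w V : Pos → ℝ} {L : ℝ} (hL : 0 ≤ L)
    (hV : ∀ z x, |V z - V x| ≤ L * ‖z - x‖) :
    meanOscillation ζ j (fun x => w x + V x) ≤
      meanOscillation ζ j w + ENNReal.ofReal (L * δ * ∫ x, ζ x ^ 2) := by
  have hc2 : HasCompactSupport fun x => ζ x ^ 2 :=
    hζc.comp_left (g := fun r : ℝ => r ^ 2) (zero_pow two_ne_zero)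
  have hi : Integrable (fun x => ζ x ^ 2) volume :=
    (hζ.pow 2).integrable_of_hasCompactSupport hc2
  have hm : Measurable fun x => ENNReal.ofReal (ζ x ^ 2) * ENNReal.ofReal (L * δ) :=
    (hζ.pow 2).measurable.ennreal_ofReal.mul_const _
  calc meanOscillation ζ j (fun x => w x + V x) ≤
      ∫⁻ x, (ENNReal.ofReal (ζ x ^ 2) * (∫⁻ z, ENNReal.ofReal (|w z - w x| * j (x - z))) +
        ENNReal.ofReal (ζ x ^ 2) * ENNReal.ofReal (L * δ)) := by
        refine lintegral_mono fun x => ?_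
        rw [← mul_add]
        exact mul_le_mul_right (hj.lintegral_abs_add_sub_le hδ hL hV x) _
    _ = meanOscillation ζ j w + ∫⁻ x, ENNReal.ofReal (ζ x ^ 2) * ENNReal.ofReal (L * δ) :=
        lintegral_add_right _ hm
    _ = _ := by
        rw [lintegral_mul_const' _ _ ENNReal.ofReal_ne_top,
          ← ofReal_integral_eq_lintegral_ofReal hi
            (Filter.Eventually.of_forall fun x => sq_nonneg _),
          mul_comm (ENNReal.ofReal (∫ x, ζ x ^ 2)), ← ENNReal.ofReal_mul (mul_nonneg hL hδ)]

/-- Strong continuity of translations on `L¹`. -/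
lemma exists_lintegral_translate_sub_le (W : Lp ℝ 1 (volume : Measure Pos)) {ε : ℝ} (hε : 0 < ε) :
    ∃ δ > 0, ∀ a : Pos, ‖a‖ < δ → ∫⁻ x, ENNReal.ofReal |W (x - a) - W x| ≤ ENNReal.ofReal ε := by
  have hp : Fact ((1 : ℝ≥0∞) ≠ ⊤) := ⟨ENNReal.one_ne_top⟩
  have hc : Continuous fun a : Pos => (DomAddAct.mk a) +ᵥ W :=
    (continuous_id.vadd continuous_const).comp DomAddAct.mkHomeomorph.continuous
  obtain ⟨δ, hδ, h⟩ := Metric.continuous_iff.1 hc 0 ε hε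
  refine ⟨δ, hδ, fun a ha => ?_⟩
  have h1 := h (-a) (by rwa [dist_zero_right, norm_neg])
  have h0 : (DomAddAct.mk (0 : Pos)) +ᵥ W = W := zero_vadd _ W
  rw [h0, Lp.dist_def] at h1
  have hae := DomAddAct.vadd_Lp_ae_eq (DomAddAct.mk (-a)) W
  have e : eLpNorm (⇑((DomAddAct.mk (-a)) +ᵥ W) - ⇑W) 1 volume =
      ∫⁻ x, ENNReal.ofReal |W (x - a) - W x| := by
    rw [eLpNorm_one_eq_lintegral_enorm]
    refine lintegral_congr_ae ?_
    filter_upwards [hae] with x hx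
    rw [Pi.sub_apply, hx, ← ofReal_norm, Real.norm_eq_abs]
    congr 4
    simp only [Equiv.symm_apply_apply, vadd_eq_add]
    abel_nf
  have hfin : eLpNorm (⇑((DomAddAct.mk (-a)) +ᵥ W) - ⇑W) 1 volume ≠ ⊤ :=
    ((Lp.memLp _).sub (Lp.memLp _)).2.ne
  rw [← e]
  exact (ENNReal.le_ofReal_iff_toReal_le hfin hε.le).2 h1.le

/-- The mean oscillation of a locally square integrable function tends to zero. -/
lemma exists_meanOscillation_le (hζ1 : ∀ x, ζ x ^ 2 ≤ 1) (hζc : HasCompactSupport ζ) {w : Pos → ℝ}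
    (hw : LocallySqInt w) {ε : ℝ} (hε : 0 < ε) :
    ∃ δ₀ > 0, ∀ δ < δ₀, ∀ j, IsMollifier j δ → meanOscillation ζ j w ≤ ENNReal.ofReal ε := by
  -- Cutting `w` off outside a ball that exceeds the support of `ζ` by `1` makes it integrable, and
  -- for `δ < 1` the mollifier does not see the cut.
  obtain ⟨R, hR⟩ := hζc.isCompact.isBounded.subset_closedBall (0 : Pos)
  have hK : IsCompact (Metric.closedBall (0 : Pos) (R + 1)) := isCompact_closedBall _ _
  have hKm : MeasurableSet (Metric.closedBall (0 : Pos) (R + 1)) := hK.measurableSet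
  have hfin : IsFiniteMeasure ((volume : Measure Pos).restrict (Metric.closedBall 0 (R + 1))) :=
    ⟨by rw [Measure.restrict_apply_univ]; exact hK.measure_lt_top⟩
  have hw1 : MemLp ((Metric.closedBall (0 : Pos) (R + 1)).indicator w) 1 volume :=
    (memLp_indicator_iff_restrict hKm).2 ((hw _ hK).mono_exponent (by norm_num))
  obtain ⟨W, hW⟩ : ∃ W : Lp ℝ 1 (volume : Measure Pos), W = hw1.toLp _ := ⟨_, rfl⟩
  have hWae : ∀ᵐ z, z ∈ Metric.closedBall (0 : Pos) (R + 1) → W z = w z := by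
    filter_upwards [hw1.coeFn_toLp] with z hz hzm
    rw [hW, hz, Set.indicator_of_mem hzm]
  obtain ⟨δ₁, hδ₁, h⟩ := exists_lintegral_translate_sub_le W hε
  refine ⟨min δ₁ 1, by positivity, fun δ hδ j hj => ?_⟩
  have hjm : Measurable j := hj.contDiff.continuous.measurable
  have hWm : Measurable W := (Lp.stronglyMeasurable W).measurable
  have step1 : meanOscillation ζ j w ≤
      ∫⁻ x, ∫⁻ z, ENNReal.ofReal (|W z - W x|) * ENNReal.ofReal (j (x - z)) := by
    refine lintegral_mono_ae ?_
    filter_upwards [hWae] with x hx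
    by_cases hxs : x ∈ tsupport ζ
    · have hxR : ‖x‖ ≤ R := by simpa using hR hxs
      have hx1 := hx (by simpa using hxR.trans (by linarith))
      refine le_trans (mul_le_of_le_one_left zero_le ?_) (lintegral_mono_ae ?_)
      · rw [← ENNReal.ofReal_one]
        exact ENNReal.ofReal_le_ofReal (hζ1 x)
      · filter_upwards [hWae] with z hz
        by_cases hzx : δ ≤ ‖x - z‖
        · simp [hj.support _ hzx]
        · push Not at hzx
          have hz1 : ‖z‖ ≤ R + 1 := by
            have h2 : ‖z‖ ≤ ‖x‖ + ‖x - z‖ := by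
              have := norm_sub_le x (x - z)
              rwa [sub_sub_cancel] at this
            have := min_le_right δ₁ 1
            linarith
          rw [hx1, hz (by simpa using hz1), ← ENNReal.ofReal_mul (abs_nonneg _)]
    · simp [image_eq_zero_of_notMem_tsupport hxs]
  refine step1.trans ?_
  -- The substitution `a = x - z` exhibits translates of `W`; Tonelli then allows integration over
  -- `x` at a fixed shift of size less than `δ`.
  have step2 : ∀ x, ∫⁻ z, ENNReal.ofReal (|W z - W x|) * ENNReal.ofReal (j (x - z)) =
      ∫⁻ a, ENNReal.ofReal (|W (x - a) - W x|) * ENNReal.ofReal (j a) := by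
    intro x
    rw [← lintegral_sub_left_eq_self _ x]
    simp only [sub_sub_cancel]
  simp only [step2]
  rw [lintegral_lintegral_swap]
  · calc _ ≤ ∫⁻ a, ENNReal.ofReal ε * ENNReal.ofReal (j a) := by
          refine lintegral_mono fun a => ?_
          rw [lintegral_mul_const' _ _ ENNReal.ofReal_ne_top]
          by_cases ha : δ ≤ ‖a‖
          · simp [hj.support _ ha]
          · push Not at ha
            exact mul_le_mul_left (h a (ha.trans (hδ.trans_le (min_le_left _ _)))) _
      _ = ENNReal.ofReal ε := by
          rw [lintegral_const_mul' _ _ ENNReal.ofReal_ne_top,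
            ← ofReal_integral_eq_lintegral_ofReal hj.integrable
              (Filter.Eventually.of_forall fun z => hj.nonneg _), hj.integral, ENNReal.ofReal_one,
            mul_one]
  · refine Measurable.aemeasurable ?_
    have h1 : Measurable fun p : Pos × Pos => |W (p.1 - p.2) - W p.1| :=
      ((hWm.comp (measurable_fst.sub measurable_snd)).sub (hWm.comp measurable_fst)).abs
    exact h1.ennreal_ofReal.mul (hjm.comp measurable_snd).ennreal_ofReal

end Oscillation

/-! ### Regularity of the mean field -/

/-- The difference is `(‖b‖ - ‖a‖) ‖a‖⁻¹ ‖b‖⁻¹`, and the product of the inverses is at most the sum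
of their squares. With the convention `0⁻¹ = 0` equality holds when `a` or `b` vanishes, so no point
has to be excluded from the integrals below. -/
lemma abs_inv_norm_sub_le (a b : Pos) : |‖a‖⁻¹ - ‖b‖⁻¹| ≤ ‖a - b‖ * (‖a‖⁻¹ ^ 2 + ‖b‖⁻¹ ^ 2) := by
  have key : ∀ a b : Pos, a = 0 → |‖a‖⁻¹ - ‖b‖⁻¹| ≤ ‖a - b‖ * (‖a‖⁻¹ ^ 2 + ‖b‖⁻¹ ^ 2) := by
    intro a b ha
    subst ha
    rcases eq_or_ne b 0 with rfl | hb
    · simp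
    · have : ‖b‖ ≠ 0 := norm_ne_zero_iff.2 hb
      simp only [norm_zero, inv_zero, zero_sub, abs_neg, norm_neg, abs_inv, abs_norm]
      apply le_of_eq
      field_simp
      simp
  rcases eq_or_ne a 0 with ha | ha
  · exact key a b ha
  rcases eq_or_ne b 0 with hb | hb
  · rw [abs_sub_comm, norm_sub_rev, add_comm]
    exact key b a hb
  have ha' : 0 < ‖a‖ := norm_pos_iff.2 ha
  have hb' : 0 < ‖b‖ := norm_pos_iff.2 hb
  have e : ‖a‖⁻¹ - ‖b‖⁻¹ = (‖b‖ - ‖a‖) * (‖a‖⁻¹ * ‖b‖⁻¹) := by field_simp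
  rw [e, abs_mul, abs_of_nonneg (by positivity : 0 ≤ ‖a‖⁻¹ * ‖b‖⁻¹)]
  refine mul_le_mul ?_ ?_ (by positivity) (norm_nonneg _)
  · rw [abs_sub_comm]
    exact abs_norm_sub_norm_le a b
  · nlinarith [sq_nonneg (‖a‖⁻¹ - ‖b‖⁻¹), sq_nonneg (‖a‖⁻¹), sq_nonneg (‖b‖⁻¹)]

/-- The Coulomb mean field is Lipschitz continuous. -/
lemma abs_meanField_coulomb_sub_le {N : ℕ} (c : ℝ) (φ : Fin N → OneBody) {Q : ℝ} (hQ : 0 ≤ Q)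
    (hb : ∀ y, ∫⁻ x, ENNReal.ofReal (coulomb 1 (y - x) ^ 2 * density φ x) ≤ ENNReal.ofReal Q)
    (z x : Pos) :
    |meanField (coulomb c) φ z - meanField (coulomb c) φ x| ≤ |c| * (2 * Q) * ‖z - x‖ := by
  have hm : ∀ y, meanField (coulomb c) φ y = c * ∫ a, coulomb 1 (y - a) * density φ a := by
    intro y
    rw [meanField, ← integral_const_mul]
    refine integral_congr_ae (Filter.Eventually.of_forall fun a => ?_)
    simp only [coulomb]
    ring
  have hi := fun y => integrable_mul_density (measurable_coulomb 1) hb y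
  have hi2 := fun y => integrable_sq_mul_density (measurable_coulomb 1) hb y
  have hq := fun y => integral_sq_mul_density_le (v := coulomb 1) hQ hb y
  rw [hm, hm, ← mul_sub, ← integral_sub (hi z) (hi x), abs_mul, mul_assoc]
  refine mul_le_mul_of_nonneg_left ?_ (abs_nonneg c)
  rw [← Real.norm_eq_abs]
  have h1 := norm_integral_le_of_norm_le (((hi2 z).add (hi2 x)).const_mul ‖z - x‖)
    (f := fun a => coulomb 1 (z - a) * density φ a - coulomb 1 (x - a) * density φ a)
    (Filter.Eventually.of_forall fun a => by
      have h2 := abs_inv_norm_sub_le (z - a) (x - a)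
      have h3 := density_nonneg φ a
      rw [sub_sub_sub_cancel_right] at h2
      rw [← sub_mul, norm_mul, Real.norm_of_nonneg h3, Real.norm_eq_abs, Pi.add_apply, ← add_mul,
        ← mul_assoc]
      refine mul_le_mul_of_nonneg_right ?_ h3
      simpa only [coulomb, one_mul] using h2)
  refine h1.trans ?_
  rw [integral_const_mul]
  have h4 := integral_add (hi2 z) (hi2 x)
  simp only [Pi.add_apply] at h4 ⊢
  rw [h4, mul_comm]
  refine mul_le_mul_of_nonneg_right ?_ (norm_nonneg _)
  linarith [hq z, hq x]

end

/-! ### Time derivatives of localized mollified scalar products -/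

noncomputable section

/-- Derivatives are available at interior times only. The mean value inequality between `s` and `t`
is passed to the limit `s → 0` by one-sided continuity. -/
lemma norm_sub_le_of_hasDerivAt_le {f : ℝ → ℂ} {τ C : ℝ} (hf : ContinuousWithinAt f (Set.Ioi 0) 0)
    (hd : ∀ t ∈ Set.Ioo 0 τ, ∃ D, HasDerivAt f D t ∧ ‖D‖ ≤ C) {t : ℝ} (ht : t ∈ Set.Ioo 0 τ) :
    ‖f t - f 0‖ ≤ C * t := by
  choose! D hD hDC using hd
  have h1 : ∀ s ∈ Set.Ioo 0 t, ‖f t - f s‖ ≤ C * ‖t - s‖ := fun s hs =>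
    (convex_Ioo 0 τ).norm_image_sub_le_of_norm_hasDerivWithin_le
      (fun x hx => (hD x hx).hasDerivWithinAt) hDC ⟨hs.1, hs.2.trans ht.2⟩ ht
  have h2 : Filter.Tendsto (fun s => ‖f t - f s‖) (nhdsWithin 0 (Set.Ioi 0)) (nhds ‖f t - f 0‖) :=
    (tendsto_const_nhds.sub hf).norm
  have h3 : Filter.Tendsto (fun s => C * ‖t - s‖) (nhdsWithin 0 (Set.Ioi 0)) (nhds (C * t)) := by
    have : ContinuousAt (fun s : ℝ => C * ‖t - s‖) 0 := by fun_prop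
    have h4 := this.tendsto
    simp only [sub_zero, Real.norm_of_nonneg ht.1.le] at h4
    exact h4.mono_left nhdsWithin_le_nhds
  refine le_of_tendsto_of_tendsto h2 h3 ?_
  filter_upwards [Ioo_mem_nhdsGT ht.1] with s hs using h1 s hs

section FstSchrodinger

variable {Y : Type*} [NormedAddCommGroup Y] [NormedSpace ℝ Y] [MeasureSpace Y]
  [BorelSpace Y] [SecondCountableTopology Y] [SFinite (volume : Measure Y)]
  [IsFiniteMeasureOnCompacts (volume : Measure Y)]

lemma memLp_fstSchrodinger {U : Pos → ℝ} (hU : LocallySqInt U) {F : Pos × Y → ℂ}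
    (hF : IsTestFunction F) : MemLp (fstSchrodinger U F) 2 volume :=
  ((hF.fstLaplacian.memLp 2).neg).add ((hU.comp_fst (Y := Y)).memLp_mul hF)

end FstSchrodinger

section Localized

variable {N : ℕ} {w v : Pos → ℝ} {T : EReal} {φ : ℝ → Fin N → OneBody} {τ M : ℝ}
  {ζ j : Pos → ℝ} {δ : ℝ}

lemma partialInner_fstSchrodinger_mollifierFamily (hj : IsMollifier j δ)
    (hζ : ContDiff ℝ ((⊤ : ℕ∞) : WithTop ℕ∞) ζ) (hζc : HasCompactSupport ζ) {U : Pos → ℝ}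
    (hU : LocallySqInt U) {f : OneBody} {G : Fin 3 → OneBody} (hG : IsWeakGradient f G) (x : Pos) :
    partialInner f (fstSchrodinger U (mollifierFamily ζ j)) x = (ζ x : ℂ) *
      conj (mollify (fun x => (j x : ℂ)) (fun z => (U z : ℂ) * f z) x -
        ∑ k, dirDeriv (stdVec k) (mollify (fun x => (j x : ℂ)) (G k)) x) := by
  have hF := isTestFunction_mollifierFamily hj hζ hζc
  have i1 : Integrable (fun z => conj (f z) * fstLaplacian (mollifierFamily ζ j) (z, x)) volume :=
    (Lp.memLp f).star.integrable_mul ((hF.fstLaplacian.section_fst x).memLp 2)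
  have i2 : Integrable (fun z => conj (f z) * ((U z : ℂ) * mollifierFamily ζ j (z, x))) volume :=
    (Lp.memLp f).star.integrable_mul (hU.memLp_mul (hF.section_fst x))
  have e1 : partialInner f (fstSchrodinger U (mollifierFamily ζ j)) x =
      -(partialInner f (fstLaplacian (mollifierFamily ζ j)) x) +
        ∫ z, conj (f z) * ((U z : ℂ) * mollifierFamily ζ j (z, x)) := by
    simp only [partialInner]
    have i3 : Integrable (fun z => -(conj (f z) * fstLaplacian (mollifierFamily ζ j) (z, x)))
      volume := i1.neg
    rw [← integral_neg, ← integral_add i3 i2]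
    refine integral_congr_ae (Filter.Eventually.of_forall fun z => ?_)
    simp only [fstSchrodinger]
    ring
  have e2 : ∫ z, conj (f z) * ((U z : ℂ) * mollifierFamily ζ j (z, x)) =
      (ζ x : ℂ) * conj (mollify (fun x => (j x : ℂ)) (fun z => (U z : ℂ) * f z) x) := by
    simp only [mollifierFamily, mollify]
    rw [← integral_conj, ← integral_const_mul]
    refine integral_congr_ae (Filter.Eventually.of_forall fun z => ?_)
    simp only [map_mul, Complex.conj_ofReal]
    ring
  rw [e1, e2, partialInner_fstLaplacian_mollifierFamily hj hG, map_sub]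
  ring

set_option maxHeartbeats 800000 in
/-- The commutator of the one-particle Schrödinger operator with a localized mollifier. -/
lemma IsMollifier.norm_inner_sub_inner_le (hj : IsMollifier j δ)
    (hζ : ContDiff ℝ ((⊤ : ℕ∞) : WithTop ℕ∞) ζ) (hζc : HasCompactSupport ζ)
    {S : ℝ} (hS : ∀ k x, ‖dirDeriv (stdVec k) (fun x => ((ζ x : ℂ)) ^ 2) x‖ ≤ S)
    {U : Pos → ℝ} (hU : LocallySqInt U) {f f' : OneBody} {G G' : Fin 3 → OneBody}
    (hG : IsWeakGradient f G) (hG' : IsWeakGradient f' G') {A B ε : ℝ}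
    (hGA : ∑ k, ‖G k‖ ^ 2 ≤ A) (hGA' : ∑ k, ‖G' k‖ ^ 2 ≤ A) (hfM : ‖f‖ ≤ M) (hfM' : ‖f'‖ ≤ M)
    (hB0 : 0 ≤ B) (hfB : ∀ᵐ z, ‖f z‖ ≤ B) (hfB' : ∀ᵐ z, ‖f' z‖ ≤ B) (hε : 0 ≤ ε)
    (ho : meanOscillation ζ j U ≤ ENNReal.ofReal ε)
    (hFL : MemLp (mollifierFamily ζ j) 2 volume)
    (hHL : MemLp (fstSchrodinger U (mollifierFamily ζ j)) 2 volume) :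
    ‖inner ℂ (ContinuousLinearMap.adjoint (tensor (X := Pos) f) (hFL.toLp _))
        (ContinuousLinearMap.adjoint (tensor (X := Pos) f') (hHL.toLp _)) -
      inner ℂ (ContinuousLinearMap.adjoint (tensor (X := Pos) f) (hHL.toLp _))
        (ContinuousLinearMap.adjoint (tensor (X := Pos) f') (hFL.toLp _))‖ ≤
      S * (3 * M ^ 2 + A) + 2 * B ^ 2 * ε := by
  have hint : ∀ a b : SqInt Pos, Integrable (fun x => conj (a x) * b x) volume := fun a b =>
    (L2.integrable_inner (𝕜 := ℂ) a b).congr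
      (Filter.Eventually.of_forall fun x => RCLike.inner_apply' _ _)
  have hD1 := hint (ContinuousLinearMap.adjoint (tensor (X := Pos) f) (hFL.toLp _))
    (ContinuousLinearMap.adjoint (tensor (X := Pos) f') (hHL.toLp _))
  have hD2 := hint (ContinuousLinearMap.adjoint (tensor (X := Pos) f) (hHL.toLp _))
    (ContinuousLinearMap.adjoint (tensor (X := Pos) f') (hFL.toLp _))
  have haF := fun u => adjoint_tensor_coeFn_of_ae u hFL.coeFn_toLp
  have haH := fun u => adjoint_tensor_coeFn_of_ae u hHL.coeFn_toLp
  have eH := partialInner_fstSchrodinger_mollifierFamily hj hζ hζc hU hG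
  have eH' := partialInner_fstSchrodinger_mollifierFamily hj hζ hζc hU hG'
  have hpot := hj.norm_potential_le hU hB0 hfB hfB' hε ho
  have hη : IsTestFunction (fun x => (ζ x : ℂ) ^ 2) :=
    ⟨(Complex.ofRealCLM.contDiff.comp hζ).pow 2,
      hζc.comp_left (g := fun r : ℝ => (r : ℂ) ^ 2) (by simp)⟩
  have hkin := hj.norm_kinetic_le hη hS hG hG'
  have hJ := hj.isTestFunction
  have hcd : ∀ {g : Pos → ℂ}, ContDiff ℝ ((⊤ : ℕ∞) : WithTop ℕ∞) g → ∀ v,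
      ContDiff ℝ ((⊤ : ℕ∞) : WithTop ℕ∞) (dirDeriv v g) := fun hg v =>
    (hg.fderiv_right (m := ((⊤ : ℕ∞) : WithTop ℕ∞)) (by simp)).clm_apply contDiff_const
  have hsm : ∀ G : Fin 3 → OneBody, ContDiff ℝ ((⊤ : ℕ∞) : WithTop ℕ∞)
      (fun x => ∑ k, dirDeriv (stdVec k) (mollify (fun x => (j x : ℂ)) (G k)) x) := fun G =>
    ContDiff.sum fun k _ => hcd (contDiff_mollify hJ (G k)) _
  have hm := contDiff_mollify hJ
  have i1 : Integrable (fun x => (ζ x : ℂ) ^ 2 * (mollify (fun x => (j x : ℂ)) f x *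
      conj (∑ k, dirDeriv (stdVec k) (mollify (fun x => (j x : ℂ)) (G' k)) x))) volume :=
    (hη.mul_left ((hm f).mul (Complex.conjCLE.contDiff.comp (hsm G')))).integrable.congr
      (Filter.Eventually.of_forall fun x => mul_comm _ _)
  have i2 : Integrable (fun x => (ζ x : ℂ) ^ 2 *
      ((∑ k, dirDeriv (stdVec k) (mollify (fun x => (j x : ℂ)) (G k)) x) *
      conj (mollify (fun x => (j x : ℂ)) f' x))) volume :=
    (hη.mul_left ((hsm G).mul (Complex.conjCLE.contDiff.comp (hm f')))).integrable.congr
      (Filter.Eventually.of_forall fun x => mul_comm _ _)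
  -- Pointwise, the difference is `ζ²` times the potential commutator minus `ζ²` times the kinetic
  -- commutator.
  have hDae : (fun x => conj ((ContinuousLinearMap.adjoint (tensor (X := Pos) f) (hFL.toLp _)) x) *
        (ContinuousLinearMap.adjoint (tensor (X := Pos) f') (hHL.toLp _)) x -
      conj ((ContinuousLinearMap.adjoint (tensor (X := Pos) f) (hHL.toLp _)) x) *
        (ContinuousLinearMap.adjoint (tensor (X := Pos) f') (hFL.toLp _)) x) =ᵐ[volume]
      fun x => (ζ x : ℂ) ^ 2 *
        (mollify (fun x => (j x : ℂ)) f x *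
            conj (mollify (fun x => (j x : ℂ)) (fun z => (U z : ℂ) * f' z) x) -
          mollify (fun x => (j x : ℂ)) (fun z => (U z : ℂ) * f z) x *
            conj (mollify (fun x => (j x : ℂ)) f' x)) -
        ((ζ x : ℂ) ^ 2 * (mollify (fun x => (j x : ℂ)) f x *
          conj (∑ k, dirDeriv (stdVec k) (mollify (fun x => (j x : ℂ)) (G' k)) x)) -
        (ζ x : ℂ) ^ 2 * ((∑ k, dirDeriv (stdVec k) (mollify (fun x => (j x : ℂ)) (G k)) x) *
          conj (mollify (fun x => (j x : ℂ)) f' x))) := by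
    filter_upwards [haF f, haF f', haH f, haH f'] with x h1 h2 h3 h4
    rw [h1, h2, h3, h4, eH, eH', partialInner_mollifierFamily, partialInner_mollifierFamily]
    simp only [map_mul, map_sub, Complex.conj_conj, Complex.conj_ofReal]
    ring
  -- Integrability of the potential part is read off from the whole integrand and the smooth,
  -- compactly supported kinetic part.
  have hP := (((hD1.sub hD2).congr hDae).add (i1.sub i2))
  have hP' : Integrable (fun x => (ζ x : ℂ) ^ 2 *
        (mollify (fun x => (j x : ℂ)) f x *
            conj (mollify (fun x => (j x : ℂ)) (fun z => (U z : ℂ) * f' z) x) -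
          mollify (fun x => (j x : ℂ)) (fun z => (U z : ℂ) * f z) x *
            conj (mollify (fun x => (j x : ℂ)) f' x))) volume :=
    hP.congr (Filter.Eventually.of_forall fun x => by
      simp only [Pi.add_apply, Pi.sub_apply]
      ring)
  have hi12 := i1.sub i2
  have efin := integral_congr_ae hDae
  have e12 := integral_sub i1 i2
  have e13 := integral_sub hP' hi12
  simp only [Pi.sub_apply] at e13
  rw [integral_sub hD1 hD2, e13, e12, ← inner_eq_integral, ← inner_eq_integral] at efin
  rw [efin]
  refine (norm_sub_le _ _).trans ?_
  rw [add_comm]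
  refine add_le_add (hkin.trans ?_) hpot
  have hS0 : 0 ≤ S := (norm_nonneg _).trans (hS 0 0)
  refine mul_le_mul_of_nonneg_left ?_ hS0
  have h1 : ‖f‖ ^ 2 ≤ M ^ 2 := pow_le_pow_left₀ (norm_nonneg _) hfM 2
  have h2 : ‖f'‖ ^ 2 ≤ M ^ 2 := pow_le_pow_left₀ (norm_nonneg _) hfM' 2
  -- Over three directions, half of `3 (M² + M²) + A + A` is the constant `3 M² + A`.
  simp only [Fin.sum_univ_three] at hGA hGA' ⊢
  linarith

/-- Writing the localized scalar product as one of partial scalar products with a fixed test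
function gives access both to the derivative formula along the flow and to continuity at time `0`.
-/
lemma inner_adjoint_tensor_mollifierFamily (hFL : MemLp (mollifierFamily ζ j) 2 volume)
    (f f' : OneBody) :
    inner ℂ (ContinuousLinearMap.adjoint (tensor (X := Pos) f) (hFL.toLp _))
      (ContinuousLinearMap.adjoint (tensor (X := Pos) f') (hFL.toLp _)) =
      ∫ x, (ζ x : ℂ) ^ 2 * (mollify (fun x => (j x : ℂ)) f x *
          conj (mollify (fun x => (j x : ℂ)) f' x)) := by
  rw [inner_eq_integral_of_ae (adjoint_tensor_coeFn_of_ae f hFL.coeFn_toLp)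
    (adjoint_tensor_coeFn_of_ae f' hFL.coeFn_toLp)]
  refine integral_congr_ae (Filter.Eventually.of_forall fun x => ?_)
  simp only [partialInner_mollifierFamily, map_mul, Complex.conj_conj, Complex.conj_ofReal]
  ring

/-- The derivative of the localized mollified scalar products. -/
lemma HartreeBound.exists_hasDerivAt_localized (h : HartreeBound w v φ T τ M) {t : ℝ}
    (ht : t ∈ Set.Ioo 0 τ) (i l : Fin N) (hj : IsMollifier j δ)
    (hζ : ContDiff ℝ ((⊤ : ℕ∞) : WithTop ℕ∞) ζ) (hζc : HasCompactSupport ζ)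
    {S : ℝ} (hS : ∀ k x, ‖dirDeriv (stdVec k) (fun x => ((ζ x : ℂ)) ^ 2) x‖ ≤ S)
    {A B ε : ℝ} (hA : ∀ i, ∃ G, IsWeakGradient (φ t i) G ∧ ∑ k, ‖G k‖ ^ 2 ≤ A)
    (hB0 : 0 ≤ B) (hB : ∀ i, ∀ᵐ z, ‖φ t i z‖ ≤ B) (hε : 0 ≤ ε)
    (ho : meanOscillation ζ j (fun x => w x + meanField v (φ t) x) ≤ ENNReal.ofReal ε) :
    ∃ D, HasDerivAt (fun s => ∫ x, (ζ x : ℂ) ^ 2 *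
        (mollify (fun x => (j x : ℂ)) (φ s i) x *
          conj (mollify (fun x => (j x : ℂ)) (φ s l) x))) D t ∧
      ‖D‖ ≤ S * (3 * M ^ 2 + A) + 2 * B ^ 2 * ε := by
  have hF := isTestFunction_mollifierFamily hj hζ hζc
  have hU : LocallySqInt (fun x => w x + meanField v (φ t) x) :=
    h.field.add (locallySqInt_of_bounded (measurable_meanField h.measurable _) (h.potential t ht))
  have hFL : MemLp (mollifierFamily ζ j) 2 volume := hF.memLp 2
  have hHL := memLp_fstSchrodinger hU hF
  have key := h.hasDerivAt_inner_adjoint_tensor ht i l hF hF hFL.coeFn_toLp hFL.coeFn_toLp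
    (HF := hHL.toLp _) (HG := hHL.toLp _) hHL.coeFn_toLp hHL.coeFn_toLp
  have efun : ∀ s, ∫ x, (ζ x : ℂ) ^ 2 * (mollify (fun x => (j x : ℂ)) (φ s i) x *
      conj (mollify (fun x => (j x : ℂ)) (φ s l) x)) = inner ℂ
      (ContinuousLinearMap.adjoint (tensor (X := Pos) (φ s i)) (hFL.toLp _))
      (ContinuousLinearMap.adjoint (tensor (X := Pos) (φ s l)) (hFL.toLp _)) :=
    fun s => (inner_adjoint_tensor_mollifierFamily hFL _ _).symm
  refine ⟨_, key.congr_of_eventuallyEq (Filter.Eventually.of_forall efun), ?_⟩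
  obtain ⟨G, hG, hGA⟩ := hA i
  obtain ⟨G', hG', hGA'⟩ := hA l
  have hfin := hj.norm_inner_sub_inner_le hζ hζc hS hU hG hG' hGA hGA' (h.orbital t ht i)
    (h.orbital t ht l) hB0 (hB i) (hB l) hε ho hFL hHL
  rw [norm_mul, Complex.norm_I, one_mul]
  exact hfin

end Localized

end

/-! ### Removal of mollifier and cutoff, and conservation of scalar products -/

noncomputable section

lemma isMollifier_normed (b : ContDiffBump (0 : Pos)) : IsMollifier (b.normed volume) b.rOut where
  contDiff := b.contDiff_normed
  hasCompactSupport := b.hasCompactSupport_normed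
  nonneg := b.nonneg_normed
  integral := b.integral_normed
  support x hx := by
    by_contra h
    have h1 : x ∈ Function.support (b.normed volume) := h
    rw [b.support_normed_eq, mem_ball_zero_iff] at h1
    exact absurd hx (not_le.2 h1)

/-- Bump functions supported in the ball of radius `1 / (n + 1)`. -/
def shrinkingBump (n : ℕ) : ContDiffBump (0 : Pos) where
  rIn := ((n : ℝ) + 1)⁻¹ / 2
  rOut := ((n : ℝ) + 1)⁻¹
  rIn_pos := by positivity
  rIn_lt_rOut := half_lt_self (by positivity)

lemma tendsto_rOut_shrinkingBump :
    Filter.Tendsto (fun n => (shrinkingBump n).rOut) Filter.atTop (nhds 0) := by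
  have := tendsto_one_div_add_atTop_nhds_zero_nat (𝕜 := ℝ)
  simp only [one_div] at this
  exact this

lemma ae_tendsto_mollify (f : OneBody) : ∀ᵐ x, Filter.Tendsto
    (fun n => mollify (fun x => (((shrinkingBump n).normed volume x : ℝ) : ℂ)) f x)
    Filter.atTop (nhds (f x)) := by
  have h := ContDiffBump.ae_convolution_tendsto_right_of_locallyIntegrable (K := 2)
    tendsto_rOut_shrinkingBump (Filter.Eventually.of_forall fun n => by
      simp only [shrinkingBump]
      linarith) (locallyIntegrable_oneBody f)
  filter_upwards [h] with x hx
  refine hx.congr fun n => ?_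
  rw [convolution_eq_swap]
  refine integral_congr_ae (Filter.Eventually.of_forall fun z => ?_)
  simp only [ContinuousLinearMap.lsmul_apply, Complex.real_smul]
  ring

/-- Mollification does not increase the bound `B`, so `ζ² B²` is an integrable majorant. -/
lemma tendsto_integral_mollify {ζ : Pos → ℝ} (hζ : Continuous ζ) (hζc : HasCompactSupport ζ)
    {f f' : OneBody} {B : ℝ} (hB : ∀ᵐ z, ‖f z‖ ≤ B) (hB' : ∀ᵐ z, ‖f' z‖ ≤ B) :
    Filter.Tendsto (fun n => ∫ x, (ζ x : ℂ) ^ 2 *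
      (mollify (fun x => (((shrinkingBump n).normed volume x : ℝ) : ℂ)) f x *
        conj (mollify (fun x => (((shrinkingBump n).normed volume x : ℝ) : ℂ)) f' x)))
      Filter.atTop (nhds (∫ x, (ζ x : ℂ) ^ 2 * (f x * conj (f' x)))) := by
  have hc2 : HasCompactSupport fun x => ζ x ^ 2 * (B * B) :=
    hζc.comp_left (g := fun r : ℝ => r ^ 2 * (B * B)) (by simp)
  have hi : Integrable (fun x => ζ x ^ 2 * (B * B)) volume :=
    ((hζ.pow 2).mul continuous_const).integrable_of_hasCompactSupport hc2
  have hm := fun (n : ℕ) (f : OneBody) => (contDiff_mollify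
    (isMollifier_normed (shrinkingBump n)).isTestFunction f).continuous
  refine tendsto_integral_of_dominated_convergence _ (fun n => ?_) hi (fun n => ?_) ?_
  · exact (((Complex.continuous_ofReal.comp hζ).pow 2).mul
      ((hm n f).mul (Complex.continuous_conj.comp (hm n f')))).aestronglyMeasurable
  · refine Filter.Eventually.of_forall fun x => ?_
    have h1 := (isMollifier_normed (shrinkingBump n)).norm_mollify_le hB x
    have h2 := (isMollifier_normed (shrinkingBump n)).norm_mollify_le hB' x
    rw [norm_mul, norm_mul, norm_pow, Complex.norm_real, Real.norm_eq_abs, sq_abs,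
      RCLike.norm_conj]
    exact mul_le_mul_of_nonneg_left (mul_le_mul h1 h2 (norm_nonneg _) ((norm_nonneg _).trans h1))
      (sq_nonneg _)
  · filter_upwards [ae_tendsto_mollify f, ae_tendsto_mollify f'] with x h1 h2
    exact (h1.mul ((Complex.continuous_conj.tendsto _).comp h2)).const_mul _

section Cutoff

/-- The bump function used to cut off at large distances. -/
def unitBump : ContDiffBump (0 : Pos) := ⟨1, 2, one_pos, one_lt_two⟩

/-- Smooth functions which are one on the ball of radius `n + 1`. -/
def cutoff (n : ℕ) (x : Pos) : ℝ := unitBump (((n : ℝ) + 1)⁻¹ • x)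

lemma contDiff_cutoff (n : ℕ) : ContDiff ℝ ((⊤ : ℕ∞) : WithTop ℕ∞) (cutoff n) :=
  unitBump.contDiff.comp (contDiff_const_smul _)

lemma hasCompactSupport_cutoff (n : ℕ) : HasCompactSupport (cutoff n) :=
  unitBump.hasCompactSupport.comp_homeomorph
    (Homeomorph.smulOfNeZero (((n : ℝ) + 1)⁻¹) (by positivity))

lemma cutoff_nonneg (n : ℕ) (x : Pos) : 0 ≤ cutoff n x := unitBump.nonneg

lemma cutoff_sq_le_one (n : ℕ) (x : Pos) : cutoff n x ^ 2 ≤ 1 :=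
  pow_le_one₀ (cutoff_nonneg n x) unitBump.le_one

lemma tendsto_cutoff (x : Pos) :
    Filter.Tendsto (fun n => cutoff n x) Filter.atTop (nhds 1) := by
  refine tendsto_const_nhds.congr' ?_
  have h1 := (tendsto_one_div_add_atTop_nhds_zero_nat (𝕜 := ℝ)).mul_const ‖x‖
  rw [zero_mul] at h1
  filter_upwards [h1.eventually_le_const one_pos] with n hn
  refine (unitBump.one_of_mem_closedBall ?_).symm
  rw [mem_closedBall_zero_iff, norm_smul, Real.norm_of_nonneg (by positivity)]
  simpa only [one_div, unitBump] using hn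

/-- All cutoffs are dilations of one bump, and the chain rule supplies the decaying factor. -/
lemma exists_dirDeriv_cutoff_le : ∃ S : ℝ, ∀ n k x,
    ‖dirDeriv (stdVec k) (fun x => ((cutoff n x : ℂ)) ^ 2) x‖ ≤ S * (1 / ((n : ℝ) + 1)) := by
  have hb : IsTestFunction (fun x => ((unitBump x : ℝ) : ℂ) ^ 2) :=
    ⟨(Complex.ofRealCLM.contDiff.comp unitBump.contDiff).pow 2,
      unitBump.hasCompactSupport.comp_left (g := fun r : ℝ => (r : ℂ) ^ 2) (by simp)⟩
  choose C hC using fun k => (hb.dirDeriv (stdVec k)).exists_bound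
  refine ⟨∑ k, |C k|, fun n k x => ?_⟩
  have h0 : HasFDerivAt (fun x : Pos => ((n : ℝ) + 1)⁻¹ • x)
      (((n : ℝ) + 1)⁻¹ • ContinuousLinearMap.id ℝ Pos) x :=
    (((n : ℝ) + 1)⁻¹ • ContinuousLinearMap.id ℝ Pos).hasFDerivAt
  have h1 := (hb.differentiable (((n : ℝ) + 1)⁻¹ • x)).hasFDerivAt.comp x h0
  have h2 : HasFDerivAt (fun x => ((cutoff n x : ℂ)) ^ 2) _ x := h1
  have e : dirDeriv (stdVec k) (fun x => ((cutoff n x : ℂ)) ^ 2) x = ((n : ℝ) + 1)⁻¹ •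
      dirDeriv (stdVec k) (fun x => ((unitBump x : ℝ) : ℂ) ^ 2) (((n : ℝ) + 1)⁻¹ • x) := by
    unfold dirDeriv
    rw [h2.fderiv]
    simp
  rw [e, norm_smul, Real.norm_of_nonneg (by positivity), mul_comm, one_div]
  refine mul_le_mul_of_nonneg_right ?_ (by positivity)
  exact (hC k _).trans ((le_abs_self _).trans
    (Finset.single_le_sum (f := fun k => |C k|) (fun _ _ => abs_nonneg _) (Finset.mem_univ k)))

lemma tendsto_integral_cutoff (f f' : OneBody) :
    Filter.Tendsto (fun n => ∫ x, (cutoff n x : ℂ) ^ 2 * (f x * conj (f' x)))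
      Filter.atTop (nhds (inner ℂ f' f)) := by
  have hi : Integrable (fun x => conj (f' x) * f x) volume :=
    (L2.integrable_inner (𝕜 := ℂ) f' f).congr
      (Filter.Eventually.of_forall fun x => RCLike.inner_apply' _ _)
  rw [inner_eq_integral]
  refine tendsto_integral_of_dominated_convergence _ (fun n => ?_) hi.norm (fun n => ?_) ?_
  · exact (((Complex.continuous_ofReal.comp (contDiff_cutoff n).continuous).pow
      2).aestronglyMeasurable.mul ((Lp.aestronglyMeasurable f).mul
      (Complex.continuous_conj.comp_aestronglyMeasurable (Lp.aestronglyMeasurable f'))))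
  · refine Filter.Eventually.of_forall fun x => ?_
    rw [norm_mul, norm_pow, Complex.norm_real, Real.norm_eq_abs, sq_abs, mul_comm (f x)]
    exact mul_le_of_le_one_left (norm_nonneg _) (cutoff_sq_le_one n x)
  · refine Filter.Eventually.of_forall fun x => ?_
    have h := (((Complex.continuous_ofReal.tendsto _).comp (tendsto_cutoff x)).pow 2).mul_const
      (f x * conj (f' x))
    simp only [Complex.ofReal_one, one_pow, one_mul] at h
    rw [mul_comm (conj (f' x))]
    exact h

end Cutoff

section Conservation

variable {N : ℕ} {w : Pos → ℝ} {c : ℝ} {T : EReal} {φ : ℝ → Fin N → OneBody} {τ M A B L : ℝ}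

lemma continuous_adjoint_tensor {X : Type*} [MeasureSpace X] [SigmaFinite (volume : Measure X)]
    (F : SqInt (Pos × X)) :
    Continuous fun u : OneBody => ContinuousLinearMap.adjoint (tensor (X := X) u) F :=
  (ContinuousLinearMap.adjoint.continuous.comp (tensor (X := X)).continuous).clm_apply
    continuous_const

lemma HartreeBound.continuousWithinAt_zero {v : Pos → ℝ} (h : HartreeBound w v φ T τ M)
    (h0 : 0 ∈ timeInterval T) (hτ : 0 < τ) (i : Fin N) :
    ContinuousWithinAt (fun s => φ s i) (Set.Ioi 0) 0 := by
  have h1 := (h.solution i).1 0 h0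
  refine h1.mono_of_mem_nhdsWithin ?_
  filter_upwards [Ioo_mem_nhdsGT hτ] with s hs using h.mem s hs

/-- The Hartree flow preserves the scalar products of the orbitals. -/
theorem HartreeBound.inner_eq {v : Pos → ℝ} (h : HartreeBound w v φ T τ M)
    (h0 : 0 ∈ timeInterval T)
    (hA : ∀ t ∈ Set.Ioo 0 τ, ∀ i, ∃ G, IsWeakGradient (φ t i) G ∧ ∑ k, ‖G k‖ ^ 2 ≤ A)
    (hB0 : 0 ≤ B) (hB : ∀ t ∈ timeInterval T, ∀ i, ∀ᵐ z, ‖φ t i z‖ ≤ B) (hL0 : 0 ≤ L)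
    (hL : ∀ t ∈ Set.Ioo 0 τ, ∀ z x,
      |meanField v (φ t) z - meanField v (φ t) x| ≤ L * ‖z - x‖)
    {t : ℝ} (ht : t ∈ Set.Ioo 0 τ) (i l : Fin N) :
    inner ℂ (φ t l) (φ t i) = inner ℂ (φ 0 l) (φ 0 i) := by
  have htT := h.mem t ht
  obtain ⟨S, hS⟩ := exists_dirDeriv_cutoff_le
  -- The mollifier is removed at a fixed cutoff, since the oscillation of `w` is controlled only
  -- locally. The kinetic error, of order `1 / (n + 1)`, is left for the limit in `n`.
  have step1 : ∀ n : ℕ, ‖(∫ x, (cutoff n x : ℂ) ^ 2 * (φ t i x * conj (φ t l x))) -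
      ∫ x, (cutoff n x : ℂ) ^ 2 * (φ 0 i x * conj (φ 0 l x))‖ ≤
      S * (1 / ((n : ℝ) + 1)) * (3 * M ^ 2 + A) * t := by
    intro n
    have hζ := (contDiff_cutoff n).continuous
    have hζc := hasCompactSupport_cutoff n
    refine le_of_forall_pos_le_add fun ε' hε' => ?_
    -- One copy of `ε` is reserved for the oscillation of `w`, the other for that of the mean field;
    -- the `+ 1` in the denominator covers the case `B = 0`.
    obtain ⟨ε, hε, hεe⟩ : ∃ ε > 0, 2 * B ^ 2 * (ε + ε) * t ≤ ε' := by
      refine ⟨ε' / (4 * B ^ 2 * t + 1), by have := ht.1; positivity, ?_⟩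
      have h1 : 0 ≤ 4 * B ^ 2 * t := by have := ht.1; positivity
      have e : 2 * B ^ 2 * (ε' / (4 * B ^ 2 * t + 1) + ε' / (4 * B ^ 2 * t + 1)) * t =
          ε' * (4 * B ^ 2 * t / (4 * B ^ 2 * t + 1)) := by
        field_simp
        ring
      rw [e]
      refine mul_le_of_le_one_right hε'.le ?_
      rw [div_le_one (by positivity)]
      linarith
    obtain ⟨δ₀, hδ₀, hosc⟩ := exists_meanOscillation_le (cutoff_sq_le_one n) hζc h.field hε
    have hlim1 := tendsto_integral_mollify hζ hζc (hB t htT i) (hB t htT l)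
    have hlim0 := tendsto_integral_mollify hζ hζc (hB 0 h0 i) (hB 0 h0 l)
    have hδlim := tendsto_rOut_shrinkingBump
    have hev2 : ∀ᶠ m in Filter.atTop,
        L * (shrinkingBump m).rOut * ∫ x, cutoff n x ^ 2 ≤ ε := by
      have h1 := (hδlim.const_mul L).mul_const (∫ x, cutoff n x ^ 2)
      rw [mul_zero, zero_mul] at h1
      exact h1.eventually_le_const hε
    refine le_of_tendsto (hlim1.sub hlim0).norm ?_
    filter_upwards [hδlim.eventually_lt_const hδ₀, hev2] with m hm1 hm2
    have hj := isMollifier_normed (shrinkingBump m)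
    have hFL : MemLp (mollifierFamily (cutoff n) ((shrinkingBump m).normed volume)) 2 volume :=
      (isTestFunction_mollifierFamily hj (contDiff_cutoff n) hζc).memLp 2
    have hcont : ContinuousWithinAt (fun s => ∫ x, (cutoff n x : ℂ) ^ 2 *
        (mollify (fun x => (((shrinkingBump m).normed volume x : ℝ) : ℂ)) (φ s i) x *
          conj (mollify (fun x => (((shrinkingBump m).normed volume x : ℝ) : ℂ)) (φ s l) x)))
        (Set.Ioi 0) 0 := by
      simp only [← inner_adjoint_tensor_mollifierFamily hFL]
      have hc := fun i => (continuous_adjoint_tensor (hFL.toLp _)).continuousAt.comp_continuousWithinAt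
        (h.continuousWithinAt_zero h0 (ht.1.trans ht.2) i)
      exact (hc i).inner (hc l)
    have hmain := norm_sub_le_of_hasDerivAt_le hcont (τ := τ)
      (C := S * (1 / ((n : ℝ) + 1)) * (3 * M ^ 2 + A) + 2 * B ^ 2 * (ε + ε)) (fun s hs => by
        refine h.exists_hasDerivAt_localized hs i l hj (contDiff_cutoff n) hζc (hS n) (hA s hs) hB0
          (hB s (h.mem s hs)) (by positivity) ?_
        refine (meanOscillation_add_le hj (shrinkingBump m).rOut_pos.le hζ hζc hL0 (hL s hs)).trans ?_
        rw [ENNReal.ofReal_add hε.le hε.le]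
        exact add_le_add (hosc _ hm1 _ hj) (ENNReal.ofReal_le_ofReal hm2)) ht
    refine hmain.trans ?_
    rw [add_mul]
    exact add_le_add le_rfl hεe
  have hz : Filter.Tendsto (fun n : ℕ => S * (1 / ((n : ℝ) + 1)) * (3 * M ^ 2 + A) * t)
      Filter.atTop (nhds 0) := by
    have h1 := (((tendsto_one_div_add_atTop_nhds_zero_nat (𝕜 := ℝ)).const_mul S).mul_const
      (3 * M ^ 2 + A)).mul_const t
    simpa using h1
  have h2 := le_of_tendsto_of_tendsto'
    ((tendsto_integral_cutoff (φ t i) (φ t l)).sub (tendsto_integral_cutoff (φ 0 i) (φ 0 l))).norm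
    hz step1
  exact sub_eq_zero.1 (norm_le_zero_iff.1 h2)

end Conservation

end

noncomputable section

/-! ### Consequences of the bounds on the Hartree flow -/

lemma ae_le_of_eLpNorm_top_le {ρ : Pos → ℝ} {D : ℝ} (hD : 0 ≤ D)
    (h : eLpNorm ρ ∞ volume ≤ ENNReal.ofReal D) : ∀ᵐ x, ρ x ≤ D := by
  rw [eLpNorm_exponent_top] at h
  filter_upwards [enorm_ae_le_eLpNormEssSup ρ volume] with x hx
  have h1 := hx.trans h
  rw [← ofReal_norm, ENNReal.ofReal_le_ofReal_iff hD] at h1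
  exact (Real.le_norm_self _).trans h1

/-- The energy is defined as an infimum; the strict bound by `A + 1` selects a weak gradient without
discussing attainment. -/
lemma exists_weakGradient_of_kineticEnergy_le {N : ℕ} {φ : Fin N → OneBody} {A : ℝ} (hA : 0 ≤ A)
    (h : kineticEnergy φ ≤ ENNReal.ofReal A) (i : Fin N) :
    ∃ G, IsWeakGradient (φ i) G ∧ ∑ k, ‖G k‖ ^ 2 ≤ A + 1 := by
  have h1 : gradNormSq (φ i) < ENNReal.ofReal (A + 1) := by
    refine lt_of_le_of_lt ((Finset.single_le_sum (f := fun i => gradNormSq (φ i))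
      (fun _ _ => zero_le) (Finset.mem_univ i)).trans h) ?_
    exact (ENNReal.ofReal_lt_ofReal_iff (by positivity)).2 (by linarith)
  simp only [gradNormSq, iInf_lt_iff] at h1
  obtain ⟨G, hG, h2⟩ := h1
  exact ⟨G, hG, ((ENNReal.ofReal_lt_ofReal_iff (by positivity)).1 h2).le⟩

section Flow

variable {N : ℕ} {w : Pos → ℝ} {c : ℝ} {T : EReal} {φ : ℝ → Fin N → OneBody} {A D : ℝ}

lemma zero_mem_timeInterval {t : ℝ} (ht : t ∈ timeInterval T) : (0 : ℝ) ∈ timeInterval T :=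
  ⟨le_rfl, lt_of_le_of_lt (by exact_mod_cast ht.1) ht.2⟩

lemma exists_Icc_subset_timeInterval {t : ℝ} (ht : t ∈ timeInterval T) :
    ∃ τ, t < τ ∧ Set.Icc 0 τ ⊆ timeInterval T := by
  obtain ⟨τ, h1, h2⟩ := EReal.lt_iff_exists_real_btwn.1 ht.2
  exact ⟨τ, by exact_mod_cast h1, fun s hs => ⟨hs.1, lt_of_le_of_lt (by exact_mod_cast hs.2) h2⟩⟩

lemma lintegral_coulomb_sq_mul_density_le (hD : 0 ≤ D) {φ : Fin N → OneBody}
    (hρ : eLpNorm (density φ) ∞ volume ≤ ENNReal.ofReal D) {M R : ℝ} (hR : 0 < R)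
    (hM : ∑ k, ‖φ k‖ ^ 2 ≤ M) (c : ℝ) (y : Pos) :
    ∫⁻ x, ENNReal.ofReal (coulomb c (y - x) ^ 2 * density φ x) ≤
      ENNReal.ofReal (c ^ 2 * (sphereArea * D * R + M / R ^ 2)) :=
  lintegral_coulomb_sq_mul_le c (density_nonneg φ) hD (ae_le_of_eLpNorm_top_le hD hρ)
    (integrable_density φ) (by rwa [integral_density]) hR y

/-- Before orthonormality is known, bounds on the orbitals come from `L²`-continuity on a compact
interval. Its end point is chosen beyond `t` so that positive times `t` are interior. The constants
`M` and `Q` enter only qualitatively, so the crude radius `R = 1` is used in the convolution bound.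
-/
lemma exists_hartreeBound (hw : IsLocallySquareIntegrable w)
    (hφ : IsHartreeSolution w (coulomb c) T φ) (hD : 0 ≤ D)
    (hρ : ∀ t ∈ timeInterval T, eLpNorm (density (φ t)) ∞ volume ≤ ENNReal.ofReal D) {t : ℝ}
    (ht : t ∈ timeInterval T) : ∃ τ M Q, t < τ ∧ 0 ≤ Q ∧ Set.Icc 0 τ ⊆ timeInterval T ∧
      HartreeBound w (coulomb c) φ T τ M ∧ ∀ s ∈ Set.Ioo 0 τ, ∀ y,
        ∫⁻ x, ENNReal.ofReal (coulomb 1 (y - x) ^ 2 * density (φ s) x) ≤ ENNReal.ofReal Q := by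
  obtain ⟨τ, hτ, hsub⟩ := exists_Icc_subset_timeInterval ht
  choose M₀ hM₀ using fun i => isCompact_Icc.exists_bound_of_continuousOn ((hφ i).1.mono hsub)
  have hle : ∀ s ∈ Set.Icc 0 τ, ∑ k, ‖φ s k‖ ^ 2 ≤ ∑ k, M₀ k ^ 2 := fun s hs =>
    Finset.sum_le_sum fun k _ => pow_le_pow_left₀ (norm_nonneg _) (hM₀ k s hs) 2
  have hQ0 : 0 ≤ ∑ k, M₀ k ^ 2 := Finset.sum_nonneg fun k _ => sq_nonneg _
  obtain ⟨Q, hQ⟩ : ∃ Q, Q = sphereArea * D * 1 + (∑ k, M₀ k ^ 2) / 1 ^ 2 := ⟨_, rfl⟩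
  have hQnn : 0 ≤ Q := by
    rw [hQ]
    have := sphereArea_nonneg
    positivity
  have hb : ∀ s ∈ Set.Ioo 0 τ, ∀ c y,
      ∫⁻ x, ENNReal.ofReal (coulomb c (y - x) ^ 2 * density (φ s) x) ≤
        ENNReal.ofReal (c ^ 2 * Q) := fun s hs c y => by
    rw [hQ]
    exact lintegral_coulomb_sq_mul_density_le hD (hρ s (hsub ⟨hs.1.le, hs.2.le⟩)) one_pos
      (hle s ⟨hs.1.le, hs.2.le⟩) c y
  refine ⟨τ, (∑ k, |M₀ k|) + (∑ k, M₀ k ^ 2 + c ^ 2 * Q), Q, hτ, hQnn, hsub, ?_, fun s hs y => ?_⟩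
  · refine ⟨hφ, hw, fun s hs => hsub ⟨hs.1.le, hs.2.le⟩, measurable_coulomb c, fun s hs i => ?_,
      fun s hs x => ?_⟩
    · have h1 := (hM₀ i s ⟨hs.1.le, hs.2.le⟩).trans (le_abs_self _)
      have h2 := Finset.single_le_sum (f := fun k => |M₀ k|) (fun _ _ => abs_nonneg _)
        (Finset.mem_univ i)
      have h3 : 0 ≤ c ^ 2 * Q := by positivity
      linarith
    · have h1 := abs_meanField_le (measurable_coulomb c) (by positivity) (hb s hs c) x
      have h2 := hle s ⟨hs.1.le, hs.2.le⟩
      have h3 : 0 ≤ ∑ k, |M₀ k| := Finset.sum_nonneg fun _ _ => abs_nonneg _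
      linarith
  · have := hb s hs 1 y
    rwa [one_pow, one_mul] at this

/-- The Hartree flow preserves orthonormality. -/
theorem orthonormal_of_isHartreeSolution (hw : IsLocallySquareIntegrable w)
    (hφ : IsHartreeSolution w (coulomb c) T φ) (h0 : Orthonormal ℂ (φ 0)) (hA : 0 ≤ A)
    (hkin : ∀ t ∈ timeInterval T, kineticEnergy (φ t) ≤ ENNReal.ofReal A) (hD : 0 ≤ D)
    (hρ : ∀ t ∈ timeInterval T, eLpNorm (density (φ t)) ∞ volume ≤ ENNReal.ofReal D) {t : ℝ}
    (ht : t ∈ timeInterval T) : Orthonormal ℂ (φ t) := by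
  rcases ht.1.eq_or_lt with rfl | htpos
  · exact h0
  obtain ⟨τ, M, Q, hτ, hQ, hsub, hb, hq⟩ := exists_hartreeBound hw hφ hD hρ ht
  -- Each orbital satisfies `|φ_i|² ≤ ρ ≤ D` almost everywhere.
  have hB : ∀ t ∈ timeInterval T, ∀ i, ∀ᵐ z, ‖φ t i z‖ ≤ √D := by
    intro s hs i
    filter_upwards [ae_le_of_eLpNorm_top_le hD (hρ s hs)] with z hz
    exact Real.le_sqrt_of_sq_le ((norm_sq_le_density (φ s) i z).trans hz)
  have h := fun i l => hb.inner_eq (zero_mem_timeInterval ht) (A := A + 1) (B := √D)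
    (L := |c| * (2 * Q)) (fun s hs i => exists_weakGradient_of_kineticEnergy_le hA
      (hkin s (hb.mem s hs)) i) (Real.sqrt_nonneg D) hB (by positivity)
    (fun s hs z x => abs_meanField_coulomb_sub_le c (φ s) hQ (hq s hs) z x) ⟨htpos, hτ⟩ i l
  rw [orthonormal_iff_ite] at h0 ⊢
  intro i l
  rw [h l i]
  exact h0 i l

/-- The radius `R = N^(1/3)` balances `D R` against `N / R²`; both become of order `N^(1/3)`, and
the factor `c² = N^(-4/3)` leaves `N⁻¹`. -/
lemma interactionBound_coulomb (hN : 0 < N) (hc : c ^ 2 = (N : ℝ) ^ (-(4 / 3) : ℝ)) (hD : 0 ≤ D)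
    {φ : Fin N → OneBody} (hφ : Orthonormal ℂ φ)
    (hρ : eLpNorm (density φ) ∞ volume ≤ ENNReal.ofReal D) :
    InteractionBound (coulomb c) φ ((sphereArea * D + 1) * (N : ℝ)⁻¹) := by
  have hN' : (0 : ℝ) < N := by exact_mod_cast hN
  have hs := sphereArea_nonneg
  refine ⟨measurable_coulomb c, coulomb_neg c, hφ, by positivity, fun y => ?_⟩
  have hM : ∑ k, ‖φ k‖ ^ 2 ≤ (N : ℝ) := by simp [hφ.1]
  refine (lintegral_coulomb_sq_mul_density_le hD hρ
    (R := (N : ℝ) ^ (1 / 3 : ℝ)) (by positivity) hM c y).trans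
    (ENNReal.ofReal_le_ofReal (le_of_eq ?_))
  have e1 : ((N : ℝ) ^ (1 / 3 : ℝ)) ^ 2 = (N : ℝ) ^ (2 / 3 : ℝ) := by
    rw [← Real.rpow_natCast, ← Real.rpow_mul hN'.le]
    norm_num
  have e2 : (N : ℝ) / (N : ℝ) ^ (2 / 3 : ℝ) = (N : ℝ) ^ (1 / 3 : ℝ) := by
    nth_rewrite 1 [← Real.rpow_one (N : ℝ)]
    rw [← Real.rpow_sub hN']
    norm_num
  have e3 : (N : ℝ) ^ (-(4 / 3) : ℝ) * (N : ℝ) ^ (1 / 3 : ℝ) = (N : ℝ)⁻¹ := by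
    rw [← Real.rpow_add hN', ← Real.rpow_neg_one]
    norm_num
  rw [hc, e1, e2, ← e3]
  ring

end Flow

lemma exists_scaledInteraction_eq_coulomb {N : ℕ} {v : Pos → ℝ}
    (hv : v = (fun x => ‖x‖⁻¹) ∨ v = (fun x => -‖x‖⁻¹)) :
    ∃ c : ℝ, c ^ 2 = (N : ℝ) ^ (-(4 / 3) : ℝ) ∧ scaledInteraction (2 / 3) N v = coulomb c := by
  have e : ((N : ℝ) ^ (-(2 / 3) : ℝ)) ^ 2 = (N : ℝ) ^ (-(4 / 3) : ℝ) := by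
    rw [← Real.rpow_natCast, ← Real.rpow_mul (Nat.cast_nonneg N)]
    norm_num
  rcases hv with rfl | rfl
  · exact ⟨(N : ℝ) ^ (-(2 / 3) : ℝ), e, rfl⟩
  · refine ⟨-(N : ℝ) ^ (-(2 / 3) : ℝ), by rw [neg_sq, e], ?_⟩
    funext x
    simp only [scaledInteraction, coulomb]
    ring

end

noncomputable section

/-! ### Separating one particle -/

section Slot

variable {n : ℕ} (m : Fin (n + 1))

/-- The other order of integration compared with `integral_slot`: the remaining particles are
integrated first, at fixed values of the two exchanged coordinates. -/
lemma integral_slot_swap {f : Pos × Config (n + 1) → ℂ} (hf : Integrable f volume) :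
    ∫ p, f p = ∫ q : Pos × Pos, ∫ r : Config n, f (q.1, m.insertNth q.2 r) := by
  have h1 := (MeasurePreserving.id (volume : Measure Pos)).prod (measurePreserving_insertNth m)
  have h2 := measurePreserving_prodAssoc (volume : Measure Pos) (volume : Measure Pos)
    (volume : Measure (Config n))
  have h := h1.comp h2
  have hemb : MeasurableEmbedding (Prod.map (id : Pos → Pos)
      (fun p : Pos × Config n => (m.insertNth p.1 p.2 : Config (n + 1))) ∘
        (MeasurableEquiv.prodAssoc : (Pos × Pos) × Config n ≃ᵐ Pos × Pos × Config n)) := by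
    refine MeasurableEmbedding.comp ?_ (MeasurableEquiv.measurableEmbedding _)
    exact MeasurableEmbedding.id.prodMap
      (MeasurableEquiv.piFinSuccAbove (fun _ => Pos) m).symm.measurableEmbedding
  have e := h.integral_comp hemb f
  refine e.symm.trans ?_
  exact integral_prod _ ((h.integrable_comp_emb hemb).2 hf)

lemma contDiff_insertNth : ContDiff ℝ ((⊤ : ℕ∞) : WithTop ℕ∞)
    fun p : Pos × Config n => (m.insertNth p.1 p.2 : Config (n + 1)) := by
  rw [contDiff_pi]
  intro i
  rcases Fin.eq_self_or_eq_succAbove m i with rfl | ⟨k, rfl⟩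
  · simp only [Fin.insertNth_apply_same]
    exact contDiff_fst
  · simp only [Fin.insertNth_apply_succAbove]
    exact (contDiff_apply ℝ Pos k).comp contDiff_snd

variable {m}

lemma IsTestFunction.comp_insertNth {f : Config (n + 1) → ℂ} (hf : IsTestFunction f) :
    IsTestFunction fun p : Pos × Config n => f (m.insertNth p.1 p.2) := by
  refine ⟨hf.1.comp (contDiff_insertNth m), ?_⟩
  refine HasCompactSupport.intro (hf.2.isCompact.image (continuous_removeNth m)) fun p hp => ?_
  refine image_eq_zero_of_notMem_tsupport fun h => hp ⟨_, h, ?_⟩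
  simp

lemma IsTestFunction.comp_insertNth_right {f : Config (n + 1) → ℂ} (hf : IsTestFunction f)
    (z : Pos) : IsTestFunction fun r : Config n => f (m.insertNth z r) := by
  refine ⟨hf.1.comp ((contDiff_insertNth m).comp (contDiff_const.prodMk contDiff_id)), ?_⟩
  refine HasCompactSupport.intro (hf.2.isCompact.image
    (continuous_snd.comp (continuous_removeNth m))) fun r hr => ?_
  refine image_eq_zero_of_notMem_tsupport fun h => hr ⟨_, h, ?_⟩
  simp

lemma fstLaplacian_comp_insertNth (f : Config (n + 1) → ℂ) (p : Pos × Config n) :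
    fstLaplacian (fun p : Pos × Config n => f (m.insertNth p.1 p.2)) p =
      particleLaplacian m f (m.insertNth p.1 p.2) := by
  simp only [fstLaplacian, particleLaplacian, Fin.insertNth_apply_same, Fin.update_insertNth]

lemma particleLaplacian_comp_insertNth (f : Config (n + 1) → ℂ) (k : Fin n) (z : Pos)
    (r : Config n) : particleLaplacian k (fun r : Config n => f (m.insertNth z r)) r =
      particleLaplacian (m.succAbove k) f (m.insertNth z r) := by
  simp only [particleLaplacian, Fin.insertNth_apply_succAbove, Fin.insertNth_update]

/-- The inner integral is a scalar product in the other particles alone, so operators acting there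
can be moved from one side to the other while the orbitals are untouched. -/
lemma inner_rankOne_eq_integral (u w : OneBody) {f g : ManyBody (n + 1)}
    {f' g' : Config (n + 1) → ℂ} (hf : f =ᵐ[volume] f') (hg : g =ᵐ[volume] g') :
    inner ℂ f (rankOne m u w g) = ∫ q : Pos × Pos, u q.2 * conj (w q.1) *
      ∫ r : Config n, conj (f' (m.insertNth q.2 r)) * g' (m.insertNth q.1 r) := by
  have h1 : tensor w f =ᵐ[volume] fun p : Pos × Config (n + 1) => w p.1 * f' p.2 := by
    filter_upwards [coeFn_tensor w f, ae_snd (Y := Pos) hf] with p h1 h2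
    rw [h1, h2]
  have h2 : tensor u g =ᵐ[volume] fun p : Pos × Config (n + 1) => u p.1 * g' p.2 := by
    filter_upwards [coeFn_tensor u g, ae_snd (Y := Pos) hg] with p h1 h2
    rw [h1, h2]
  have h3 := coeFn_compMP_of_ae (measurePreserving_slotSwap m) h2
  rw [inner_rankOne, inner_eq_integral_of_ae h1 h3, integral_slot_swap m]
  · refine integral_congr_ae (Filter.Eventually.of_forall fun q => ?_)
    simp only [Function.comp_apply, slotSwap, Fin.insertNth_apply_same, Fin.update_insertNth]
    rw [← integral_const_mul]
    refine integral_congr_ae (Filter.Eventually.of_forall fun r => ?_)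
    simp only [map_mul]
    ring
  · refine (L2.integrable_inner (𝕜 := ℂ) (tensor w f)
      (compMP _ (measurePreserving_slotSwap m) (tensor u g))).congr ?_
    filter_upwards [h1, h3] with p h4 h5
    rw [RCLike.inner_apply', h4, h5]

/-- The Laplacian in another particle coordinate commutes with `p_m` in the form sense. -/
lemma inner_orbProj_particleLaplacian {M : ℕ} (φ : Fin M → OneBody) {k : Fin (n + 1)} (hk : k ≠ m)
    {f g Df Dg : ManyBody (n + 1)} {f' g' : Config (n + 1) → ℂ} (hf' : IsTestFunction f')
    (hg' : IsTestFunction g') (hf : f =ᵐ[volume] f') (hg : g =ᵐ[volume] g')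
    (hDf : Df =ᵐ[volume] particleLaplacian k f') (hDg : Dg =ᵐ[volume] particleLaplacian k g') :
    inner ℂ f (orbProj φ m Dg) = inner ℂ Df (orbProj φ m g) := by
  obtain ⟨l, rfl⟩ := Fin.exists_succAbove_eq hk
  rw [orbProj_apply, orbProj_apply, inner_sum, inner_sum]
  refine Finset.sum_congr rfl fun i _ => ?_
  rw [inner_rankOne_eq_integral _ _ hf hDg, inner_rankOne_eq_integral _ _ hDf hg]
  refine integral_congr_ae (Filter.Eventually.of_forall fun q => ?_)
  simp only [← particleLaplacian_comp_insertNth]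
  rw [integral_conj_mul_particleLaplacian (hf'.comp_insertNth_right q.2)
    (hg'.comp_insertNth_right q.1) l]

/-- With `x_m` separated from the rest, the rank-one operator is tensoring with `u` after the
partial scalar product with `w`. Its matrix elements take the form whose derivative along the flow
is known. -/
lemma inner_rankOne_eq_inner_adjoint (u w : OneBody) (f g : ManyBody (n + 1)) :
    inner ℂ f (rankOne m u w g) =
      inner ℂ (ContinuousLinearMap.adjoint (tensor (X := Config n) u)
          (compMP _ (measurePreserving_insertNth m) f))
        (ContinuousLinearMap.adjoint (tensor (X := Config n) w)
          (compMP _ (measurePreserving_insertNth m) g)) := by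
  have h1 := coeFn_compMP (measurePreserving_insertNth m) g
  have h2 := adjoint_tensor_coeFn_of_ae w h1
  have h3 : compMP _ (measurePreserving_insertNth m) (rankOne m u w g) =
      tensor u (ContinuousLinearMap.adjoint (tensor (X := Config n) w)
        (compMP _ (measurePreserving_insertNth m) g)) := by
    refine Lp.ext ?_
    have h4 := coeFn_compMP_of_ae (measurePreserving_insertNth m)
      (rankOne_coeFn m u w (f := g) Filter.EventuallyEq.rfl)
    filter_upwards [h4, coeFn_tensor u (ContinuousLinearMap.adjoint (tensor (X := Config n) w)
      (compMP _ (measurePreserving_insertNth m) g)), ae_snd (Y := Pos) h2] with p h4 h5 h6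
    rw [h4, h5, h6]
    simp only [Function.comp_apply, partialInner, Fin.insertNth_apply_same, Fin.update_insertNth]
  rw [← inner_compMP_compMP (measurePreserving_insertNth m), h3,
    ContinuousLinearMap.adjoint_inner_left]

end Slot

/-! ### The time derivative of the projection along the Hartree flow -/

section Derivative

variable {n : ℕ} {w v : Pos → ℝ} {T : EReal} {φ : ℝ → Fin (n + 1) → OneBody} {τ M : ℝ}

/-- The derivative formula for partial scalar products with equal orbital indices, the remaining
particles being the parameter space, summed over the orbitals. -/
lemma HartreeBound.hasDerivAt_inner_orbProj (h : HartreeBound w v φ T τ M) {t : ℝ}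
    (ht : t ∈ Set.Ioo 0 τ) (m : Fin (n + 1)) {f g hf hg : ManyBody (n + 1)}
    {f' g' : Config (n + 1) → ℂ} (tf : IsTestFunction f') (tg : IsTestFunction g')
    (ef : f =ᵐ[volume] f') (eg : g =ᵐ[volume] g')
    (ehf : hf =ᵐ[volume] fun x => -(particleLaplacian m f' x) +
      ((w (x m) + meanField v (φ t) (x m) : ℝ) : ℂ) * f' x)
    (ehg : hg =ᵐ[volume] fun x => -(particleLaplacian m g' x) +
      ((w (x m) + meanField v (φ t) (x m) : ℝ) : ℂ) * g' x) :
    HasDerivAt (fun s => inner ℂ f (orbProj (φ s) m g))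
      (Complex.I * (inner ℂ f (orbProj (φ t) m hg) - inner ℂ hf (orbProj (φ t) m g))) t := by
  have e1 : ∀ {a : ManyBody (n + 1)} {a' : Config (n + 1) → ℂ}, a =ᵐ[volume] a' →
      compMP _ (measurePreserving_insertNth m) a =ᵐ[volume]
        fun p : Pos × Config n => a' (m.insertNth p.1 p.2) := fun ha =>
    coeFn_compMP_of_ae (measurePreserving_insertNth m) ha
  have e2 : ∀ {a : ManyBody (n + 1)} {a' : Config (n + 1) → ℂ},
      (a =ᵐ[volume] fun x => -(particleLaplacian m a' x) +
        ((w (x m) + meanField v (φ t) (x m) : ℝ) : ℂ) * a' x) →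
      compMP _ (measurePreserving_insertNth m) a =ᵐ[volume]
        fstSchrodinger (fun x => w x + meanField v (φ t) x)
          fun p : Pos × Config n => a' (m.insertNth p.1 p.2) := by
    intro a a' ha
    refine (e1 ha).trans (Filter.Eventually.of_forall fun p => ?_)
    simp only [fstSchrodinger, fstLaplacian_comp_insertNth, Fin.insertNth_apply_same]
  have key : ∀ k : Fin (n + 1), HasDerivAt (fun s => inner ℂ f (rankOne m (φ s k) (φ s k) g))
      (Complex.I * (inner ℂ f (rankOne m (φ t k) (φ t k) hg) -
        inner ℂ hf (rankOne m (φ t k) (φ t k) g))) t := by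
    intro k
    simp only [inner_rankOne_eq_inner_adjoint]
    exact h.hasDerivAt_inner_adjoint_tensor ht k k tf.comp_insertNth tg.comp_insertNth
      (e1 ef) (e1 eg) (e2 ehf) (e2 ehg)
  have hsum := HasDerivAt.fun_sum fun k (_ : k ∈ Finset.univ) => key k
  simp only [orbProj_apply, inner_sum]
  refine hsum.congr_deriv ?_
  rw [← Finset.mul_sum, Finset.sum_sub_distrib]

end Derivative

end

noncomputable section

/-! ### Bounded multiplication operators -/

section Multiplication

variable {X : Type*} [MeasureSpace X]

lemma memLp_real_mul {W : X → ℝ} (hW : Measurable W) {M : ℝ} (hM : ∀ x, |W x| ≤ M) (f : SqInt X) :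
    MemLp (fun x => (W x : ℂ) * f x) 2 volume := by
  refine (Lp.memLp f).of_le_mul (c := M) ((Complex.measurable_ofReal.comp
    hW).aestronglyMeasurable.mul (Lp.aestronglyMeasurable f))
    (Filter.Eventually.of_forall fun x => ?_)
  rw [norm_mul, Complex.norm_real]
  exact mul_le_mul_of_nonneg_right (hM x) (norm_nonneg _)

/-- Multiplication by a bounded real function. -/
def mulOp {W : X → ℝ} (hW : Measurable W) {M : ℝ} (hM : ∀ x, |W x| ≤ M) :
    SqInt X →L[ℂ] SqInt X :=
  LinearMap.mkContinuous
    { toFun := fun f => (memLp_real_mul hW hM f).toLp _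
      map_add' := fun f g => by
        refine Lp.ext ?_
        filter_upwards [(memLp_real_mul hW hM (f + g)).coeFn_toLp,
          (memLp_real_mul hW hM f).coeFn_toLp, (memLp_real_mul hW hM g).coeFn_toLp,
          Lp.coeFn_add ((memLp_real_mul hW hM f).toLp _) ((memLp_real_mul hW hM g).toLp _),
          Lp.coeFn_add f g] with x h1 h2 h3 h4 h5
        rw [h1, h4, Pi.add_apply, h2, h3, h5, Pi.add_apply, mul_add]
      map_smul' := fun a f => by
        refine Lp.ext ?_
        filter_upwards [(memLp_real_mul hW hM (a • f)).coeFn_toLp,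
          (memLp_real_mul hW hM f).coeFn_toLp,
          Lp.coeFn_smul a ((memLp_real_mul hW hM f).toLp _), Lp.coeFn_smul a f] with x h1 h2 h3 h4
        rw [RingHom.id_apply, h1, h3, Pi.smul_apply, h2, h4, Pi.smul_apply, smul_eq_mul,
          smul_eq_mul]
        ring }
    M fun f => by
      refine Lp.norm_le_mul_norm_of_ae_le_mul ?_
      filter_upwards [(memLp_real_mul hW hM f).coeFn_toLp] with x hx
      change ‖((memLp_real_mul hW hM f).toLp _) x‖ ≤ _
      rw [hx, norm_mul, Complex.norm_real]
      exact mul_le_mul_of_nonneg_right (hM x) (norm_nonneg _)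

lemma mulOp_coeFn {W : X → ℝ} (hW : Measurable W) {M : ℝ} (hM : ∀ x, |W x| ≤ M) (f : SqInt X) :
    mulOp hW hM f =ᵐ[volume] fun x => (W x : ℂ) * f x :=
  (memLp_real_mul hW hM f).coeFn_toLp

lemma norm_mulOp_le {W : X → ℝ} (hW : Measurable W) {M : ℝ} (hM0 : 0 ≤ M) (hM : ∀ x, |W x| ≤ M) :
    ‖mulOp hW hM‖ ≤ M :=
  LinearMap.mkContinuous_norm_le _ hM0 _

lemma inner_real_mul {W : X → ℝ} {a b Wa Wb : SqInt X} (ha : Wa =ᵐ[volume] fun x => (W x : ℂ) * a x)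
    (hb : Wb =ᵐ[volume] fun x => (W x : ℂ) * b x) : inner ℂ Wa b = inner ℂ a Wb := by
  rw [inner_eq_integral_of_ae ha Filter.EventuallyEq.rfl,
    inner_eq_integral_of_ae Filter.EventuallyEq.rfl hb]
  refine integral_congr_ae (Filter.Eventually.of_forall fun x => ?_)
  simp only [map_mul, Complex.conj_ofReal]
  ring

lemma inner_real_mul_self_im {W : X → ℝ} {a Wa : SqInt X}
    (ha : Wa =ᵐ[volume] fun x => (W x : ℂ) * a x) : (inner ℂ a Wa).im = 0 := by
  have h := inner_real_mul ha ha
  rw [← inner_conj_symm] at h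
  exact Complex.conj_eq_iff_im.1 h

end Multiplication

/-! ### The projected relative interaction -/

section RelativeInteraction

variable {N : ℕ} {v : Pos → ℝ} {φ : Fin N → OneBody} {κ : ℝ}

lemma InteractionBound.sum_norm_sq (h : InteractionBound v φ κ) : ∑ k, ‖φ k‖ ^ 2 = N := by
  simp [h.orthonormal.1]

lemma InteractionBound.abs_meanField_le (h : InteractionBound v φ κ) (y : Pos) :
    |meanField v φ y| ≤ N + κ := by
  rw [← h.sum_norm_sq]
  exact _root_.abs_meanField_le h.measurable h.nonneg h.bound y

/-- The mean field at the `i`-th particle, composed with `p_i`. -/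
def meanFieldProj (h : InteractionBound v φ κ) (i : Fin N) : ManyBody N →L[ℂ] ManyBody N :=
  (mulOp (X := Config N) (W := fun x => meanField v φ (x i))
    ((measurable_meanField h.measurable φ).comp (measurable_pi_apply i))
    (fun x => h.abs_meanField_le (x i))).comp (orbProj φ i)

lemma meanFieldProj_coeFn (h : InteractionBound v φ κ) (i : Fin N) (f : ManyBody N) :
    meanFieldProj h i f =ᵐ[volume] fun x => ((meanField v φ (x i) : ℝ) : ℂ) * orbProj φ i f x :=
  mulOp_coeFn (X := Config N) (W := fun x => meanField v φ (x i))
    ((measurable_meanField h.measurable φ).comp (measurable_pi_apply i))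
    (fun x => h.abs_meanField_le (x i)) (orbProj φ i f)

/-- The difference of the interaction with the `i`-th particle and its mean field, composed
with `p_i`. -/
def relInteraction (h : InteractionBound v φ κ) (i : Fin N) : ManyBody N →L[ℂ] ManyBody N :=
  sumInterProj h i - meanFieldProj h i

/-- The size of this bound is irrelevant. It is needed because it depends only on `N` and `κ`, hence
is uniform in time, when the commutator formula is extended to the closure of the graph. -/
lemma norm_relInteraction_le (h : InteractionBound v φ κ) (i : Fin N) :
    ‖relInteraction h i‖ ≤ N * √κ + (N + κ) := by
  have hκ := h.nonneg
  refine (norm_sub_le _ _).trans (add_le_add ?_ ?_)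
  · refine (norm_sum_le _ _).trans ((Finset.sum_le_sum fun j _ => norm_interProj_le h _).trans ?_)
    rw [Finset.sum_const, nsmul_eq_mul]
    refine mul_le_mul_of_nonneg_right ?_ (Real.sqrt_nonneg _)
    have : (Finset.univ.erase i).attach.card ≤ N := by
      rw [Finset.card_attach]
      exact (Finset.card_le_univ _).trans (by simp)
    exact_mod_cast this
  · refine (ContinuousLinearMap.opNorm_comp_le _ _).trans ?_
    have h1 : ‖orbProj φ i‖ ≤ 1 := ContinuousLinearMap.opNorm_le_bound _ zero_le_one fun f => by
      rw [one_mul]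
      exact norm_orbProj_le h.orthonormal i f
    have h2 := norm_mulOp_le (X := Config N) (W := fun x => meanField v φ (x i))
      ((measurable_meanField h.measurable φ).comp (measurable_pi_apply i)) (by positivity)
      (fun x => h.abs_meanField_le (x i))
    exact (mul_le_mul h2 h1 (norm_nonneg _) (by positivity)).trans (by rw [mul_one])

lemma relInteraction_coeFn (h : InteractionBound v φ κ) (i : Fin N) (f : ManyBody N) :
    relInteraction h i f =ᵐ[volume] fun x => (((∑ j ∈ Finset.univ.erase i, v (x i - x j)) -
      meanField v φ (x i) : ℝ) : ℂ) * orbProj φ i f x := by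
  have h1 : sumInterProj h i f = ∑ j ∈ (Finset.univ.erase i).attach,
      interProj h (Finset.ne_of_mem_erase j.2).symm f := by
    simp only [sumInterProj, _root_.sum_apply]
  have h2 : ∀ᵐ x : Config N, ∀ j : {j // j ∈ Finset.univ.erase i},
      interProj h (Finset.ne_of_mem_erase j.2).symm f x =
        ((v (x i - x j) : ℝ) : ℂ) * orbProj φ i f x :=
    ae_all_iff.2 fun j => interProj_coeFn h _ f
  have h3 : relInteraction h i f = sumInterProj h i f - meanFieldProj h i f := rfl
  rw [h3]
  filter_upwards [Lp.coeFn_sub (sumInterProj h i f) (meanFieldProj h i f),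
    meanFieldProj_coeFn h i f, h2, (Lp.coeFn_finsetSum (Finset.univ.erase i).attach
      fun j => interProj h (Finset.ne_of_mem_erase j.2).symm f)] with x h4 h5 h6 h7
  rw [h4, Pi.sub_apply, h5, h1, h7, Finset.sum_apply, Finset.sum_congr rfl fun j _ => h6 j,
    ← Finset.sum_mul, ← sub_mul, Complex.ofReal_sub, Complex.ofReal_sum,
    ← Finset.sum_attach (Finset.univ.erase i) fun j => ((v (x i - x j) : ℝ) : ℂ)]

/-- The main estimate for the projected relative interaction. -/
lemma abs_im_inner_relInteraction_le (h : InteractionBound v φ κ) {ψ : ManyBody N}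
    (hψ : AntisymmetricOn Finset.univ ψ) (i : Fin N) :
    |(inner ℂ ψ (relInteraction h i ψ)).im| ≤
      2 * √(N * κ) * (‖orbCoproj φ i ψ‖ ^ 2 + ‖ψ‖ ^ 2 / N) := by
  -- The relative interaction is a real multiplication operator applied to `p_i ψ`, so its
  -- expectation in `p_i ψ` is real and only the component `q_i ψ` on the left contributes to the
  -- imaginary part.
  have h1 := inner_real_mul_self_im (relInteraction_coeFn h i ψ)
  have h2 : (inner ℂ ψ (relInteraction h i ψ)).im =
      (inner ℂ (orbCoproj φ i ψ) (relInteraction h i ψ)).im := by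
    nth_rewrite 1 [← orbProj_add_orbCoproj φ i ψ]
    rw [inner_add_left, Complex.add_im, h1, zero_add]
  rw [h2]
  exact (Complex.abs_im_le_norm _).trans
    (norm_inner_interaction_sub_meanField_le h hψ i (meanFieldProj_coeFn h i ψ))

end RelativeInteraction

end

noncomputable section

/-! ### Commutator with the Hamiltonian on test functions -/

section Graph

variable {n : ℕ} {w : Pos → ℝ} {c : ℝ}

/-- The part of the potential energy that does not depend on the particle `0`. -/
def spectatorPotential (w v : Pos → ℝ) (x : Config (n + 1)) : ℝ :=
  (∑ j ∈ Finset.univ.erase 0, w (x j)) +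
    ∑ i ∈ Finset.univ.erase 0, ∑ j ∈ Finset.Ioi i, v (x i - x j)

lemma spectatorPotential_update (w v : Pos → ℝ) (x : Config (n + 1)) (z : Pos) :
    spectatorPotential w v (Function.update x 0 z) = spectatorPotential w v x := by
  unfold spectatorPotential
  congr 1
  · refine Finset.sum_congr rfl fun j hj => ?_
    rw [Function.update_of_ne (Finset.ne_of_mem_erase hj)]
  · refine Finset.sum_congr rfl fun i hi => Finset.sum_congr rfl fun j hj => ?_
    rw [Function.update_of_ne (Finset.ne_of_mem_erase hi),
      Function.update_of_ne (Fin.ne_zero_of_lt (Finset.mem_Ioi.1 hj))]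

/-- The interaction with the particle `0`, relative to its mean field. -/
def relPotential (v : Pos → ℝ) (φ : Fin (n + 1) → OneBody) (x : Config (n + 1)) : ℝ :=
  (∑ j ∈ Finset.univ.erase 0, v (x 0 - x j)) - meanField v φ (x 0)

/-- The mean field at particle `0` is added and subtracted. The first bracket is the operator
governing the motion of `p_0`, the next two terms do not act on particle `0`, and the last is the
relative interaction. -/
lemma hamiltonianExpr_eq (w v : Pos → ℝ) (φ : Fin (n + 1) → OneBody) (g : Config (n + 1) → ℂ)
    (x : Config (n + 1)) : hamiltonianExpr w v g x =
      (-(particleLaplacian 0 g x) + ((w (x 0) + meanField v φ (x 0) : ℝ) : ℂ) * g x) -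
        (∑ j ∈ Finset.univ.erase 0, particleLaplacian j g x) +
        (spectatorPotential w v x : ℂ) * g x + (relPotential v φ x : ℂ) * g x := by
  have hI : Finset.Ioi (0 : Fin (n + 1)) = Finset.univ.erase 0 := by
    ext j
    simp
  unfold hamiltonianExpr
  rw [← Finset.add_sum_erase Finset.univ _ (Finset.mem_univ (0 : Fin (n + 1))),
    ← Finset.add_sum_erase Finset.univ (fun i => ∑ j ∈ Finset.Ioi i, ((v (x i - x j) : ℝ) : ℂ))
      (Finset.mem_univ (0 : Fin (n + 1))), hI, Finset.sum_add_distrib, Finset.sum_neg_distrib,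
    ← Finset.sum_mul]
  simp only [spectatorPotential, relPotential, Complex.ofReal_add, Complex.ofReal_sub,
    Complex.ofReal_sum]
  ring

lemma locallySqInt_spectatorPotential (hw : LocallySqInt w) :
    LocallySqInt (spectatorPotential (n := n) w (coulomb c)) :=
  (LocallySqInt.sum _ fun j _ => hw.comp_eval j).add
    (LocallySqInt.sum _ fun _ _ => LocallySqInt.sum _ fun _ hj =>
      locallySqInt_coulomb_sub c (Finset.mem_Ioi.1 hj).ne)

lemma locallySqInt_relPotential {φ : Fin (n + 1) → OneBody} {κ : ℝ}
    (h : InteractionBound (coulomb c) φ κ) : LocallySqInt (relPotential (coulomb c) φ) := by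
  have h1 : LocallySqInt (fun x : Config (n + 1) => -(meanField (coulomb c) φ (x 0))) := by
    refine locallySqInt_of_bounded (M := (n + 1 : ℕ) + κ) ((measurable_meanField h.measurable φ).comp
      (measurable_pi_apply 0)).neg fun x => ?_
    rw [abs_neg]
    exact h.abs_meanField_le _
  exact (LocallySqInt.sum _ fun j hj =>
    locallySqInt_coulomb_sub c (Finset.ne_of_mem_erase hj).symm).add h1

/-- The commutator of `p_0` with the Hamiltonian, compared with the commutator with the one-particle
mean field operator. -/
lemma inner_orbProj_commutator {φ : Fin (n + 1) → OneBody} {κ : ℝ} (hw : LocallySqInt w)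
    (h : InteractionBound (coulomb c) φ κ) {f g Hf Hg : ManyBody (n + 1)}
    {f' g' : Config (n + 1) → ℂ} (tf : IsTestFunction f') (tg : IsTestFunction g')
    (ef : f =ᵐ[volume] f') (eg : g =ᵐ[volume] g')
    (eHf : Hf =ᵐ[volume] hamiltonianExpr w (coulomb c) f')
    (eHg : Hg =ᵐ[volume] hamiltonianExpr w (coulomb c) g') :
    ∃ hf hg : ManyBody (n + 1),
      (hf =ᵐ[volume] fun x => -(particleLaplacian 0 f' x) +
        ((w (x 0) + meanField (coulomb c) φ (x 0) : ℝ) : ℂ) * f' x) ∧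
      (hg =ᵐ[volume] fun x => -(particleLaplacian 0 g' x) +
        ((w (x 0) + meanField (coulomb c) φ (x 0) : ℝ) : ℂ) * g' x) ∧
      inner ℂ f (orbProj φ 0 hg) - inner ℂ hf (orbProj φ 0 g) =
        inner ℂ f (orbProj φ 0 Hg) - inner ℂ Hf (orbProj φ 0 g) -
          inner ℂ (relInteraction h 0 f) g + inner ℂ f (relInteraction h 0 g) := by
  have hone : LocallySqInt (fun x : Config (n + 1) => w (x 0) + meanField (coulomb c) φ (x 0)) :=
    (hw.comp_eval 0).add (locallySqInt_of_bounded ((measurable_meanField h.measurable φ).comp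
      (measurable_pi_apply 0)) fun x => h.abs_meanField_le (x 0))
  have hs := locallySqInt_spectatorPotential (n := n) (c := c) hw
  have hr := locallySqInt_relPotential h
  -- All potentials are locally square integrable, so on a test function every piece of the
  -- Hamiltonian is separately in `L²` and the decomposition holds between vectors.
  have dec : ∀ {a Ha : ManyBody (n + 1)} {a' : Config (n + 1) → ℂ}, IsTestFunction a' →
      Ha =ᵐ[volume] hamiltonianExpr w (coulomb c) a' →
      ∃ (ha Ca Xa : ManyBody (n + 1)) (Da : Fin (n + 1) → ManyBody (n + 1)),
        (ha =ᵐ[volume] fun x => -(particleLaplacian 0 a' x) +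
          ((w (x 0) + meanField (coulomb c) φ (x 0) : ℝ) : ℂ) * a' x) ∧
        (Ca =ᵐ[volume] fun x => (spectatorPotential w (coulomb c) x : ℂ) * a' x) ∧
        (Xa =ᵐ[volume] fun x => (relPotential (coulomb c) φ x : ℂ) * a' x) ∧
        (∀ j, Da j =ᵐ[volume] particleLaplacian j a') ∧
        Ha = ha - (∑ j ∈ Finset.univ.erase 0, Da j) + Ca + Xa := by
    intro a Ha a' ta eHa
    have m1 : MemLp (fun x => -(particleLaplacian 0 a' x) +
          ((w (x 0) + meanField (coulomb c) φ (x 0) : ℝ) : ℂ) * a' x) 2 volume :=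
      ((ta.particleLaplacian 0).memLp 2).neg.add (hone.memLp_mul ta)
    have m2 := hs.memLp_mul ta
    have m3 := hr.memLp_mul ta
    have m4 : ∀ j, MemLp (particleLaplacian j a') 2 volume := fun j =>
      (ta.particleLaplacian j).memLp 2
    refine ⟨m1.toLp _, m2.toLp _, m3.toLp _, fun j => (m4 j).toLp _, m1.coeFn_toLp, m2.coeFn_toLp,
      m3.coeFn_toLp, fun j => (m4 j).coeFn_toLp, Lp.ext ?_⟩
    have m5 : ∀ᵐ x, ∀ j, ((m4 j).toLp (particleLaplacian j a')) x = particleLaplacian j a' x :=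
      ae_all_iff.2 fun j => (m4 j).coeFn_toLp
    filter_upwards [eHa, Lp.coeFn_add (m1.toLp _ - (∑ j ∈ Finset.univ.erase 0, (m4 j).toLp _) +
        m2.toLp _) (m3.toLp _),
      Lp.coeFn_add (m1.toLp _ - (∑ j ∈ Finset.univ.erase 0, (m4 j).toLp _)) (m2.toLp _),
      Lp.coeFn_sub (m1.toLp _) (∑ j ∈ Finset.univ.erase 0, (m4 j).toLp _),
      Lp.coeFn_finsetSum (Finset.univ.erase 0) fun j => (m4 j).toLp (particleLaplacian j a'),
      m1.coeFn_toLp, m2.coeFn_toLp, m3.coeFn_toLp, m5] with x h0 h1 h2 h3 h4 h5 h6 h7 h8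
    rw [h0, h1, Pi.add_apply, h2, Pi.add_apply, h3, Pi.sub_apply, h4, Finset.sum_apply, h5, h6, h7,
      Finset.sum_congr rfl fun j _ => h8 j, hamiltonianExpr_eq w (coulomb c) φ]
  obtain ⟨hf, Cf, Xf, Df, ehf, eCf, eXf, eDf, rfl⟩ := dec (a := f) tf eHf
  obtain ⟨hg, Cg, Xg, Dg, ehg, eCg, eXg, eDg, rfl⟩ := dec (a := g) tg eHg
  refine ⟨hf, hg, ehf, ehg, ?_⟩
  have sub : ∀ {W : Config (n + 1) → ℝ} {a Wa : ManyBody (n + 1)} {a' : Config (n + 1) → ℂ},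
      a =ᵐ[volume] a' → (Wa =ᵐ[volume] fun x => (W x : ℂ) * a' x) →
      Wa =ᵐ[volume] fun x => (W x : ℂ) * a x := by
    intro W a Wa a' h1 h2
    filter_upwards [h1, h2] with x h3 h4
    rw [h3, h4]
  have kD : ∀ j ∈ Finset.univ.erase (0 : Fin (n + 1)),
      inner ℂ f (orbProj φ 0 (Dg j)) = inner ℂ (Df j) (orbProj φ 0 g) := fun j hj =>
    inner_orbProj_particleLaplacian φ (Finset.ne_of_mem_erase hj) tf tg ef eg (eDf j) (eDg j)
  have kC : inner ℂ Cf (orbProj φ 0 g) = inner ℂ f (orbProj φ 0 Cg) :=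
    inner_real_mul (sub ef eCf) (orbProj_mul_coeFn φ 0
      (c := fun x => ((spectatorPotential w (coulomb c) x : ℝ) : ℂ))
      (fun x z => by rw [spectatorPotential_update]) (sub eg eCg))
  -- The operator `relInteraction` is multiplication by the relative potential after `p_0`; the
  -- adjoint order `p_0` after the multiplication is meaningful on the test function `g`.
  have kX1 : inner ℂ (relInteraction h 0 f) g = inner ℂ f (orbProj φ 0 Xg) := by
    rw [← inner_orbProj_left]
    exact inner_real_mul (relInteraction_coeFn h 0 f) (sub eg eXg)
  have kX2 : inner ℂ Xf (orbProj φ 0 g) = inner ℂ f (relInteraction h 0 g) :=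
    inner_real_mul (sub ef eXf) (relInteraction_coeFn h 0 g)
  simp only [map_add, map_sub, map_sum, inner_add_left, inner_add_right, inner_sub_left,
    inner_sub_right, sum_inner, inner_sum]
  rw [Finset.sum_congr rfl kD, kC, kX1, kX2]
  ring

/-- The derivative of `⟨f, p_0 g⟩` along the Hartree flow, for `f`, `g` in the graph of the
Hamiltonian on test functions. -/
lemma HartreeBound.hasDerivAt_inner_orbProj_graph {T : EReal} {φ : ℝ → Fin (n + 1) → OneBody}
    {τ M κ : ℝ} (h : HartreeBound w (coulomb c) φ T τ M) {t : ℝ} (ht : t ∈ Set.Ioo 0 τ)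
    (hI : InteractionBound (coulomb c) (φ t) κ) {p q : ManyBody (n + 1) × ManyBody (n + 1)}
    (hp : p ∈ hamiltonianGraph w (coulomb c)) (hq : q ∈ hamiltonianGraph w (coulomb c)) :
    HasDerivAt (fun s => inner ℂ p.1 (orbProj (φ s) 0 q.1))
      (Complex.I * (inner ℂ p.1 (orbProj (φ t) 0 q.2) - inner ℂ p.2 (orbProj (φ t) 0 q.1) -
        inner ℂ (relInteraction hI 0 p.1) q.1 + inner ℂ p.1 (relInteraction hI 0 q.1))) t := by
  obtain ⟨f', tf, ef, eHf⟩ := hp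
  obtain ⟨g', tg, eg, eHg⟩ := hq
  obtain ⟨hf, hg, ehf, ehg, e⟩ := inner_orbProj_commutator h.field hI tf tg ef eg eHf eHg
  rw [← e]
  exact h.hasDerivAt_inner_orbProj ht 0 tf tg ef eg ehf ehg

end Graph

end

noncomputable section

/-! ### Weak solutions of abstract Schrödinger equations -/

section WeakSolution

open Filter Topology Set

variable {E : Type*} [NormedAddCommGroup E] [InnerProductSpace ℂ E]

/-- `ψ` is a weak solution on `[0, τ]` of `i ∂ₜ ψ = H ψ`. -/
structure WeakSolution (H : E →ₗ.[ℂ] E) (τ : ℝ) (ψ : ℝ → E) : Prop where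
  continuous : Continuous ψ
  hasDerivAt : ∀ q ∈ H.graph, ∀ t ∈ Ioo 0 τ,
    HasDerivAt (fun s => inner ℂ q.1 (ψ s)) (-Complex.I * inner ℂ q.2 (ψ t)) t

/-- As `f` vanishes at `t`, the difference quotient is that of `f` paired with `g s`, so continuity
of `g` is enough. -/
lemma hasDerivAt_inner_of_eq_zero_left {f g : ℝ → E} {f' : E} {t : ℝ} (hf : HasDerivAt f f' t)
    (h0 : f t = 0) (hg : ContinuousAt g t) :
    HasDerivAt (fun s => inner ℂ (f s) (g s)) (inner ℂ f' (g t)) t := by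
  rw [hasDerivAt_iff_tendsto_slope] at hf ⊢
  have h1 := hf.inner (𝕜 := ℂ) (hg.tendsto.mono_left (nhdsWithin_le_nhds (s := {t}ᶜ)))
  refine h1.congr fun s => ?_
  simp only [slope_def_module, h0, sub_zero, inner_zero_left]
  rw [← Complex.coe_smul, inner_smul_left, Complex.conj_ofReal, Complex.real_smul]

/-- The product rule for `⟨u, P u⟩`, for a differentiable `u` and a continuous family `P` which
is differentiable at the fixed vector `u t`. -/
lemma hasDerivAt_inner_apply {u : ℝ → E} {u' : E} {P : ℝ → E →L[ℂ] E} {t : ℝ} {d : ℂ}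
    (hu : HasDerivAt u u' t) (hP : ContinuousAt P t)
    (hd : HasDerivAt (fun s => inner ℂ (u t) (P s (u t))) d t) :
    HasDerivAt (fun s => inner ℂ (u s) (P s (u s)))
      (inner ℂ u' (P t (u t)) + inner ℂ (u t) (P t u') + d) t := by
  -- The splitting is `⟨u s, P s (u s)⟩ = ⟨u s - u t, P s (u s)⟩ + ⟨u t, P s (u s - u t)⟩ + ⟨u t, P
  -- s (u t)⟩`.
  have h0 : HasDerivAt (fun s => u s - u t) u' t := hu.sub_const _
  have h1 := hasDerivAt_inner_of_eq_zero_left h0 (sub_self _) (hP.clm_apply hu.continuousAt)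
  have h2 : HasDerivAt (fun s => inner ℂ (u t) (P s (u s - u t))) (inner ℂ (u t) (P t u')) t := by
    rw [hasDerivAt_iff_tendsto_slope] at h0 ⊢
    have h3 := (tendsto_const_nhds (x := u t)).inner (𝕜 := ℂ)
      ((isBoundedBilinearMap_apply.continuous.tendsto (P t, u')).comp
        ((hP.tendsto.mono_left (nhdsWithin_le_nhds (s := {t}ᶜ))).prodMk_nhds h0))
    refine h3.congr fun s => ?_
    simp only [slope_def_module, Function.comp, sub_self, sub_zero, map_zero, inner_zero_right]
    rw [← Complex.coe_smul, map_smul, inner_smul_right, Complex.real_smul]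
  refine ((h1.add h2).add hd).congr_of_eventuallyEq (Eventually.of_forall fun s => ?_)
  simp only [Pi.add_apply, inner_sub_left, map_sub, inner_sub_right]
  ring

/-- The forward average `ε⁻¹ ∫_t^{t+ε} ψ`. -/
def forwardAverage (ψ : ℝ → E) (ε t : ℝ) : E := ε⁻¹ • ∫ s in t..t + ε, ψ s

variable [CompleteSpace E]

lemma hasDerivAt_forwardAverage {ψ : ℝ → E} (hψ : Continuous ψ) (ε t : ℝ) :
    HasDerivAt (forwardAverage ψ ε) (ε⁻¹ • (ψ (t + ε) - ψ t)) t := by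
  have h1 : HasDerivAt (fun u => ∫ s in (0 : ℝ)..u, ψ s) (ψ t) t :=
    (hψ.integral_hasStrictDerivAt 0 t).hasDerivAt
  have h2 : HasDerivAt (fun u => ∫ s in (0 : ℝ)..u + ε, ψ s) (ψ (t + ε)) t :=
    ((hψ.integral_hasStrictDerivAt 0 (t + ε)).hasDerivAt).comp_add_const t ε
  refine ((h2.sub h1).const_smul ε⁻¹).congr_of_eventuallyEq (Eventually.of_forall fun u => ?_)
  simp only [forwardAverage, Pi.sub_apply, Pi.smul_apply]
  rw [intervalIntegral.integral_interval_sub_left (hψ.intervalIntegrable _ _)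
    (hψ.intervalIntegrable _ _)]

lemma tendsto_forwardAverage {ψ : ℝ → E} (hψ : Continuous ψ) (t : ℝ) :
    Tendsto (fun ε => forwardAverage ψ ε t) (𝓝[>] 0) (𝓝 (ψ t)) := by
  have h1 : HasDerivAt (fun u => ∫ s in t..u, ψ s) (ψ t) t :=
    (hψ.integral_hasStrictDerivAt t t).hasDerivAt
  have h2 : HasDerivAt (fun ε => ∫ s in t..t + ε, ψ s) (ψ t) 0 :=
    HasDerivAt.comp_const_add t 0 (by simpa using h1)
  have h3 := (hasDerivAt_iff_tendsto_slope.1 h2).mono_left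
    (nhdsWithin_mono (0 : ℝ) fun x (hx : 0 < x) => hx.ne')
  refine h3.congr fun ε => ?_
  simp [slope_def_module, forwardAverage]

lemma inner_forwardAverage {ψ : ℝ → E} (hψ : Continuous ψ) (x : E) (ε t : ℝ) :
    inner ℂ x (forwardAverage ψ ε t) = (ε : ℂ)⁻¹ * ∫ s in t..t + ε, inner ℂ x (ψ s) := by
  have h := (innerSL ℂ x).intervalIntegral_comp_comm (hψ.intervalIntegrable (μ := volume) t (t + ε))
  simp only [innerSL_apply_apply] at h
  rw [forwardAverage, ← Complex.coe_smul, inner_smul_right, h, Complex.ofReal_inv]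

/-- Membership in a closed subspace is tested against its orthogonal complement, which reduces the
vector-valued integral to scalar ones. -/
lemma forwardAverage_mem {S : Submodule ℂ E} (hS : IsClosed (S : Set E)) {ψ : ℝ → E}
    (hψ : Continuous ψ) {ε t : ℝ} (hε : 0 ≤ ε) (h : ∀ s ∈ Icc t (t + ε), ψ s ∈ S) :
    forwardAverage ψ ε t ∈ S := by
  have h1 : Sᗮᗮ = S := by
    rw [Submodule.orthogonal_orthogonal_eq_closure, hS.submodule_topologicalClosure_eq]
  rw [← h1, Submodule.mem_orthogonal]
  intro v hv
  rw [inner_forwardAverage hψ, intervalIntegral.integral_congr (g := fun _ => (0 : ℂ)),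
    intervalIntegral.integral_zero, mul_zero]
  intro s hs
  rw [uIcc_of_le (by linarith)] at hs
  exact Submodule.inner_left_of_mem_orthogonal (h s hs) hv

lemma inner_graph_eq {H : E →ₗ.[ℂ] E} (hH : IsSelfAdjoint H) {p q : E × E} (hp : p ∈ H.graph)
    (hq : q ∈ H.graph) : inner ℂ p.2 q.1 = inner ℂ p.1 q.2 := by
  obtain ⟨x, hx1, hx2⟩ := (LinearPMap.mem_graph_iff H).1 hp
  obtain ⟨y, hy1, hy2⟩ := (LinearPMap.mem_graph_iff H).1 hq
  have h := LinearPMap.adjoint_isFormalAdjoint hH.dense_domain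
  rw [LinearPMap.isSelfAdjoint_def.1 hH] at h
  rw [← hx1, ← hx2, ← hy1, ← hy2]
  exact h x y

/-- The hypothesis places `p` in the graph of the adjoint, which coincides with that of `H`. -/
lemma mem_graph_of_forall_inner {H : E →ₗ.[ℂ] E} (hH : IsSelfAdjoint H) {p : E × E}
    (h : ∀ q ∈ H.graph, inner ℂ q.2 p.1 = inner ℂ q.1 p.2) : p ∈ H.graph := by
  have h1 : ∀ x : H.domain, inner ℂ p.2 (x : E) = inner ℂ p.1 (H x) := fun x => by
    have := h _ (H.mem_graph x)
    rw [← inner_conj_symm, ← this, inner_conj_symm]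
  have h2 : p.1 ∈ H.adjoint.domain := LinearPMap.mem_adjoint_domain_of_exists _ ⟨p.2, h1⟩
  have h3 := LinearPMap.adjoint_apply_eq hH.dense_domain ⟨p.1, h2⟩ h1
  have h4 : p ∈ H.adjoint.graph := (LinearPMap.mem_graph_iff _).2 ⟨⟨p.1, h2⟩, rfl, h3⟩
  rwa [LinearPMap.isSelfAdjoint_def.1 hH] at h4

namespace WeakSolution

variable {H : E →ₗ.[ℂ] E} {τ : ℝ} {ψ : ℝ → E}

/-- The forward averages of a weak solution are in the domain of `H` and solve the equation
strongly. -/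
lemma forwardAverage_mem_graph (hH : IsSelfAdjoint H) (h : WeakSolution H τ ψ) {ε t : ℝ}
    (hε : 0 < ε) (ht : 0 ≤ t) (htε : t + ε ≤ τ) :
    (forwardAverage ψ ε t, Complex.I • ε⁻¹ • (ψ (t + ε) - ψ t)) ∈ H.graph := by
  refine mem_graph_of_forall_inner hH fun q hq => ?_
  -- The weak equation integrated over `[t, t + ε]`.
  have h1 : ∫ s in t..t + ε, -Complex.I * inner ℂ q.2 (ψ s) =
      inner ℂ q.1 (ψ (t + ε)) - inner ℂ q.1 (ψ t) := by
    refine intervalIntegral.integral_eq_sub_of_hasDerivAt_of_le (by linarith)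
      (continuous_const.inner h.continuous).continuousOn
      (fun s hs => h.hasDerivAt q hq s ⟨by linarith [hs.1], by linarith [hs.2]⟩)
      ((continuous_const.mul (continuous_const.inner h.continuous)).intervalIntegrable _ _)
  rw [intervalIntegral.integral_const_mul] at h1
  rw [inner_forwardAverage h.continuous, inner_smul_right, ← Complex.coe_smul, inner_smul_right,
    inner_sub_right, ← h1, Complex.ofReal_inv]
  linear_combination ((ε : ℂ)⁻¹ * ∫ s in t..t + ε, inner ℂ q.2 (ψ s)) * Complex.I_mul_I

/-- A Grönwall estimate for `‖ψ‖² - ⟨ψ, P ψ⟩` with a time dependent observable `P`. -/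
theorem gronwall (hH : IsSelfAdjoint H) (h : WeakSolution H τ ψ) {t₁ : ℝ} (h0 : 0 ≤ t₁)
    (h1 : t₁ < τ) {P V : ℝ → E →L[ℂ] E} (hP : ContinuousOn P (Icc 0 t₁))
    (hder : ∀ p ∈ H.graph, ∀ t ∈ Ioo 0 t₁, HasDerivAt (fun s => inner ℂ p.1 (P s p.1))
      (Complex.I * (inner ℂ p.1 (P t p.2) - inner ℂ p.2 (P t p.1) - inner ℂ (V t p.1) p.1 +
        inner ℂ p.1 (V t p.1))) t)
    {S : Submodule ℂ E} (hS : IsClosed (S : Set E)) (hψS : ∀ t ∈ Ico 0 τ, ψ t ∈ S) {a b : ℝ}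
    (hV : ∀ t ∈ Ioo 0 t₁, ∀ f ∈ S, |(inner ℂ f (V t f)).im| ≤
      a * (‖f‖ ^ 2 - (inner ℂ f (P t f)).re + b * ‖f‖ ^ 2)) :
    ‖ψ t₁‖ ^ 2 - (inner ℂ (ψ t₁) (P t₁ (ψ t₁))).re + b * ‖ψ t₁‖ ^ 2 ≤
      Real.exp (2 * a * t₁) *
        (‖ψ 0‖ ^ 2 - (inner ℂ (ψ 0) (P 0 (ψ 0))).re + b * ‖ψ 0‖ ^ 2) := by
  -- The vector `ψ t` need not lie in the domain of `H`. Its forward averages do, are strongly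
  -- differentiable and remain in `S`, so the estimate is proved for them and then `ε → 0`. The
  -- restriction `ε < τ - t₁` keeps the averages inside the interval.
  have key : ∀ ε ∈ Ioo 0 (τ - t₁), ∀ u, u = forwardAverage ψ ε →
      ‖u t₁‖ ^ 2 - (inner ℂ (u t₁) (P t₁ (u t₁))).re + b * ‖u t₁‖ ^ 2 ≤
      Real.exp (2 * a * t₁) * (‖u 0‖ ^ 2 - (inner ℂ (u 0) (P 0 (u 0))).re + b * ‖u 0‖ ^ 2) := by
    intro ε hε u hu
    have hu' : ∀ t, HasDerivAt u (ε⁻¹ • (ψ (t + ε) - ψ t)) t := fun t => by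
      rw [hu]
      exact hasDerivAt_forwardAverage h.continuous ε t
    have huc : Continuous u := continuous_iff_continuousAt.2 fun t => (hu' t).continuousAt
    have huS : ∀ t ∈ Icc 0 t₁, u t ∈ S := fun t ht => by
      rw [hu]
      refine forwardAverage_mem hS h.continuous hε.1.le fun s hs => hψS s ?_
      exact ⟨by linarith [ht.1, hs.1], by linarith [ht.2, hs.2, hε.2]⟩
    let F : ℝ → ℝ := fun t => (inner ℂ (u t) (u t)).re - (inner ℂ (u t) (P t (u t))).re +
      b * (inner ℂ (u t) (u t)).re
    have hF : ∀ t, F t = ‖u t‖ ^ 2 - (inner ℂ (u t) (P t (u t))).re + b * ‖u t‖ ^ 2 := fun t => by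
      simp only [F, inner_self_eq_norm_sq_to_K, ← Complex.ofReal_pow, Complex.ofReal_re,
        Complex.coe_algebraMap]
    -- The terms with `H u` from the product rule cancel those supplied by `hder`. What remains of
    -- the derivative of `Re ⟨u, P u⟩` is `-2 Im ⟨u, V u⟩`, while `‖u‖²` is constant.
    have hFd : ∀ t ∈ Ioo 0 t₁, HasDerivAt F (2 * (inner ℂ (u t) (V t (u t))).im) t := by
      intro t ht
      obtain ⟨Hu, hHu⟩ : ∃ Hu, Hu = Complex.I • ε⁻¹ • (ψ (t + ε) - ψ t) := ⟨_, rfl⟩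
      have hg : (u t, Hu) ∈ H.graph := by
        rw [hu, hHu]
        exact h.forwardAverage_mem_graph hH hε.1 ht.1.le (by linarith [ht.2, hε.2])
      have d0 : HasDerivAt u (-Complex.I • Hu) t := by
        refine (hu' t).congr_deriv ?_
        rw [hHu, smul_smul, neg_mul, Complex.I_mul_I, neg_neg, one_smul]
      have d1 := hasDerivAt_inner_apply d0 (hP.continuousAt (Icc_mem_nhds ht.1 ht.2))
        (hder _ hg t ht)
      have d2 := d0.inner ℂ d0
      have sym := inner_graph_eq hH hg hg
      have d3 : HasDerivAt (fun s => (inner ℂ (u s) (u s)).re) 0 t := by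
        refine (Complex.reCLM.hasFDerivAt.comp_hasDerivAt t d2).congr_deriv ?_
        simp only at sym
        simp only [inner_smul_left, inner_smul_right, sym, map_neg, Complex.conj_I]
        simp
      have d4 := (Complex.reCLM.hasFDerivAt.comp_hasDerivAt t d1)
      refine ((d3.sub d4).add (d3.const_mul b)).congr_deriv ?_
      have e1 : (inner ℂ (V t (u t)) (u t)).im = -(inner ℂ (u t) (V t (u t))).im := by
        rw [← inner_conj_symm, Complex.conj_im]
      simp only [map_smul, inner_smul_left, inner_smul_right, map_neg, Complex.conj_I,
        Complex.reCLM_apply]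
      simp [e1]
      ring
    have hFc : ContinuousOn F (Icc 0 t₁) := by
      have c1 : ContinuousOn (fun t => inner ℂ (u t) (P t (u t))) (Icc 0 t₁) :=
        huc.continuousOn.inner (hP.clm_apply huc.continuousOn)
      have c2 : Continuous fun t => (inner ℂ (u t) (u t)).re :=
        Complex.continuous_re.comp (huc.inner huc)
      exact (c2.continuousOn.sub (Complex.continuous_re.comp_continuousOn c1)).add
        (continuous_const.mul c2).continuousOn
    have hE : ∀ t, HasDerivAt (fun t => Real.exp (-(2 * a * t)))
        (Real.exp (-(2 * a * t)) * -(2 * a)) t := fun t => by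
      have := ((hasDerivAt_id t).const_mul (2 * a)).neg.exp
      simpa using this
    have anti : AntitoneOn (fun t => F t * Real.exp (-(2 * a * t))) (Icc 0 t₁) := by
      refine antitoneOn_of_hasDerivWithinAt_nonpos (convex_Icc _ _)
        (hFc.mul (by fun_prop)) (f' := fun t => 2 * (inner ℂ (u t) (V t (u t))).im *
          Real.exp (-(2 * a * t)) + F t * (Real.exp (-(2 * a * t)) * -(2 * a))) ?_ ?_
      · intro t ht
        rw [interior_Icc] at ht
        exact ((hFd t ht).mul (hE t)).hasDerivWithinAt
      · intro t ht
        rw [interior_Icc] at ht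
        have b1 := hV t ht (u t) (huS t ⟨ht.1.le, ht.2.le⟩)
        rw [← hF] at b1
        have b2 := le_abs_self (inner ℂ (u t) (V t (u t))).im
        have b3 := Real.exp_pos (-(2 * a * t))
        nlinarith
    have fin := anti (left_mem_Icc.2 h0) (right_mem_Icc.2 h0) h0
    simp only [mul_zero, neg_zero, Real.exp_zero, mul_one] at fin
    rw [← hF, ← hF]
    rwa [Real.exp_neg, mul_inv_le_iff₀ (Real.exp_pos _), mul_comm] at fin
  have lim : ∀ t, Tendsto (fun ε => ‖forwardAverage ψ ε t‖ ^ 2 -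
      (inner ℂ (forwardAverage ψ ε t) (P t (forwardAverage ψ ε t))).re +
        b * ‖forwardAverage ψ ε t‖ ^ 2) (𝓝[>] 0)
      (𝓝 (‖ψ t‖ ^ 2 - (inner ℂ (ψ t) (P t (ψ t))).re + b * ‖ψ t‖ ^ 2)) := fun t => by
    have c : Continuous fun f : E => ‖f‖ ^ 2 - (inner ℂ f (P t f)).re + b * ‖f‖ ^ 2 :=
      ((continuous_norm.pow 2).sub (Complex.continuous_re.comp
        (continuous_id.inner (P t).continuous))).add (continuous_const.mul (continuous_norm.pow 2))
    exact (c.tendsto _).comp (tendsto_forwardAverage h.continuous t)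
  refine le_of_tendsto_of_tendsto (lim t₁) ((lim 0).const_mul _) ?_
  filter_upwards [Ioo_mem_nhdsGT (sub_pos.2 h1)] with ε hε
  exact key ε hε _ rfl

/-- The norm of a weak solution is conserved. -/
lemma norm_sq_eq (hH : IsSelfAdjoint H) (h : WeakSolution H τ ψ) {t : ℝ} (h0 : 0 ≤ t)
    (h1 : t < τ) : ‖ψ t‖ ^ 2 = ‖ψ 0‖ ^ 2 := by
  -- With `P = r • 1` and `V = 0` the estimate reads `(1 - r) ‖ψ t‖² ≤ (1 - r) ‖ψ 0‖²`; `r = 0` and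
  -- `r = 2` give the two inequalities.
  have h2 := fun r : ℂ => h.gronwall hH h0 h1 (P := fun _ => r • 1) (V := fun _ => 0)
    continuousOn_const (fun p hp t _ => by
      have e : inner ℂ p.2 p.1 = inner ℂ p.1 p.2 := inner_graph_eq hH hp hp
      simpa [inner_smul_right, e] using hasDerivAt_const t (inner ℂ p.1 (r • p.1))) (S := ⊤)
    isClosed_univ (fun _ _ => trivial) (a := 0) (b := 0) (by simp)
  have h3 := h2 0
  have h4 := h2 2
  simp [← Complex.ofReal_pow] at h3 h4
  linarith

end WeakSolution

end WeakSolution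

end

noncomputable section

/-! ### The graph of the Hamiltonian -/

section HamiltonianGraph

variable {N : ℕ} {w v : Pos → ℝ}

/-- `LinearPMap.closure` leaves a non-closable operator unchanged; keeping both alternatives makes a
proof of closability unnecessary. -/
lemma graph_hamiltonian_eq (w v : Pos → ℝ) :
    (hamiltonian N w v).graph = hamiltonianGraph w v ∨
      (hamiltonian N w v).graph = (hamiltonianGraph w v).topologicalClosure := by
  have h : (hamiltonianGraph w v).toLinearPMap.graph = hamiltonianGraph (N := N) w v :=
    Submodule.toLinearPMap_graph_eq _ (hamiltonianGraph_functional w v)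
  by_cases hc : (hamiltonianGraph (N := N) w v).toLinearPMap.IsClosable
  · right
    rw [hamiltonian, ← hc.graph_closure_eq_closure_graph, h]
  · left
    rw [hamiltonian, LinearPMap.closure_def' hc, h]

lemma graph_hamiltonian_le (w v : Pos → ℝ) :
    (hamiltonian N w v).graph ≤ (hamiltonianGraph w v).topologicalClosure := by
  rcases graph_hamiltonian_eq (N := N) w v with h | h
  · exact h.le.trans (Submodule.le_topologicalClosure _)
  · exact h.le

lemma particleLaplacian_permConfig (σ : Equiv.Perm (Fin N)) (j : Fin N) (η : Config N → ℂ)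
    (x : Config N) : particleLaplacian j (fun y => η (permConfig σ y)) x =
      particleLaplacian (σ.symm j) η (permConfig σ x) := by
  have h : ∀ y, permConfig σ (Function.update x j y) =
      Function.update (permConfig σ x) (σ.symm j) y := fun y => by
    funext i
    by_cases hi : i = σ.symm j
    · subst hi
      simp [permConfig]
    · rw [Function.update_of_ne hi]
      simp only [permConfig]
      rw [Function.update_of_ne]
      rintro rfl
      simp at hi
  simp only [particleLaplacian, h]
  simp [permConfig]

/-- For even `v` the sum over pairs is half of the sum over all ordered pairs without the diagonal,
and the latter is invariant under relabelling. -/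
lemma sum_pair_permConfig (hv : ∀ x, v (-x) = v x) (σ : Equiv.Perm (Fin N)) (x : Config N) :
    ∑ i, ∑ j ∈ Finset.Ioi i, v (permConfig σ x i - permConfig σ x j) =
      ∑ i, ∑ j ∈ Finset.Ioi i, v (x i - x j) := by
  have h : ∀ y : Config N, 2 * ∑ i, ∑ j ∈ Finset.Ioi i, v (y i - y j) =
      ∑ i, ∑ j, v (y i - y j) - ∑ i : Fin N, v (y i - y i) := fun y => by
    have h1 := Finset.sum_sum_Ioi_add_eq_sum_sum_off_diag fun i j => v (y i - y j)
    have h2 : ∀ i j, v (y j - y i) = v (y i - y j) := fun i j => by rw [← hv, neg_sub]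
    rw [Finset.mul_sum, ← Finset.sum_sub_distrib]
    simp only [h2, ← two_mul, ← Finset.mul_sum] at h1 ⊢
    rw [h1]
    refine Finset.sum_congr rfl fun i _ => ?_
    rw [eq_sub_iff_add_eq, ← Finset.sum_compl_add_sum {i}, Finset.sum_singleton]
  have h1 := h x
  have h2 := h (permConfig σ x)
  have h3 : ∑ i, ∑ j, v (permConfig σ x i - permConfig σ x j) = ∑ i, ∑ j, v (x i - x j) := by
    rw [← Equiv.sum_comp σ fun i => ∑ j, v (x i - x j)]
    exact Finset.sum_congr rfl fun i _ => Equiv.sum_comp σ fun j => v (x (σ i) - x j)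
  have h4 : ∑ i, v (permConfig σ x i - permConfig σ x i) = ∑ i, v (x i - x i) := by
    simp
  rw [h3, h4, ← h1] at h2
  linarith

lemma hamiltonianExpr_permConfig (hv : ∀ x, v (-x) = v x) (σ : Equiv.Perm (Fin N))
    (η : Config N → ℂ) (x : Config N) : hamiltonianExpr w v (fun y => η (permConfig σ y)) x =
      hamiltonianExpr w v η (permConfig σ x) := by
  have h := congrArg (fun r : ℝ => (r : ℂ)) (sum_pair_permConfig hv σ x)
  simp only [Complex.ofReal_sum] at h
  simp only [hamiltonianExpr, particleLaplacian_permConfig, h]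
  congr 1
  rw [← Equiv.sum_comp σ]
  simp [permConfig]

lemma IsTestFunction.comp_permConfig {η : Config N → ℂ} (h : IsTestFunction η)
    (σ : Equiv.Perm (Fin N)) : IsTestFunction fun x => η (permConfig σ x) := by
  have hc : ContDiff ℝ ((⊤ : ℕ∞) : WithTop ℕ∞) (permConfig σ) :=
    contDiff_pi.2 fun i => contDiff_apply _ _ (σ i)
  refine ⟨h.1.comp hc, ?_⟩
  let e : Config N ≃ₜ Config N :=
    { toFun := permConfig σ
      invFun := permConfig σ.symm
      left_inv := fun x => by simpa using permConfig_permConfig_symm σ.symm x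
      right_inv := permConfig_permConfig_symm σ
      continuous_toFun := hc.continuous
      continuous_invFun := continuous_pi fun i => continuous_apply (σ.symm i) }
  exact h.2.comp_homeomorph e

lemma permOp_mem_hamiltonianGraph (hv : ∀ x, v (-x) = v x) (σ : Equiv.Perm (Fin N))
    {p : ManyBody N × ManyBody N} (hp : p ∈ hamiltonianGraph w v) :
    (permOp σ p.1, permOp σ p.2) ∈ hamiltonianGraph w v := by
  obtain ⟨η, h, a, b⟩ := hp
  refine ⟨_, h.comp_permConfig σ, permOp_coeFn σ a, ?_⟩
  refine (permOp_coeFn σ b).trans (Filter.Eventually.of_forall fun x => ?_)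
  exact (hamiltonianExpr_permConfig hv σ η x).symm

lemma permOp_mem_graph (hv : ∀ x, v (-x) = v x) (σ : Equiv.Perm (Fin N))
    {p : ManyBody N × ManyBody N} (hp : p ∈ (hamiltonian N w v).graph) :
    (permOp σ p.1, permOp σ p.2) ∈ (hamiltonian N w v).graph := by
  rcases graph_hamiltonian_eq (N := N) w v with h | h <;> rw [h] at hp ⊢
  · exact permOp_mem_hamiltonianGraph hv σ hp
  · have hc : Continuous fun p : ManyBody N × ManyBody N => (permOp σ p.1, permOp σ p.2) := by
      fun_prop
    exact map_mem_closure (f := fun p : ManyBody N × ManyBody N => (permOp σ p.1, permOp σ p.2)) hc hp fun q hq => permOp_mem_hamiltonianGraph hv σ hq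

end HamiltonianGraph

/-! ### Continuity of the projections and extension to the domain of the Hamiltonian -/

section Projection

open Filter Topology Set

/-- Tensoring with an orbital depends on it continuously in operator norm, and so does the adjoint.
Continuity of the orbitals in `L²` thus gives norm continuity of `p_m` in time. -/
lemma continuous_rankOne {N : ℕ} (m : Fin N) :
    Continuous fun p : OneBody × OneBody => rankOne m p.1 p.2 := by
  have h1 : Continuous fun p : OneBody × OneBody => tensor (X := Config N) p.1 :=
    (tensor (X := Config N)).continuous.comp continuous_fst
  have h2 : Continuous fun p : OneBody × OneBody =>
      ContinuousLinearMap.adjoint (tensor (X := Config N) p.2) :=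
    ContinuousLinearMap.adjoint.continuous.comp
      ((tensor (X := Config N)).continuous.comp continuous_snd)
  exact h2.clm_comp (continuous_const.clm_comp h1)

lemma continuous_sum_diag {ι A B : Type*} [Fintype ι] [TopologicalSpace A] [TopologicalSpace B]
    [AddCommMonoid B] [ContinuousAdd B] {r : A × A → B} (hr : Continuous r) :
    Continuous fun f : ι → A => ∑ k, r (f k, f k) :=
  continuous_finsetSum _ fun k _ => hr.comp ((continuous_apply k).prodMk (continuous_apply k))

lemma continuous_orbProj {N : ℕ} (m : Fin N) :
    Continuous fun φ : Fin N → OneBody => orbProj φ m :=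
  continuous_sum_diag (continuous_rankOne m)

lemma tendstoUniformlyOn_inner_apply {E X : Type*} [NormedAddCommGroup E] [InnerProductSpace ℂ E]
    {B : X → E →L[ℂ] E} {s : Set X} {M : ℝ} (hB : ∀ x ∈ s, ‖B x‖ ≤ M) {f g : ℕ → E} {f₀ g₀ : E}
    (hf : Tendsto f atTop (𝓝 f₀)) (hg : Tendsto g atTop (𝓝 g₀)) :
    TendstoUniformlyOn (fun k x => inner ℂ (f k) (B x (g k))) (fun x => inner ℂ f₀ (B x g₀))
      atTop s := by
  have h1 : Tendsto (fun k => ‖f₀ - f k‖ * (M * ‖g k‖) + ‖f₀‖ * (M * ‖g₀ - g k‖)) atTop (𝓝 0) := by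
    have h2 : Tendsto (fun k => ‖f₀ - f k‖ * (M * ‖g k‖) + ‖f₀‖ * (M * ‖g₀ - g k‖)) atTop
        (𝓝 (‖f₀ - f₀‖ * (M * ‖g₀‖) + ‖f₀‖ * (M * ‖g₀ - g₀‖))) :=
      ((hf.const_sub f₀).norm.mul (hg.norm.const_mul M)).add
        (((hg.const_sub g₀).norm.const_mul M).const_mul _)
    simpa using h2
  rw [Metric.tendstoUniformlyOn_iff]
  intro ε hε
  filter_upwards [h1.eventually_lt_const hε] with k hk x hx
  refine lt_of_le_of_lt ?_ hk
  rw [dist_eq_norm]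
  have e : inner ℂ f₀ (B x g₀) - inner ℂ (f k) (B x (g k)) =
      inner ℂ (f₀ - f k) (B x (g k)) + inner ℂ f₀ (B x (g₀ - g k)) := by
    rw [map_sub, inner_sub_left, inner_sub_right]
    ring
  have b : ∀ y, ‖B x y‖ ≤ M * ‖y‖ := fun y =>
    (B x).le_of_opNorm_le (hB x hx) y
  rw [e]
  exact (norm_add_le _ _).trans (add_le_add
    ((norm_inner_le_norm _ _).trans (mul_le_mul_of_nonneg_left (b _) (norm_nonneg _)))
    ((norm_inner_le_norm _ _).trans (mul_le_mul_of_nonneg_left (b _) (norm_nonneg _))))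

/-- A derivative formula for matrix elements extends from a graph to its closure. -/
lemma hasDerivAt_inner_apply_of_mem_closure {E : Type*} [NormedAddCommGroup E]
    [InnerProductSpace ℂ E] {G : Set (E × E)} {P V : ℝ → E →L[ℂ] E} {s : Set ℝ} (hs : IsOpen s)
    {M : ℝ} (hP : ∀ t ∈ s, ‖P t‖ ≤ M) (hV : ∀ t ∈ s, ‖V t‖ ≤ M)
    (h : ∀ p ∈ G, ∀ t ∈ s, HasDerivAt (fun s => inner ℂ p.1 (P s p.1))
      (Complex.I * (inner ℂ p.1 (P t p.2) - inner ℂ p.2 (P t p.1) - inner ℂ (V t p.1) p.1 +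
        inner ℂ p.1 (V t p.1))) t)
    {p : E × E} (hp : p ∈ closure G) {t : ℝ} (ht : t ∈ s) :
    HasDerivAt (fun s => inner ℂ p.1 (P s p.1))
      (Complex.I * (inner ℂ p.1 (P t p.2) - inner ℂ p.2 (P t p.1) - inner ℂ (V t p.1) p.1 +
        inner ℂ p.1 (V t p.1))) t := by
  obtain ⟨q, hq, hlim⟩ := mem_closure_iff_seq_limit.1 hp
  have l1 : Tendsto (fun k => (q k).1) atTop (𝓝 p.1) := (continuous_fst.tendsto _).comp hlim
  have l2 : Tendsto (fun k => (q k).2) atTop (𝓝 p.2) := (continuous_snd.tendsto _).comp hlim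
  have uV := tendstoUniformlyOn_inner_apply hV l1 l1
  have uV' : TendstoUniformlyOn (fun k x => inner ℂ (V x (q k).1) (q k).1)
      (fun x => inner ℂ (V x p.1) p.1) atTop s := by
    have := Complex.conjLIE.isometry.uniformContinuous.comp_tendstoUniformlyOn uV
    refine (this.congr (Eventually.of_forall fun k x _ => ?_)).congr_right fun x _ => ?_
    · exact inner_conj_symm _ _
    · exact inner_conj_symm _ _
  -- The operator bounds make the derivatives converge uniformly on `s`; together with pointwise
  -- convergence of the matrix elements this yields the derivative of the limit.
  have u := ((((tendstoUniformlyOn_inner_apply hP l1 l2).sub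
    (tendstoUniformlyOn_inner_apply hP l2 l1)).sub uV').add uV)
  have u' := ((lipschitzWith_smul Complex.I).uniformContinuous (β := ℂ)).comp_tendstoUniformlyOn u
  refine hasDerivAt_of_tendstoUniformlyOn (f := fun k s => inner ℂ (q k).1 (P s (q k).1))
    hs u' (Eventually.of_forall fun k x hx => ?_)
    (fun x _ => ?_) ht
  · exact h (q k) (hq k) x hx
  · exact l1.inner (((P x).continuous.tendsto _).comp l1)

end Projection

end

noncomputable section

/-! ### Solutions of the many-body Schrödinger equation -/

section Schrodinger

open Filter Topology Set

variable {N : ℕ} {w v : Pos → ℝ} {T : EReal} {ψ : ℝ → ManyBody N} {τ : ℝ}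

/-- Constant extension beyond `[0, τ]` yields a function continuous on the whole line, so that
forward averages are defined without side conditions; the equation is claimed only on `(0, τ)`. -/
lemma IsSchrodingerSolution.weakSolution {H : ManyBody N →ₗ.[ℂ] ManyBody N}
    (h : IsSchrodingerSolution H T ψ) (hτ : 0 ≤ τ) (hsub : Icc 0 τ ⊆ timeInterval T) :
    WeakSolution H τ (IccExtend hτ fun t => ψ t) := by
  refine ⟨(h.1.mono hsub).domRestrict.Icc_extend', fun q hq t ht => ?_⟩
  obtain ⟨x, hx1, hx2⟩ := (LinearPMap.mem_graph_iff H).1 hq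
  have h1 := (h.2 x t (hsub ⟨ht.1.le, ht.2.le⟩)).hasDerivAt
    (Filter.mem_of_superset (Icc_mem_nhds ht.1 ht.2) hsub)
  rw [hx1, hx2] at h1
  rw [IccExtend_of_mem hτ (fun t : Icc 0 τ => ψ t) ⟨ht.1.le, ht.2.le⟩]
  refine h1.congr_of_eventuallyEq ?_
  filter_upwards [Icc_mem_nhds ht.1 ht.2] with s hs
  rw [IccExtend_of_mem hτ (fun t : Icc 0 τ => ψ t) hs]

/-- Relabelling preserves the graph of the Hamiltonian, so it maps weak solutions to weak solutions,
and the weak equation is linear. -/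
lemma WeakSolution.permOp_add (hv : ∀ x, v (-x) = v x)
    (h : WeakSolution (hamiltonian N w v) τ ψ) (σ : Equiv.Perm (Fin N)) :
    WeakSolution (hamiltonian N w v) τ (fun t => permOp σ (ψ t) + ψ t) := by
  refine ⟨((permOp σ).continuous.comp h.continuous).add h.continuous, fun q hq t ht => ?_⟩
  have e : ∀ f g : ManyBody N, inner ℂ f (permOp σ g) = inner ℂ (permOp σ.symm f) g := fun f g => by
    rw [inner_permOp_left, Equiv.symm_symm]
  simp only [inner_add_right, e, mul_add]
  exact (h.hasDerivAt _ (permOp_mem_graph hv σ.symm hq) t ht).add (h.hasDerivAt q hq t ht)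

/-- The antisymmetric wave functions. -/
def antisymmetricSubmodule (N : ℕ) : Submodule ℂ (ManyBody N) where
  carrier := {f | AntisymmetricOn Finset.univ f}
  add_mem' := fun {f g} hf hg i hi j hj hij => by
    rw [map_add, hf i hi j hj hij, hg i hi j hj hij, neg_add]
  zero_mem' := fun i _ j _ _ => by simp
  smul_mem' := fun c f hf i hi j hj hij => by
    rw [map_smul, hf i hi j hj hij, smul_neg]

lemma isClosed_antisymmetricSubmodule (N : ℕ) :
    IsClosed (antisymmetricSubmodule N : Set (ManyBody N)) := by
  have e : (antisymmetricSubmodule N : Set (ManyBody N)) =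
      ⋂ (i : Fin N) (j : Fin N) (_ : i ≠ j), {f | permOp (Equiv.swap i j) f = -f} := by
    ext f
    simp [antisymmetricSubmodule, AntisymmetricOn]
  rw [e]
  exact isClosed_iInter fun i => isClosed_iInter fun j => isClosed_iInter fun _ =>
    isClosed_eq (permOp _).continuous continuous_neg

/-- Antisymmetry is preserved by the Schrödinger equation. -/
lemma WeakSolution.antisymmetricOn (hv : ∀ x, v (-x) = v x)
    (hH : IsSelfAdjoint (hamiltonian N w v)) (h : WeakSolution (hamiltonian N w v) τ ψ)
    (h0 : AntisymmetricOn Finset.univ (ψ 0)) {t : ℝ} (ht : t ∈ Ico 0 τ) :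
    AntisymmetricOn Finset.univ (ψ t) := by
  intro i hi j hj hij
  -- The sum of `ψ` and its transposed version is a weak solution that vanishes at time `0`;
  -- conservation of the norm keeps it zero.
  have h1 := (h.permOp_add hv (Equiv.swap i j)).norm_sq_eq hH ht.1 ht.2
  rw [h0 i hi j hj hij, neg_add_cancel, norm_zero] at h1
  exact eq_neg_of_add_eq_zero_left (norm_eq_zero.1 (pow_eq_zero_iff two_ne_zero |>.1 (by simpa using h1)))

lemma norm_sq_orbCoproj {M : ℕ} {φ : Fin M → OneBody} (hφ : Orthonormal ℂ φ) (m : Fin N)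
    (f : ManyBody N) : ‖orbCoproj φ m f‖ ^ 2 = ‖f‖ ^ 2 - (inner ℂ f (orbProj φ m f)).re := by
  have h1 := norm_sq_orbProj_add hφ m f
  have h2 : (inner ℂ f (orbProj φ m f)).re = ‖orbProj φ m f‖ ^ 2 := by
    rw [← inner_self_eq_norm_sq (𝕜 := ℂ), inner_orbProj_left, orbProj_orbProj hφ]
    rfl
  linarith

end Schrodinger

section MainEstimate

open Filter Topology Set

variable {n : ℕ} {w : Pos → ℝ} {c : ℝ} {T : EReal} {φ : ℝ → Fin (n + 1) → OneBody} {τ M κ : ℝ}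

lemma norm_orbProj_le_one {N L : ℕ} {φ : Fin L → OneBody} (hφ : Orthonormal ℂ φ) (m : Fin N) :
    ‖orbProj φ m‖ ≤ 1 :=
  ContinuousLinearMap.opNorm_le_bound _ zero_le_one fun f => by
    rw [one_mul]
    exact norm_orbProj_le hφ m f

/-- The derivative of `⟨f, p_0 f⟩` along the Hartree flow, for `f` in the domain of the
Hamiltonian. -/
lemma HartreeBound.hasDerivAt_inner_orbProj_domain (h : HartreeBound w (coulomb c) φ T τ M)
    {V : ℝ → ManyBody (n + 1) →L[ℂ] ManyBody (n + 1)}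
    (hV : ∀ t ∈ Ioo 0 τ, ∃ hI : InteractionBound (coulomb c) (φ t) κ, V t = relInteraction hI 0)
    {p : ManyBody (n + 1) × ManyBody (n + 1)}
    (hp : p ∈ (hamiltonian (n + 1) w (coulomb c)).graph) {t : ℝ} (ht : t ∈ Ioo 0 τ) :
    HasDerivAt (fun s => inner ℂ p.1 (orbProj (φ s) 0 p.1))
      (Complex.I * (inner ℂ p.1 (orbProj (φ t) 0 p.2) - inner ℂ p.2 (orbProj (φ t) 0 p.1) -
        inner ℂ (V t p.1) p.1 + inner ℂ p.1 (V t p.1))) t := by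
  have hp' := graph_hamiltonian_le w (coulomb c) hp
  rw [← SetLike.mem_coe, Submodule.topologicalClosure_coe] at hp'
  refine hasDerivAt_inner_apply_of_mem_closure (P := fun s => orbProj (φ s) 0) isOpen_Ioo
    (M := max 1 ((n + 1 : ℕ) * √κ + ((n + 1 : ℕ) + κ))) (fun s hs => ?_) (fun s hs => ?_)
    (G := SetLike.coe (hamiltonianGraph w (coulomb c))) (fun q hq s hs => ?_)
    hp' ht
  · exact (norm_orbProj_le_one (hV s hs).1.orthonormal 0).trans (le_max_left _ _)
  · obtain ⟨hI, e⟩ := hV s hs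
    rw [e]
    exact (norm_relInteraction_le hI 0).trans (le_max_right _ _)
  · obtain ⟨hI, e⟩ := hV s hs
    rw [e]
    exact h.hasDerivAt_inner_orbProj_graph hs hI hq hq

/-- Grönwall is applied with `P = p_0` on the antisymmetric subspace, where `‖ψ‖² - Re ⟨ψ, p_0 ψ⟩ =
α_n`. The shift `b = 1 / N` absorbs the inhomogeneous term of the estimate and produces the summand
with `exp - 1`. -/
lemma HartreeBound.alphaN_le (h : HartreeBound w (coulomb c) φ T τ M)
    (hI : ∀ t ∈ Ico 0 τ, InteractionBound (coulomb c) (φ t) κ)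
    (hH : IsSelfAdjoint (hamiltonian (n + 1) w (coulomb c))) {ψ : ℝ → ManyBody (n + 1)}
    (hψ : WeakSolution (hamiltonian (n + 1) w (coulomb c)) τ ψ) (h1 : ‖ψ 0‖ = 1)
    (ha : IsAntisymmetric (ψ 0)) {t : ℝ} (ht : t ∈ Ico 0 τ) (hsub : Icc 0 t ⊆ timeInterval T) :
    alphaN (ψ t) (φ t) ≤ Real.exp (4 * √((n + 1 : ℕ) * κ) * t) * alphaN (ψ 0) (φ 0) +
      (Real.exp (4 * √((n + 1 : ℕ) * κ) * t) - 1) * ((n + 1 : ℕ) : ℝ)⁻¹ := by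
  obtain ⟨ht0, htτ⟩ := ht
  have hτ : 0 < τ := ht0.trans_lt htτ
  have hanti : ∀ s ∈ Ico 0 τ, AntisymmetricOn Finset.univ (ψ s) := fun s hs =>
    hψ.antisymmetricOn (coulomb_neg c) hH
      (antisymmetricOn_of_permOp (permOp_eq_of_isAntisymmetric ha)) hs
  classical
  -- The value `0` only serves to define `V` at all times; on `(0, τ)` the interaction bound holds.
  let V : ℝ → ManyBody (n + 1) →L[ℂ] ManyBody (n + 1) := fun s =>
    if hs : InteractionBound (coulomb c) (φ s) κ then relInteraction hs 0 else 0
  have hV : ∀ s ∈ Ioo 0 τ, ∃ hI : InteractionBound (coulomb c) (φ s) κ,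
      V s = relInteraction hI 0 := fun s hs =>
    ⟨hI s ⟨hs.1.le, hs.2⟩, dif_pos (hI s ⟨hs.1.le, hs.2⟩)⟩
  have hP : ContinuousOn (fun s => orbProj (N := n + 1) (φ s) 0) (Icc 0 t) :=
    (continuous_orbProj 0).comp_continuousOn
      (continuousOn_pi.2 fun i => ((h.solution i).1).mono hsub)
  have main := hψ.gronwall hH ht0 htτ hP (V := V)
    (fun p hp s hs => h.hasDerivAt_inner_orbProj_domain hV hp ⟨hs.1, hs.2.trans htτ⟩)
    (isClosed_antisymmetricSubmodule (n + 1)) hanti (a := 2 * √((n + 1 : ℕ) * κ))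
    (b := ((n + 1 : ℕ) : ℝ)⁻¹) (fun s hs f hf => by
      obtain ⟨hIs, e⟩ := hV s ⟨hs.1, hs.2.trans htτ⟩
      have := abs_im_inner_relInteraction_le hIs hf 0
      rw [norm_sq_orbCoproj hIs.orthonormal, div_eq_inv_mul] at this
      rw [e]
      exact this)
  have hN : Orthonormal ℂ (φ 0) := (hI 0 ⟨le_rfl, hτ⟩).orthonormal
  have ht : t ∈ Ico 0 τ := ⟨ht0, htτ⟩
  have hn := hψ.norm_sq_eq hH ht0 htτ
  rw [h1, one_pow] at hn
  rw [← norm_sq_orbCoproj (hI t ht).orthonormal, ← norm_sq_orbCoproj hN,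
    ← alphaN_eq_norm_sq (hanti t ht) (hI t ht).orthonormal,
    ← alphaN_eq_norm_sq (hanti 0 ⟨le_rfl, hτ⟩) hN, hn, h1] at main
  have e : 2 * (2 * √((n + 1 : ℕ) * κ)) * t = 4 * √((n + 1 : ℕ) * κ) * t := by ring
  rw [e] at main
  linarith

end MainEstimate

end

/-! ### Assembly of the theorem -/

theorem mainTheorem4 (A D : ℝ) (hA : 0 < A) (hD : 0 < D) :
    ∃ K C : ℝ, 0 < K ∧ 0 < C ∧
      ∀ (N : ℕ) (_ : 0 < N)
        (v : Pos → ℝ) (_ : v = (fun x => ‖x‖⁻¹) ∨ v = (fun x => -‖x‖⁻¹))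
        (w : Pos → ℝ) (_ : IsLocallySquareIntegrable w)
        (T : EReal) (_ : 0 < T)
        (φ : ℝ → Fin N → OneBody)
        (_ : IsHartreeSolution w (scaledInteraction (2 / 3) N v) T φ)
        (_ : Orthonormal ℂ (φ 0))
        (_ : ∀ t ∈ timeInterval T, kineticEnergy (φ t) ≤ ENNReal.ofReal (A * N))
        (_ : ∀ t ∈ timeInterval T, eLpNorm (density (φ t)) ∞ volume ≤ ENNReal.ofReal D),
        (∀ t ∈ timeInterval T,
          supSqConvDensity (scaledInteraction (2 / 3) N v) (φ t)
            ≤ ENNReal.ofReal (K * (N : ℝ)⁻¹)) ∧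
        ∀ (_ : IsSelfAdjoint (hamiltonian N w (scaledInteraction (2 / 3) N v)))
          (ψ : ℝ → ManyBody N)
          (_ : IsSchrodingerSolution
            (hamiltonian N w (scaledInteraction (2 / 3) N v)) T ψ)
          (_ : ‖ψ 0‖ = 1) (_ : IsAntisymmetric (ψ 0)),
          ∀ t ∈ timeInterval T,
            alphaN (ψ t) (φ t) ≤ Real.exp (C * t) * alphaN (ψ 0) (φ 0)
              + (Real.exp (C * t) - 1) * (N : ℝ)⁻¹ := by
  have hs := sphereArea_nonneg
  -- With `K = sphereArea * D + 1` and `κ = K / N` one has `N κ = K`, so the Grönwall rate `4 √(N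
  -- κ)` becomes `4 √K`. The kinetic energy bound enters only through conservation of
  -- orthonormality.
  refine ⟨sphereArea * D + 1, 4 * √(sphereArea * D + 1), by positivity, by positivity, ?_⟩
  intro N hN v hv w hw T hT φ hφ h0 hkin hρ
  obtain ⟨c, hc, hvc⟩ := exists_scaledInteraction_eq_coulomb (N := N) hv
  rw [hvc] at hφ ⊢
  have hI : ∀ t ∈ timeInterval T,
      InteractionBound (coulomb c) (φ t) ((sphereArea * D + 1) * (N : ℝ)⁻¹) := fun t ht =>
    interactionBound_coulomb hN hc hD.le (orthonormal_of_isHartreeSolution hw hφ h0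
      (by positivity) hkin hD.le hρ ht) (hρ t ht)
  refine ⟨fun t ht => iSup_le (hI t ht).bound, fun hH ψ hψ h1 ha t ht => ?_⟩
  obtain ⟨n, rfl⟩ := Nat.exists_eq_add_one.2 hN
  obtain ⟨τ, M, Q, hτ, -, hsub, hb, -⟩ := exists_hartreeBound hw hφ hD.le hρ ht
  have hτ0 : 0 ≤ τ := ht.1.trans hτ.le
  have e : ∀ s ∈ Set.Icc 0 τ, Set.IccExtend hτ0 (fun s => ψ s) s = ψ s := fun s hs =>
    Set.IccExtend_of_mem hτ0 (fun s : Set.Icc 0 τ => ψ s) hs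
  have e0 := e 0 ⟨le_rfl, hτ0⟩
  have main := hb.alphaN_le (fun s hs => hI s (hsub ⟨hs.1, hs.2.le⟩)) hH
    (hψ.weakSolution hτ0 hsub) (by rw [e0, h1]) (by rwa [e0]) ⟨ht.1, hτ⟩
    ((Set.Icc_subset_Icc_right hτ.le).trans hsub)
  have hn : ((n + 1 : ℕ) : ℝ) ≠ 0 := by positivity
  rwa [e0, e t ⟨ht.1, hτ.le⟩, mul_comm (sphereArea * D + 1), mul_inv_cancel_left₀ hn] at main
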